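/- Let $\mathscr A$ be a unital $C^*$-algebra, $\alpha$ a strongly continuous action of $\mathbb R^n$ on $\mathscr A$ by $*$-automorphisms, and $B=(B_{kl})$ a skew-symmetric real $n\times n$ matrix, which defines the twist $e(x,y)=e^{i\langle Bx,y\rangle}$. Let $\mathscr A^\infty$ be the algebra of those $a\in\mathscr A$ for which $t\mapsto\alpha_t(a)$ is smooth, with $\delta^\gamma a=i^{-|\gamma|}\partial_t^\gamma|_{t=0}\alpha_t(a)$ for $\gamma\in\mathbb N_0^n$ and with the Fréchet topology of the seminorms $a\mapsto\|\delta^\gamma a\|$. For $m\in\mathbb R$ let $S^m$ be the space of smooth maps $f:\mathbb R^n\to\mathscr A^\infty$ such that for all $\beta,\gamma\in\mathbb N_0^n$ there is $C>0$ with $\|\delta^\gamma\partial_\xi^\beta f(\xi)\|\le C(1+|\xi|^2)^{(m-|\beta|)/2}$ for all $\xi$. For $f\in S^m$ and $f_j\in S^{m-j}$ write $f\sim\sum_{j\ge0}f_j$ if $f-\sum_{j<N}f_j\in S^{m-N}$ for all $N\ge1$. Let $CS^m$ be the space of classical symbols, i.e. of those $f\in S^m$ with $f\sim\sum_{j\ge0}f_{m-j}$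 for some smooth maps $f_{m-j}:\mathbb R^n\to\mathscr A^\infty$ that are homogeneous of degree $m-j$ in the sense that $f_{m-j}(\lambda\xi)=\lambda^{m-j}f_{m-j}(\xi)$ for $\lambda\ge1$, $|\xi|\ge1$. Let $f\in CS^m$ with $f\sim\sum_{j\ge0}f_{m-j}$ and $g\in CS^{m'}$ with $g\sim\sum_{j\ge0}g_{m'-j}$ be classical symbols with such expansions. Then the $\mathscr A^\infty$-valued oscillatory integral $$(f\sharp g)(\xi)=(2\pi)^{-n}\int\Big(\int e^{-i\langle y,\eta\rangle}f(\eta+\xi)\,\alpha_{-y}\big(g(\xi+By)\big)\,dy\Big)d\eta$$ exists for every $\xi\in\mathbb R^n$ (for every Schwartz function $\chi$ on $\mathbb R^{n}\times\mathbb R^n$ with $\chi(0,0)=1$, the integrals with the extra factor $\chi(\varepsilon y,\varepsilon\eta)$ converge in $\mathscr A^\infty$ to $(f\sharp g)(\xi)$ as $\varepsilon\to0^+$), and $f\sharp g\in CS^{m+m'}$. Moreover $f\sharp g\sim\sum_{j\ge0}(f\sharp g)_{m+m'-j}$ with the smooth homogeneous parts $$(f\sharp g)_{m+m'-j}(\xi)=\sum_{k+l+|\alpha|=j}\frac{(-i)^{|\alpha|}}{\alpha!}\,(\partial_\xi^\alpha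 f_{m-k})(\xi)\;g^{B,\alpha}_{m'-l}(\xi),\qquad j\ge0,$$ where the sum is over $k,l\in\mathbb N_0$ and $\alpha\in\mathbb N_0^n$, and $$g^{B,\alpha}_{m'-l}(\xi)=\sum_{k=0}^{\min(l,|\alpha|)}\ \sum_{\beta+\gamma=\alpha,\ |\gamma|=k}\binom{\alpha}{\beta}(-i)^{|\beta|}\,\delta^\beta\partial_{B,\xi}^\gamma g_{m'-l+k}(\xi),\qquad \partial_{B,\xi_j}=\sum_{k=1}^nB_{kj}\partial_{\xi_k},\quad \partial_{B,\xi}^\gamma=\partial_{B,\xi_1}^{\gamma_1}\cdots\partial_{B,\xi_n}^{\gamma_n}.$$ In particular, $(f\sharp g)_{m+m'}(\xi)=f_m(\xi)\,g_{m'}(\xi)$. -/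

import Mathlib

open scoped ContDiff Matrix SchwartzMap

/-- A twisted `C*`-dynamical system `(A, ℝⁿ, α, e)` over a unital `C*`-algebra `A`: a strongly
continuous action `α` of `ℝⁿ` on `A` by `*`-automorphisms, and a skew-symmetric real matrix `B`,
which encodes the twist `e(x, y) = exp (i ⟨B x, y⟩)`. -/
structure TwistedSystem (n : ℕ) (A : Type*) [CStarAlgebra A] where
  /-- the action -/
  act : EuclideanSpace ℝ (Fin n) → (A ≃⋆ₐ[ℂ] A)
  act_zero : ∀ a, act 0 a = a
  act_add : ∀ s t a, act (s + t) a = act s (act t a)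
  act_continuous : ∀ a, Continuous fun t => act t a
  /-- the matrix of the twist -/
  B : Matrix (Fin n) (Fin n) ℝ
  B_skew : Bᵀ = -B

noncomputable section

namespace PsiCalculus

/-! ### Multi-indices -/

/-- The length `|α|` of a multi-index. -/
def len {n : ℕ} (a : Fin n → ℕ) : ℕ := ∑ i, a i

/-- The factorial `α!` of a multi-index. -/
def fact {n : ℕ} (a : Fin n → ℕ) : ℕ := ∏ i, (a i).factorial

/-- The binomial coefficient of two multi-indices. -/
def binom {n : ℕ} (a b : Fin n → ℕ) : ℕ := ∏ i, (a i).choose (b i)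

/-- `T₁^{α₁} ⋯ Tₙ^{αₙ} f` for operators `T₁, …, Tₙ`. -/
def multiPow {n : ℕ} {X : Type*} (T : Fin n → X → X) (a : Fin n → ℕ) (f : X) : X :=
  (List.finRange n).foldr (fun j F => (T j)^[a j] F) f

/-! ### Partial derivatives -/

section Derivatives

variable {n : ℕ} {A : Type*} [NormedAddCommGroup A] [NormedSpace ℝ A]

/-- The partial derivative `∂_j f`. -/
def partialD (j : Fin n) (f : EuclideanSpace ℝ (Fin n) → A) : EuclideanSpace ℝ (Fin n) → A :=
  fun x => fderiv ℝ f x (EuclideanSpace.single j 1)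

/-- The iterated partial derivative `∂^α f = ∂₁^{α₁} ⋯ ∂ₙ^{αₙ} f`. -/
def partialPow (a : Fin n → ℕ) (f : EuclideanSpace ℝ (Fin n) → A) :
    EuclideanSpace ℝ (Fin n) → A :=
  multiPow partialD a f

/-- `∂_{B,ξ_j} f = ∑_k B_{kj} ∂_{ξ_k} f`, the derivative of `f (ξ + B x)` in `x_j` at `x = 0`. -/
def twistedD (B : Matrix (Fin n) (Fin n) ℝ) (j : Fin n) (f : EuclideanSpace ℝ (Fin n) → A) :
    EuclideanSpace ℝ (Fin n) → A :=
  fun x => ∑ k, B k j • partialD k f x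

/-- `∂_{B,ξ}^α f = ∂_{B,ξ₁}^{α₁} ⋯ ∂_{B,ξₙ}^{αₙ} f`. -/
def twistedPow (B : Matrix (Fin n) (Fin n) ℝ) (a : Fin n → ℕ)
    (f : EuclideanSpace ℝ (Fin n) → A) : EuclideanSpace ℝ (Fin n) → A :=
  multiPow (twistedD B) a f

end Derivatives

end PsiCalculus

namespace TwistedSystem

open PsiCalculus

variable {n : ℕ} {A : Type*} [CStarAlgebra A] (D : TwistedSystem n A)

/-! ### The smooth subalgebra -/

/-- `a ∈ A^∞`: the orbit map `t ↦ α_t(a)` is smooth. -/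
def IsSmoothElt (a : A) : Prop := ContDiff ℝ ∞ fun t => D.act t a

/-- `δ^γ a = i^{-|γ|} ∂_t^γ|_{t=0} α_t(a)`. -/
def delta (c : Fin n → ℕ) (a : A) : A :=
  (Complex.I⁻¹ ^ len c) • partialPow c (fun t => D.act t a) 0

/-- Convergence in the Fréchet space `A^∞`, with the seminorms `a ↦ ‖δ^γ a‖`. -/
def TendstoSmooth {ι : Type*} (u : ι → A) (l : Filter ι) (a : A) : Prop :=
  D.IsSmoothElt a ∧ (∀ᶠ i in l, D.IsSmoothElt (u i)) ∧
    ∀ c : Fin n → ℕ, Filter.Tendsto (fun i => ‖D.delta c (u i - a)‖) l (nhds 0)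

/-- `f : ℝⁿ → A^∞` is smooth. The topology of `A^∞` is the one that the maps `δ^γ : A^∞ → A`
induce, and `a ↦ (δ^γ a)_γ` has closed range in the product of copies of `A`; so `f` is smooth as
a map into `A^∞` if and only if every `δ^γ ∘ f : ℝⁿ → A` is smooth, and then all the partial
derivatives of `f` take their values in `A^∞`. -/
structure IsSmoothMap (f : EuclideanSpace ℝ (Fin n) → A) : Prop where
  mem : ∀ (b : Fin n → ℕ) (x : EuclideanSpace ℝ (Fin n)), D.IsSmoothElt (partialPow b f x)
  smooth : ∀ c : Fin n → ℕ, ContDiff ℝ ∞ fun x => D.delta c (f x)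

/-! ### Symbols -/

/-- The symbol space `S^m(ℝⁿ, A^∞)`. -/
structure IsSymbol (m : ℝ) (f : EuclideanSpace ℝ (Fin n) → A) : Prop where
  smooth : D.IsSmoothMap f
  bound : ∀ a b : Fin n → ℕ, ∃ C : ℝ, 0 < C ∧ ∀ x : EuclideanSpace ℝ (Fin n),
    ‖D.delta a (partialPow b f x)‖ ≤ C * (1 + ‖x‖ ^ 2) ^ ((m - len b) / 2)

/-- `f ∼ ∑_j f_j` with `f ∈ S^m` and `f_j ∈ S^{m-j}`. -/
structure HasExpansion (m : ℝ) (f : EuclideanSpace ℝ (Fin n) → A)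
    (F : ℕ → EuclideanSpace ℝ (Fin n) → A) : Prop where
  symbol : D.IsSymbol m f
  symbol_term : ∀ j : ℕ, D.IsSymbol (m - j) (F j)
  remainder : ∀ N : ℕ, 1 ≤ N →
    D.IsSymbol (m - N) fun x => f x - ∑ j ∈ Finset.range N, F j x

/-- `f(λ ξ) = λ^m f(ξ)` for `λ ≥ 1` and `|ξ| ≥ 1`. -/
def IsHomogeneous {n : ℕ} {A : Type*} [CStarAlgebra A] (m : ℝ)
    (f : EuclideanSpace ℝ (Fin n) → A) : Prop :=
  ∀ (r : ℝ) (x : EuclideanSpace ℝ (Fin n)), 1 ≤ r → 1 ≤ ‖x‖ → f (r • x) = (r ^ m : ℝ) • f x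

/-- `f ∼ ∑_j f_{m-j}` where each `f_{m-j}` (written `F j`) is smooth and homogeneous of
degree `m - j`. -/
structure HasClassicalExpansion (m : ℝ) (f : EuclideanSpace ℝ (Fin n) → A)
    (F : ℕ → EuclideanSpace ℝ (Fin n) → A) : Prop where
  smooth_term : ∀ j : ℕ, D.IsSmoothMap (F j)
  homogeneous_term : ∀ j : ℕ, IsHomogeneous (m - j) (F j)
  expansion : D.HasExpansion m f F

/-- The space `CS^m(ℝⁿ, A^∞)` of classical symbols. -/
def IsClassicalSymbol (m : ℝ) (f : EuclideanSpace ℝ (Fin n) → A) : Prop :=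
  ∃ F : ℕ → EuclideanSpace ℝ (Fin n) → A, D.HasClassicalExpansion m f F

/-! ### Oscillatory integrals and the composition product -/

/-- `(2π)⁻ⁿ ∫ (∫ e^{-i⟨y,η⟩} χ(ε y, ε η) a(y, η) dy) dη`. -/
def regularizedIntegral {n : ℕ} {A : Type*} [CStarAlgebra A]
    (χ : 𝓢(EuclideanSpace ℝ (Fin n) × EuclideanSpace ℝ (Fin n), ℂ))
    (a : EuclideanSpace ℝ (Fin n) → EuclideanSpace ℝ (Fin n) → A) (ε : ℝ) : A :=
  ((2 * Real.pi) ^ n)⁻¹ • ∫ η : EuclideanSpace ℝ (Fin n), ∫ y : EuclideanSpace ℝ (Fin n),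
    (Complex.exp (-(Complex.I * (inner ℝ y η : ℝ))) * χ (ε • y, ε • η)) • a y η

/-- `v` is the value of the `A^∞`-valued oscillatory integral
`(2π)⁻ⁿ ∫ (∫ e^{-i⟨y,η⟩} a(y, η) dy) dη`: for every Schwartz function `χ` with `χ(0, 0) = 1`,
the integrals regularized by `χ(ε y, ε η)` converge to `v` in `A^∞` as `ε → 0+`. -/
def HasOscIntegral (a : EuclideanSpace ℝ (Fin n) → EuclideanSpace ℝ (Fin n) → A) (v : A) : Prop :=
  ∀ χ : 𝓢(EuclideanSpace ℝ (Fin n) × EuclideanSpace ℝ (Fin n), ℂ), χ (0, 0) = 1 →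
    D.TendstoSmooth (regularizedIntegral χ a) (nhdsWithin 0 (Set.Ioi 0)) v

open Classical in
/-- The value of the oscillatory integral (and `0` if there is none). -/
def oscIntegral (a : EuclideanSpace ℝ (Fin n) → EuclideanSpace ℝ (Fin n) → A) : A :=
  if h : ∃ v, D.HasOscIntegral a v then h.choose else 0

/-- The amplitude `(y, η) ↦ f(η + ξ) α_{-y}(g(ξ + B y))`. -/
def compAmplitude (f g : EuclideanSpace ℝ (Fin n) → A) (ξ : EuclideanSpace ℝ (Fin n)) :
    EuclideanSpace ℝ (Fin n) → EuclideanSpace ℝ (Fin n) → A :=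
  fun y η => f (η + ξ) * D.act (-y) (g (ξ + WithLp.toLp 2 (D.B *ᵥ y.ofLp)))

/-- The composition product
`f ♯ g (ξ) = (2π)⁻ⁿ ∫ (∫ e^{-i⟨y,η⟩} f(η + ξ) α_{-y}(g(ξ + B y)) dy) dη`. -/
def sharp (f g : EuclideanSpace ℝ (Fin n) → A) : EuclideanSpace ℝ (Fin n) → A :=
  fun ξ => D.oscIntegral (D.compAmplitude f g ξ)

/-! ### The homogeneous parts -/

/-- `g_{m-l}^{B,α} = ∑_{k ≤ min(l, |α|)} ∑_{β+γ=α, |γ|=k}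
binom(α, β) (-i)^{|β|} δ^β ∂_{B,ξ}^γ g_{m-l+k}`, where `G j` stands for `g_{m-j}`.
These are the homogeneous parts of `g^{B,α}(ξ) = ∂_x^α|_{x=0} α_{-x}(g(ξ + B x))`. -/
def twistedPart (G : ℕ → EuclideanSpace ℝ (Fin n) → A) (a : Fin n → ℕ) (l : ℕ) :
    EuclideanSpace ℝ (Fin n) → A :=
  fun ξ => ∑ k ∈ Finset.range (min l (len a) + 1),
    ∑ c ∈ (Finset.Iic a).filter (fun c => len c = k),
      ((binom a (a - c) : ℂ) * (-Complex.I) ^ len (a - c)) •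
        D.delta (a - c) (twistedPow D.B c (G (l - k)) ξ)

/-- `(f ♯ g)_{m+m'-j} = ∑_{k+l+|α|=j} (-i)^{|α|}/α! (∂_ξ^α f_{m-k}) g_{m'-l}^{B,α}`, where `F k`
and `G l` stand for `f_{m-k}` and `g_{m'-l}`. -/
def sharpPart (F G : ℕ → EuclideanSpace ℝ (Fin n) → A) (j : ℕ) :
    EuclideanSpace ℝ (Fin n) → A :=
  fun ξ => ∑ p ∈ Finset.HasAntidiagonal.antidiagonal j,
    ∑ q ∈ Finset.HasAntidiagonal.antidiagonal p.1,
    ∑ a ∈ Finset.piAntidiag (Finset.univ : Finset (Fin n)) p.2,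
      ((-Complex.I) ^ len a / (fact a : ℂ)) •
        (partialPow a (F q.1) ξ * D.twistedPart G a q.2 ξ)

end TwistedSystem

end

/-! Let Q((t,ξ),(s,ζ)) = α_t(f ξ) α_s(g ζ) (`pairFun`). With w = (y,η), the amplitude at ξ is Q(x +
L₀w + L₁w), where x is the diagonal point over (0,ξ), L₀w = ∑ y_j q_j moves only the second factor,
and L₁w = ∑ η_j p_j moves only the first. Hence f ♯ g is the value at s = 1 of the oscillatory
integrals of Q(x + L₀w + s L₁w). Since η_j e^{-i⟨y,η⟩} = i ∂_{y_j} e^{-i⟨y,η⟩}, differentiating in s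
and integrating by parts replaces Q by TQ, where T = -i ∑_j ∂_{p_j} ∂_{q_j}
(`IsPhase.hasDerivAt_oscOp`). At s = 0 the amplitude depends on y alone and the integral returns
Q(x) (`oscOp_fst`). Taylor's formula in s gives f ♯ g = ∑_{k<N} T^k Q / k! + R_N, with R_N
controlled by the same integrals of T^N Q for s in [0,1] (`norm_oscRemainder_le`).

The analytic input is one uniform estimate, `IsPhase.norm_integral_smul_le`: repeated integration by
parts bounds an integral against the phase by the weight of the amplitude, whatever power of |w| the
amplitude grows with. Applied to differences of cutoffs it yields convergence, independence of the
cutoff, and a rate O(ε) that is uniform in parameters and so allows differentiation under the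
oscillatory integral.

Smoothness into A^∞ is ordinary smoothness of (t,ξ) ↦ α_t(f ξ) (`isSmoothMap_iff`); there δ_j and
∂_j become directional derivatives, and all commutation rules become symmetry of second derivatives.
T differentiates f once, so it lowers the total order by one. All operators involved commute with
derivatives of Q and with the diagonal action, so a bound on the size of R_N, valid for every Q of
the class, already contains the bounds on all δ^γ ∂^β R_N (`IsPairOperator.isSymbol`). The same
commutation turns convergence in A^∞ into convergence in norm.

The rest is algebra: T^k Q / k! is a multinomial sum of products of ∂^a f with (-iδ + ∂_B)^a g, the
power of -iδ + ∂_B is a binomial sum of commuting operators, and the classical expansions of f and g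
are inserted and regrouped by degree (`HasClassicalExpansion.mul`,
`HasClassicalExpansion.of_layers`). -/

section

open scoped ContDiff Matrix SchwartzMap

noncomputable section

/-! ### Families of smooth functions with derivatives dominated by a weight -/

section BoundedFamily

variable {ι κ : Type*} {V X A A' A'' : Type*}
  [NormedAddCommGroup V] [NormedSpace ℝ V] [NormedAddCommGroup X] [NormedSpace ℝ X]
  [NormedAddCommGroup A''] [NormedSpace ℝ A''] [NormedAddCommGroup A'] [NormedSpace ℝ A']
  [NormedAddCommGroup A] [NormedSpace ℝ A]

/-- A family of smooth functions `b i` all of whose iterated derivatives are dominated, uniformly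
in `i`, by a multiple of the weight `R i`. -/
structure BoundedFamily (R : ι → V → ℝ) (b : ι → V → A) : Prop where
  smooth : ∀ i, ContDiff ℝ ∞ (b i)
  nonneg : ∀ i w, 0 ≤ R i w
  bound : ∀ k : ℕ, ∃ C : ℝ, 0 ≤ C ∧ ∀ i w, ‖iteratedFDeriv ℝ k (b i) w‖ ≤ C * R i w

namespace BoundedFamily

variable {R R' : ι → V → ℝ} {b c : ι → V → A}

theorem of_bound (hs : ∀ i, ContDiff ℝ ∞ (b i)) (hR : ∀ i w, 0 ≤ R i w)
    (h : ∀ k : ℕ, ∃ C : ℝ, ∀ i w, ‖iteratedFDeriv ℝ k (b i) w‖ ≤ C * R i w) :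
    BoundedFamily R b := by
  refine ⟨hs, hR, fun k => ?_⟩
  obtain ⟨C, hC⟩ := h k
  exact ⟨max C 0, le_max_right _ _, fun i w => (hC i w).trans
    (mul_le_mul_of_nonneg_right (le_max_left _ _) (hR i w))⟩

theorem norm_le (h : BoundedFamily R b) : ∃ C : ℝ, 0 ≤ C ∧ ∀ i w, ‖b i w‖ ≤ C * R i w := by
  simpa using h.bound 0

theorem mono (h : BoundedFamily R b) (C : ℝ) (hR' : ∀ i w, 0 ≤ R' i w)
    (hRR' : ∀ i w, R i w ≤ C * R' i w) : BoundedFamily R' b := by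
  refine of_bound h.smooth hR' fun k => ?_
  obtain ⟨K, hK, hb⟩ := h.bound k
  refine ⟨K * C, fun i w => (hb i w).trans ?_⟩
  rw [mul_assoc]
  exact mul_le_mul_of_nonneg_left (hRR' i w) hK

theorem reindex (h : BoundedFamily R b) (e : κ → ι) :
    BoundedFamily (fun i => R (e i)) (fun i => b (e i)) := by
  refine ⟨fun i => h.smooth _, fun i => h.nonneg _, fun k => ?_⟩
  obtain ⟨K, hK, hb⟩ := h.bound k
  exact ⟨K, hK, fun i w => hb _ w⟩

theorem zero (hR : ∀ i w, 0 ≤ R i w) : BoundedFamily R (fun _ _ => (0 : A)) := by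
  refine of_bound (fun i => contDiff_const) hR fun k => ⟨0, fun i w => ?_⟩
  simp [iteratedFDeriv_fun_zero]

theorem add (h : BoundedFamily R b) (h' : BoundedFamily R c) :
    BoundedFamily R (fun i w => b i w + c i w) := by
  refine of_bound (fun i => (h.smooth i).add (h'.smooth i)) h.nonneg fun k => ?_
  obtain ⟨K, hK, hb⟩ := h.bound k
  obtain ⟨K', hK', hb'⟩ := h'.bound k
  refine ⟨K + K', fun i w => ?_⟩
  rw [show (fun w => b i w + c i w) = b i + c i from rfl,
    iteratedFDeriv_add_apply ((h.smooth i).of_le (mod_cast le_top)).contDiffAt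
      ((h'.smooth i).of_le (mod_cast le_top)).contDiffAt, add_mul]
  exact (norm_add_le _ _).trans (add_le_add (hb i w) (hb' i w))

theorem clm_comp (h : BoundedFamily R b) (T : A →L[ℝ] A') :
    BoundedFamily R (fun i w => T (b i w)) := by
  refine of_bound (fun i => T.contDiff.comp (h.smooth i)) h.nonneg fun k => ?_
  obtain ⟨K, hK, hb⟩ := h.bound k
  refine ⟨‖T‖ * K, fun i w => ?_⟩
  refine (T.norm_iteratedFDeriv_comp_left (h.smooth i).contDiffAt (mod_cast le_top)).trans ?_
  rw [mul_assoc]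
  exact mul_le_mul_of_nonneg_left (hb i w) (norm_nonneg _)

theorem const_smul {𝕜 : Type*} [NormedField 𝕜] [NormedSpace 𝕜 A] [SMulCommClass ℝ 𝕜 A]
    (h : BoundedFamily R b) (r : 𝕜) :
    BoundedFamily R (fun i w => r • b i w) :=
  h.clm_comp (r • ContinuousLinearMap.id ℝ A)

theorem neg (h : BoundedFamily R b) : BoundedFamily R (fun i w => -b i w) :=
  h.clm_comp (-ContinuousLinearMap.id ℝ A)

theorem sub (h : BoundedFamily R b) (h' : BoundedFamily R c) :
    BoundedFamily R (fun i w => b i w - c i w) := by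
  simpa only [sub_eq_add_neg] using h.add h'.neg

theorem sum {J : Type*} (s : Finset J) {d : J → ι → V → A} (hR : ∀ i w, 0 ≤ R i w)
    (h : ∀ j ∈ s, BoundedFamily R (d j)) :
    BoundedFamily R (fun i w => ∑ j ∈ s, d j i w) := by
  classical
  induction s using Finset.induction_on with
  | empty => simpa using zero hR
  | insert j s hj ih =>
    simp only [Finset.sum_insert hj]
    exact (h j (Finset.mem_insert_self _ _)).add
      (ih fun i hi => h i (Finset.mem_insert_of_mem hi))

theorem bilinear (B : A →L[ℝ] A' →L[ℝ] A'') {c : ι → V → A'} (h : BoundedFamily R b)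
    (h' : BoundedFamily R' c) :
    BoundedFamily (fun i w => R i w * R' i w) (fun i w => B (b i w) (c i w)) := by
  refine of_bound (fun i => ?_) (fun i w => mul_nonneg (h.nonneg i w) (h'.nonneg i w)) fun k => ?_
  · exact B.isBoundedBilinearMap.contDiff.comp ((h.smooth i).prodMk (h'.smooth i))
  choose K hK hb using h.bound
  choose K' hK' hb' using h'.bound
  refine ⟨‖B‖ * ∑ i ∈ Finset.range (k + 1), (k.choose i : ℝ) * K i * K' (k - i), fun i w => ?_⟩
  refine (B.norm_iteratedFDeriv_le_of_bilinear (h.smooth i) (h'.smooth i) w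
    (mod_cast le_top)).trans ?_
  rw [mul_assoc]
  refine mul_le_mul_of_nonneg_left ?_ (norm_nonneg B)
  rw [Finset.sum_mul]
  refine Finset.sum_le_sum fun j _ => ?_
  calc _ ≤ (k.choose j : ℝ) * (K j * R i w) * (K' (k - j) * R' i w) := by
        gcongr
        · exact mul_nonneg (Nat.cast_nonneg _) (mul_nonneg (hK _) (h.nonneg i w))
        · exact hb _ _ _
        · exact hb' _ _ _
    _ = _ := by ring

theorem smul {b : ι → V → ℂ} [NormedSpace ℂ A] (h : BoundedFamily R b)
    (h' : BoundedFamily R' c) :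
    BoundedFamily (fun i w => R i w * R' i w) (fun i w => b i w • c i w) :=
  h.bilinear (ContinuousLinearMap.lsmul ℝ ℂ) h'

theorem fderiv (h : BoundedFamily R b) : BoundedFamily R (fun i => fderiv ℝ (b i)) := by
  refine ⟨fun i => (h.smooth i).fderiv_right (by simp), h.nonneg, fun k => ?_⟩
  obtain ⟨K, hK, hb⟩ := h.bound (k + 1)
  exact ⟨K, hK, fun i w => by rw [norm_iteratedFDeriv_fderiv]; exact hb i w⟩

theorem fderiv_apply (h : BoundedFamily R b) (e : V) :
    BoundedFamily R (fun i w => _root_.fderiv ℝ (b i) w e) :=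
  h.fderiv.clm_comp (ContinuousLinearMap.apply ℝ A e)

/-- Serves functions whose size is estimated by hand (linear maps, differences of cutoffs) while
their derivative is already a known family. -/
theorem of_fderiv (hs : ∀ i, ContDiff ℝ ∞ (b i)) {C : ℝ} (hb : ∀ i w, ‖b i w‖ ≤ C * R i w)
    (h : BoundedFamily R (fun i => _root_.fderiv ℝ (b i))) : BoundedFamily R b := by
  refine of_bound hs h.nonneg fun k => ?_
  cases k with
  | zero => exact ⟨C, by simpa using hb⟩
  | succ k =>
    obtain ⟨K, hK, hb⟩ := h.bound k
    exact ⟨K, fun i w => by rw [← norm_iteratedFDeriv_fderiv]; exact hb i w⟩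

theorem comp_affine {R : ι → X → ℝ} {Q : ι → X → A} (h : BoundedFamily R Q) (x : ι → X)
    (L : ι → V →L[ℝ] X) {K : ℝ} (hL : ∀ i, ‖L i‖ ≤ K) :
    BoundedFamily (fun i w => R i (x i + L i w)) (fun i w => Q i (x i + L i w)) := by
  refine of_bound (fun i => ?_) (fun i w => h.nonneg _ _) fun k => ?_
  · exact (h.smooth i).comp (contDiff_const.add (L i).contDiff)
  obtain ⟨C, hC, hb⟩ := h.bound k
  refine ⟨C * K ^ k, fun i w => ?_⟩
  have h1 : (fun w => Q i (x i + L i w)) = (fun z => Q i (x i + z)) ∘ L i := rfl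
  have h2 : ContDiff ℝ ∞ (fun z => Q i (x i + z)) := (h.smooth i).comp (contDiff_const.add contDiff_id)
  rw [h1, (L i).iteratedFDeriv_comp_right h2 w (i := k) (mod_cast le_top),
    iteratedFDeriv_comp_add_left]
  refine (ContinuousMultilinearMap.norm_compContinuousLinearMap_le _ _).trans ?_
  rw [Finset.prod_const, Finset.card_univ, Fintype.card_fin]
  calc _ ≤ (C * R i (x i + L i w)) * K ^ k := by
        gcongr
        · exact mul_nonneg hC (h.nonneg _ _)
        · exact hb _ _
        · exact hL i
    _ = _ := by ring

end BoundedFamily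

end BoundedFamily

end

end

section

open scoped ContDiff Matrix SchwartzMap LineDeriv
open MeasureTheory

set_option linter.unusedSectionVars false

noncomputable section

/-! ### Power weights and the multiplier 1 / (1 + ∑ l_j²) -/

section Weights

variable {ι : Type*} {V A : Type*} [NormedAddCommGroup V] [NormedSpace ℝ V]
  [NormedAddCommGroup A] [NormedSpace ℝ A]

theorem BoundedFamily.hasTemperateGrowth {R : ι → ℝ} {p : ℝ} {b : ι → V → A}
    (h : BoundedFamily (fun i w => R i * (1 + ‖w‖) ^ p) b) (i : ι) :
    (b i).HasTemperateGrowth := by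
  refine ⟨h.smooth i, fun k => ?_⟩
  obtain ⟨C, hC, hb⟩ := h.bound k
  have hR : 0 ≤ R i := by simpa using h.nonneg i 0
  refine ⟨⌈p⌉₊, C * R i, fun w => (hb i w).trans ?_⟩
  rw [mul_assoc, ← Real.rpow_natCast]
  gcongr
  · simp
  · exact Nat.le_ceil p

theorem boundedFamily_clm (T : V →L[ℝ] A) :
    BoundedFamily (fun (_ : ι) w => 1 * (1 + ‖w‖) ^ (1 : ℝ)) (fun _ => T) := by
  have hd : fderiv ℝ T = fun _ => T := by ext1 w; exact T.fderiv
  refine BoundedFamily.of_fderiv (fun _ => T.contDiff) (C := ‖T‖) (fun _ w => ?_) ?_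
  · simp only [Real.rpow_one, one_mul]
    exact (T.le_opNorm w).trans (by gcongr; simp)
  · rw [hd]
    refine BoundedFamily.of_bound (fun _ => contDiff_const) (fun _ w => by positivity) fun k => ?_
    refine ⟨‖T‖, fun _ w => ?_⟩
    cases k with
    | zero =>
      simp only [norm_iteratedFDeriv_zero, Real.rpow_one, one_mul]
      exact le_mul_of_one_le_right (norm_nonneg _) (by simp)
    | succ k =>
      rw [iteratedFDeriv_succ_const]
      simp only [Pi.zero_apply, norm_zero]
      positivity

variable {J : Type*} [Fintype J] (l : J → V →L[ℝ] ℝ)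

/-- `1 / (1 + ∑ j, (l j w) ^ 2)`. -/
def invQuad (w : V) : ℝ := (1 + ∑ j, (l j w) ^ 2)⁻¹

theorem one_le_quad (w : V) : 1 ≤ 1 + ∑ j, (l j w) ^ 2 :=
  le_add_of_nonneg_right (Finset.sum_nonneg fun _ _ => sq_nonneg _)

theorem contDiff_invQuad : ContDiff ℝ ∞ (invQuad l) := by
  refine ContDiff.inv ?_ fun w => (zero_lt_one.trans_le (one_le_quad l w)).ne'
  exact contDiff_const.add (ContDiff.sum fun j _ => (l j).contDiff.pow 2)

/-- The derivative is expressed through `invQuad` itself, as its square times a linear map; this is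
what makes an induction on the order of differentiation close up. -/
theorem fderiv_invQuad : fderiv ℝ (invQuad l) =
    fun w => (invQuad l w * invQuad l w) • (-(∑ j, (2 : ℝ) • (l j).smulRight (l j))) w := by
  ext1 w
  have h1 : HasFDerivAt (fun w => 1 + ∑ j, (l j w) ^ 2) (∑ j, (2 * l j w) • l j) w := by
    refine HasFDerivAt.const_add _ (HasFDerivAt.fun_sum fun j _ => ?_)
    simpa using (l j).hasFDerivAt.pow (x := w) 2
  have h2 := (hasDerivAt_inv (zero_lt_one.trans_le (one_le_quad l w)).ne').comp_hasFDerivAt w h1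
  have h3 : HasFDerivAt (invQuad l) _ w := h2
  rw [h3.fderiv]
  ext v
  simp [invQuad, Finset.mul_sum, sq]
  refine Finset.sum_congr rfl fun j _ => by ring

/-- The constant 2 comes from (1 + t)² ≤ 2(1 + t²). -/
theorem invQuad_le (hl : ∀ w, ‖w‖ ^ 2 ≤ ∑ j, (l j w) ^ 2) (w : V) :
    ‖invQuad l w‖ ≤ 2 * (1 + ‖w‖) ^ (-2 : ℝ) := by
  have h0 := one_le_quad l w
  rw [invQuad, Real.norm_of_nonneg (by positivity), Real.rpow_neg (by positivity), Real.rpow_two,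
    ← div_eq_mul_inv, inv_eq_one_div, div_le_div_iff₀ (by positivity) (by positivity)]
  nlinarith [hl w, sq_nonneg (1 - ‖w‖)]

/-- Strong induction on the order: a derivative of order k + 1 is one of order k of `invQuad`² times
a linear map, and Leibniz only involves orders at most k, with total decay -2 - 2 + 1 < -2. -/
theorem boundedFamily_invQuad (hl : ∀ w, ‖w‖ ^ 2 ≤ ∑ j, (l j w) ^ 2) :
    BoundedFamily (fun (_ : ι) w => 1 * (1 + ‖w‖) ^ (-2 : ℝ)) (fun _ => invQuad l) := by
  refine BoundedFamily.of_bound (fun _ => contDiff_invQuad l) (fun _ w => by positivity)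
    fun k => ?_
  suffices H : ∃ C : ℝ, 0 ≤ C ∧ ∀ w, ‖iteratedFDeriv ℝ k (invQuad l) w‖ ≤
      C * (1 + ‖w‖) ^ (-2 : ℝ) by
    obtain ⟨C, -, hC⟩ := H
    exact ⟨C, fun _ w => by simpa using hC w⟩
  induction k using Nat.strong_induction_on with
  | _ k ih =>
  rcases k with _ | k
  · exact ⟨2, by norm_num, fun w => by simpa using invQuad_le l hl w⟩
  choose! C hC hb using ih
  set T := -(∑ j, (2 : ℝ) • (l j).smulRight (l j)) with hT
  choose K hK hTb using (boundedFamily_clm (ι := Unit) T).bound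
  have hs : ∀ N : ℕ, ContDiff ℝ N (invQuad l) := fun N => (contDiff_invQuad l).of_le (mod_cast le_top)
  refine ⟨∑ i ∈ Finset.range (k + 1), (k.choose i : ℝ) *
    (∑ j ∈ Finset.range (i + 1), (i.choose j : ℝ) * C j * C (i - j)) * K (k - i), ?_, fun w => ?_⟩
  · refine Finset.sum_nonneg fun i hi => ?_
    have hi' := Finset.mem_range.1 hi
    refine mul_nonneg (mul_nonneg (by positivity) (Finset.sum_nonneg fun j hj => ?_)) (hK _)
    have hj' := Finset.mem_range.1 hj
    exact mul_nonneg (mul_nonneg (by positivity) (hC _ (by omega))) (hC _ (by omega))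
  rw [← norm_iteratedFDeriv_fderiv, fderiv_invQuad]
  refine (norm_iteratedFDeriv_smul_le (N := k) ((hs k).mul (hs k)) T.contDiff w le_rfl).trans ?_
  have hw : 0 < 1 + ‖w‖ := by positivity
  rw [Finset.sum_mul]
  refine Finset.sum_le_sum fun i hi => ?_
  have hi' := Finset.mem_range.1 hi
  have h1 : ‖iteratedFDeriv ℝ i (fun w => invQuad l w * invQuad l w) w‖ ≤
      (∑ j ∈ Finset.range (i + 1), (i.choose j : ℝ) * C j * C (i - j)) *
        ((1 + ‖w‖) ^ (-2 : ℝ) * (1 + ‖w‖) ^ (-2 : ℝ)) := by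
    refine (norm_iteratedFDeriv_mul_le (hs i) (hs i) w le_rfl).trans ?_
    rw [Finset.sum_mul]
    refine Finset.sum_le_sum fun j hj => ?_
    have hj' := Finset.mem_range.1 hj
    calc _ ≤ (i.choose j : ℝ) * (C j * (1 + ‖w‖) ^ (-2 : ℝ)) *
          (C (i - j) * (1 + ‖w‖) ^ (-2 : ℝ)) := by
          gcongr
          · exact mul_nonneg (by positivity) (mul_nonneg (hC j (by omega)) (by positivity))
          · exact hb j (by omega) w
          · exact hb (i - j) (by omega) w
      _ = _ := by ring
  have h2 : ‖iteratedFDeriv ℝ (k - i) T w‖ ≤ K (k - i) * (1 + ‖w‖) := by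
    simpa using hTb (k - i) () w
  have h3 : 0 ≤ ∑ j ∈ Finset.range (i + 1), (i.choose j : ℝ) * C j * C (i - j) := by
    refine Finset.sum_nonneg fun j hj => ?_
    have hj' := Finset.mem_range.1 hj
    exact mul_nonneg (mul_nonneg (by positivity) (hC _ (by omega))) (hC _ (by omega))
  -- One of the two factors of decay absorbs the linear growth of `T`; the other one is the weight
  -- that is claimed.
  have h4 : (1 + ‖w‖) ^ (-2 : ℝ) * (1 + ‖w‖) ≤ 1 := by
    rw [← Real.rpow_add_one hw.ne']
    exact Real.rpow_le_one_of_one_le_of_nonpos (by simp) (by norm_num)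
  set S := ∑ j ∈ Finset.range (i + 1), (i.choose j : ℝ) * C j * C (i - j)
  calc _ ≤ (k.choose i : ℝ) * (S * ((1 + ‖w‖) ^ (-2 : ℝ) * (1 + ‖w‖) ^ (-2 : ℝ))) *
        (K (k - i) * (1 + ‖w‖)) := by gcongr
    _ = ((k.choose i : ℝ) * S * K (k - i) * (1 + ‖w‖) ^ (-2 : ℝ)) *
        ((1 + ‖w‖) ^ (-2 : ℝ) * (1 + ‖w‖)) := by ring
    _ ≤ _ := by
      have := hK (k - i)
      exact mul_le_of_le_one_right (by positivity) h4

end Weights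

/-! ### Integration by parts against an oscillating phase -/

section Phase

variable {W : Type*} [NormedAddCommGroup W] [NormedSpace ℝ W] [FiniteDimensional ℝ W]
  [MeasurableSpace W] [BorelSpace W] {μ : Measure W} [μ.IsAddHaarMeasure]
  {J : Type*} [Fintype J]

/-- A unimodular function `φ` with `∂_{e j} φ = -i (l j) φ` for linear forms `l j` that control the
norm. -/
structure IsPhase (φ : W → ℂ) (e : J → W) (l : J → W →L[ℝ] ℝ) : Prop where
  norm_eq : ∀ w, ‖φ w‖ = 1
  differentiable : Differentiable ℝ φ
  fderiv_eq : ∀ w j, fderiv ℝ φ w (e j) = -(Complex.I * (l j w : ℂ)) * φ w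
  norm_sq_le : ∀ w, ‖w‖ ^ 2 ≤ ∑ j, (l j w) ^ 2

namespace IsPhase

variable {φ : W → ℂ} {e : J → W} {l : J → W →L[ℝ] ℝ}
  {ι : Type*} {A : Type*} [NormedAddCommGroup A] [NormedSpace ℂ A]

theorem integrable_smul (hφ : IsPhase φ e l) {b : W → A} (hb : Integrable b μ) :
    Integrable (fun w => φ w • b w) μ := by
  refine hb.bdd_smul 1 hφ.differentiable.continuous.aestronglyMeasurable ?_
  filter_upwards with w
  rw [hφ.norm_eq]

/-- The derivative moves onto φ, where it becomes multiplication by -i l_j; a Schwartz factor leaves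
no boundary term. -/
theorem integral_fderiv_smul (hφ : IsPhase φ e l) (b : 𝓢(W, A)) (j : J) :
    ∫ w, φ w • fderiv ℝ b w (e j) ∂μ = Complex.I • ∫ w, φ w • (l j w : ℂ) • b w ∂μ := by
  have hlt : (fun w => (l j w : ℂ)).HasTemperateGrowth :=
    (Complex.ofRealCLM.comp (l j)).hasTemperateGrowth
  have h1 : (fun w => φ w • (l j w : ℂ) • b w) =
      fun w => φ w • SchwartzMap.smulLeftCLM A (fun w => (l j w : ℂ)) b w := by
    ext w; rw [SchwartzMap.smulLeftCLM_apply_apply hlt]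
  have hi : Integrable (fun w => φ w • (l j w : ℂ) • b w) μ := by
    rw [h1]; exact hφ.integrable_smul (SchwartzMap.integrable _)
  have h2 : ∀ w, fderiv ℝ φ w (e j) • b w = (-Complex.I) • (φ w • (l j w : ℂ) • b w) := by
    intro w
    rw [hφ.fderiv_eq]
    simp only [smul_smul]
    ring_nf
  rw [integral_smul_fderiv_eq_neg_fderiv_smul_of_integrable]
  · simp_rw [h2]
    rw [integral_smul, neg_smul, neg_neg]
  · simp_rw [h2]; exact hi.smul _
  · exact hφ.integrable_smul (SchwartzMap.integrable (SchwartzMap.evalCLM ℂ W A (e j) (SchwartzMap.fderivCLM ℂ W A b)))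
  · exact hφ.integrable_smul b.integrable
  · exact fun w _ => hφ.differentiable w
  · exact fun w _ => b.differentiableAt

/-- The transposed first order operator which reproduces integrals against the phase and gains one
power of decay. -/
def transposeOp (e : J → W) (l : J → W →L[ℝ] ℝ) (b : 𝓢(W, A)) : 𝓢(W, A) :=
  SchwartzMap.smulLeftCLM A (fun w => (invQuad l w : ℂ)) b -
    Complex.I • ∑ j, SchwartzMap.evalCLM ℂ W A (e j) (SchwartzMap.fderivCLM ℂ W A
      (SchwartzMap.smulLeftCLM A (fun w => ((invQuad l w * l j w : ℝ) : ℂ)) b))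

theorem boundedFamily_ofReal_invQuad (hφ : IsPhase φ e l) :
    BoundedFamily (fun (_ : ι) w => 1 * (1 + ‖w‖) ^ (-1 : ℝ))
      (fun _ w => (invQuad l w : ℂ)) := by
  refine ((boundedFamily_invQuad l hφ.norm_sq_le).clm_comp Complex.ofRealCLM).mono 1
    (fun _ w => by positivity) fun _ w => ?_
  simp only [one_mul]
  exact Real.rpow_le_rpow_of_exponent_le (by simp) (by norm_num)

theorem boundedFamily_ofReal_invQuad_mul (hφ : IsPhase φ e l) (j : J) :
    BoundedFamily (fun (_ : ι) w => 1 * (1 + ‖w‖) ^ (-1 : ℝ))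
      (fun _ w => ((invQuad l w * l j w : ℝ) : ℂ)) := by
  refine (((boundedFamily_invQuad l hφ.norm_sq_le).bilinear (ContinuousLinearMap.mul ℝ ℝ)
    (boundedFamily_clm (l j))).clm_comp Complex.ofRealCLM).mono 1
    (fun _ w => by positivity) fun _ w => ?_
  simp only [one_mul]
  rw [← Real.rpow_add (by positivity)]
  norm_num

theorem transposeOp_apply (hφ : IsPhase φ e l) (b : 𝓢(W, A)) (w : W) :
    transposeOp e l b w = (invQuad l w : ℂ) • b w -
      Complex.I • ∑ j, fderiv ℝ (fun w => ((invQuad l w * l j w : ℝ) : ℂ) • b w) w (e j) := by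
  have h1 := (hφ.boundedFamily_ofReal_invQuad (ι := Unit)).hasTemperateGrowth ()
  have h2 := fun j => (hφ.boundedFamily_ofReal_invQuad_mul (ι := Unit) j).hasTemperateGrowth ()
  rw [transposeOp, sub_apply, SchwartzMap.smulLeftCLM_apply_apply h1,
    smul_apply, sum_apply]
  simp_rw [SchwartzMap.evalCLM_apply_apply, SchwartzMap.fderivCLM_apply,
    SchwartzMap.smulLeftCLM_apply (h2 _)]

/-- Differentiation gains nothing for these families. The power comes from the multipliers `invQuad`
and `invQuad` · l_j, which are O((1 + ‖w‖)⁻¹) together with all their derivatives. -/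
theorem boundedFamily_transposeOp (hφ : IsPhase φ e l) {b : ι → 𝓢(W, A)} {R : ι → ℝ} {p : ℝ}
    (hb : BoundedFamily (fun i w => R i * (1 + ‖w‖) ^ p) (fun i => (b i : W → A))) :
    BoundedFamily (fun i w => R i * (1 + ‖w‖) ^ (p - 1))
      (fun i => (transposeOp e l (b i) : W → A)) := by
  have hR : ∀ i, 0 ≤ R i := fun i => by simpa using hb.nonneg i 0
  have hpos : ∀ i (w : W), 0 ≤ R i * (1 + ‖w‖) ^ (p - 1) := fun i w =>
    mul_nonneg (hR i) (by positivity)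
  have hw : ∀ i (w : W), 1 * (1 + ‖w‖) ^ (-1 : ℝ) * (R i * (1 + ‖w‖) ^ p) ≤
      1 * (R i * (1 + ‖w‖) ^ (p - 1)) := fun i w => by
    rw [sub_eq_neg_add, Real.rpow_add (by positivity)]
    exact le_of_eq (by ring)
  have : (fun i => (transposeOp e l (b i) : W → A)) = fun i w => (invQuad l w : ℂ) • b i w -
      Complex.I • ∑ j, fderiv ℝ (fun w => ((invQuad l w * l j w : ℝ) : ℂ) • b i w) w (e j) := by
    ext i w; exact hφ.transposeOp_apply (b i) w
  rw [this]
  refine BoundedFamily.sub ((hφ.boundedFamily_ofReal_invQuad.smul hb).mono 1 hpos hw)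
    (BoundedFamily.const_smul (BoundedFamily.sum _ hpos fun j _ => ?_) Complex.I)
  exact (((hφ.boundedFamily_ofReal_invQuad_mul j).smul hb).mono 1 hpos hw).fderiv_apply (e j)

/-- Insert 1 = `invQuad` + ∑_j l_j (l_j `invQuad`) and trade each outer factor l_j for a derivative
along e_j by `integral_fderiv_smul`. -/
theorem integral_transposeOp (hφ : IsPhase φ e l) (b : 𝓢(W, A)) :
    ∫ w, φ w • transposeOp e l b w ∂μ = ∫ w, φ w • b w ∂μ := by
  have h1 := (hφ.boundedFamily_ofReal_invQuad (ι := Unit)).hasTemperateGrowth ()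
  have h2 := fun j => (hφ.boundedFamily_ofReal_invQuad_mul (ι := Unit) j).hasTemperateGrowth ()
  set c : J → 𝓢(W, A) := fun j =>
    SchwartzMap.smulLeftCLM A (fun w => ((invQuad l w * l j w : ℝ) : ℂ)) b with hc
  have hcw : ∀ j w, c j w = ((invQuad l w * l j w : ℝ) : ℂ) • b w := fun j w =>
    SchwartzMap.smulLeftCLM_apply_apply (h2 j) b w
  have hl : ∀ j, (fun w => (l j w : ℂ)).HasTemperateGrowth := fun j =>
    (Complex.ofRealCLM.comp (l j)).hasTemperateGrowth
  have hi0 : Integrable (fun w => φ w • (invQuad l w : ℂ) • b w) μ := by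
    have := hφ.integrable_smul (μ := μ) (SchwartzMap.integrable
      (SchwartzMap.smulLeftCLM A (fun w => (invQuad l w : ℂ)) b))
    simpa only [SchwartzMap.smulLeftCLM_apply_apply h1] using this
  have hi1 : ∀ j, Integrable (fun w => φ w • fderiv ℝ (c j) w (e j)) μ := fun j =>
    hφ.integrable_smul (SchwartzMap.integrable
      (SchwartzMap.evalCLM ℂ W A (e j) (SchwartzMap.fderivCLM ℂ W A (c j))))
  have hi2 : ∀ j, Integrable (fun w => φ w • (l j w : ℂ) • c j w) μ := fun j => by
    have := hφ.integrable_smul (μ := μ) (SchwartzMap.integrable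
      (SchwartzMap.smulLeftCLM A (fun w => (l j w : ℂ)) (c j)))
    simpa only [SchwartzMap.smulLeftCLM_apply_apply (hl j)] using this
  have e1 : ∀ w, φ w • transposeOp e l b w =
      φ w • (invQuad l w : ℂ) • b w - Complex.I • ∑ j, φ w • fderiv ℝ (c j) w (e j) := by
    intro w
    rw [hφ.transposeOp_apply, smul_sub, smul_comm (φ w) Complex.I, Finset.smul_sum]
    simp only [← hcw]
  -- The partition of unity; the last l_j of each summand is kept outside `c j`, ready to be
  -- integrated by parts.
  have e2 : ∀ w, φ w • b w =
      φ w • (invQuad l w : ℂ) • b w + ∑ j, φ w • (l j w : ℂ) • c j w := by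
    intro w
    simp only [hcw, smul_smul, ← Finset.sum_smul, ← add_smul]
    congr 1
    have : (invQuad l w : ℂ) * (1 + ∑ j, (l j w : ℂ) ^ 2) = 1 := by
      have := inv_mul_cancel₀ (zero_lt_one.trans_le (one_le_quad l w)).ne'
      rw [invQuad]
      exact_mod_cast this
    calc φ w = φ w * ((invQuad l w : ℂ) * (1 + ∑ j, (l j w : ℂ) ^ 2)) := by rw [this, mul_one]
      _ = _ := by
        rw [mul_add, mul_add, mul_one, Finset.mul_sum, Finset.mul_sum]
        congr 1
        refine Finset.sum_congr rfl fun j _ => ?_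
        push_cast
        ring
  have hi3 : Integrable (fun w => Complex.I • ∑ j, φ w • fderiv ℝ (c j) w (e j)) μ :=
    (integrable_finsetSum _ fun j _ => hi1 j).smul _
  simp_rw [e1]
  conv_rhs => simp only [e2]
  rw [integral_sub hi0 hi3,
    integral_add hi0 (integrable_finsetSum _ fun j _ => hi2 j), integral_smul,
    integral_finsetSum _ fun j _ => hi1 j, integral_finsetSum _ fun j _ => hi2 j,
    sub_eq_add_neg, ← smul_neg, ← Finset.sum_neg_distrib, Finset.smul_sum]
  congr 1
  refine Finset.sum_congr rfl fun j _ => ?_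
  rw [hφ.integral_fderiv_smul, smul_neg, smul_smul, Complex.I_mul_I, neg_smul, one_smul, neg_neg]

/-- Each use of `transposeOp` leaves the integral unchanged and lowers p by one. Once p is below
minus the dimension, the integral converges absolutely, with a constant that does not depend on i.
-/
theorem norm_integral_smul_le (hφ : IsPhase φ e l) {b : ι → 𝓢(W, A)} {R : ι → ℝ} {p : ℝ}
    (hb : BoundedFamily (fun i w => R i * (1 + ‖w‖) ^ p) (fun i => (b i : W → A))) :
    ∃ C : ℝ, 0 ≤ C ∧ ∀ i, ‖∫ w, φ w • b i w ∂μ‖ ≤ C * R i := by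
  -- N counts the integrations by parts still to be made; N = 0 means that p is already integrable.
  obtain ⟨N, hN⟩ := exists_nat_gt (p + Module.finrank ℝ W)
  induction N generalizing p b with
  | zero =>
    obtain ⟨C, hC, hb⟩ := hb.norm_le
    have hint : Integrable (fun w : W => (1 + ‖w‖) ^ p) μ := by
      have := integrable_one_add_norm (μ := μ) (E := W) (r := -p) (by push_cast at hN; linarith)
      simpa using this
    refine ⟨C * ∫ w : W, (1 + ‖w‖) ^ p ∂μ,
      mul_nonneg hC (integral_nonneg fun w => by positivity), fun i => ?_⟩
    calc _ ≤ ∫ w : W, C * R i * (1 + ‖w‖) ^ p ∂μ := by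
          refine norm_integral_le_of_norm_le (hint.const_mul _) (Filter.Eventually.of_forall
            fun w => ?_)
          rw [norm_smul, hφ.norm_eq, one_mul, mul_assoc]
          exact hb i w
      _ = _ := by rw [integral_const_mul]; ring
  | succ N ih =>
    simp_rw [← hφ.integral_transposeOp (μ := μ) (b _)]
    exact ih (hφ.boundedFamily_transposeOp hb) (by push_cast at hN; linarith)

end IsPhase

end Phase

end

end

section

open scoped ContDiff Matrix SchwartzMap LineDeriv Topology
open MeasureTheory Filter

set_option linter.unusedSectionVars false

noncomputable section

/-! ### Rescaled Schwartz cutoffs -/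

section Cutoff

variable {ι : Type*} {W A : Type*} [NormedAddCommGroup W] [NormedSpace ℝ W]
  [NormedAddCommGroup A] [NormedSpace ℝ A]

theorem BoundedFamily.smul_family {R : ι → W → ℝ} {b : ι → W → A} (h : BoundedFamily R b)
    (r : ι → ℝ) (hr : ∀ i, 0 ≤ r i) :
    BoundedFamily (fun i w => r i * R i w) (fun i w => r i • b i w) := by
  refine BoundedFamily.of_bound (fun i => (h.smooth i).const_smul _)
    (fun i w => mul_nonneg (hr i) (h.nonneg i w)) fun k => ?_
  obtain ⟨C, hC, hb⟩ := h.bound k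
  refine ⟨C, fun i w => ?_⟩
  rw [show (fun w => r i • b i w) = r i • b i from rfl, iteratedFDeriv_const_smul_apply
    ((h.smooth i).of_le (mod_cast le_top)).contDiffAt, norm_smul, Real.norm_of_nonneg (hr i),
    mul_left_comm]
  exact mul_le_mul_of_nonneg_left (hb i w) (hr i)

theorem boundedFamily_schwartz (χ : 𝓢(W, A)) :
    BoundedFamily (fun (_ : ι) _ => 1) (fun _ => (χ : W → A)) :=
  BoundedFamily.of_bound (fun _ => χ.smooth ⊤) (fun _ _ => zero_le_one) fun k =>
    ⟨_, fun _ w => by simpa using SchwartzMap.norm_iteratedFDeriv_le_seminorm ℝ χ k w⟩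

theorem boundedFamily_cutoff (χ : 𝓢(W, A)) {ε : ι → ℝ} (hε : ∀ i, 0 ≤ ε i) (hε1 : ∀ i, ε i ≤ 1) :
    BoundedFamily (fun (_ : ι) _ => 1) (fun i w => χ (ε i • w)) := by
  have := (boundedFamily_schwartz (ι := ι) χ).comp_affine (fun _ => 0)
    (fun i => ε i • ContinuousLinearMap.id ℝ W) (K := 1) (fun i => ?_)
  · simpa using this
  · refine (norm_smul_le (ε i) (ContinuousLinearMap.id ℝ W)).trans ?_
    rw [Real.norm_of_nonneg (hε i)]
    exact mul_le_one₀ (hε1 i) (norm_nonneg _) ContinuousLinearMap.norm_id_le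

/-- The source of every convergence rate: the mean value inequality gives the factor ε ‖w‖ for the
function, and the chain rule gives the factor ε for its derivatives. The price is one more power of
1 + ‖w‖, which is harmless in oscillatory integrals. -/
theorem boundedFamily_cutoff_sub (χ : 𝓢(W, A)) {ε : ι → ℝ} (hε : ∀ i, 0 ≤ ε i)
    (hε1 : ∀ i, ε i ≤ 1) :
    BoundedFamily (fun i w => ε i * (1 + ‖w‖)) (fun i w => χ (ε i • w) - χ 0) := by
  have hpos : ∀ i (w : W), 0 ≤ ε i * (1 + ‖w‖) := fun i w => mul_nonneg (hε i) (by positivity)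
  have hd : ∀ i, fderiv ℝ (fun w => χ (ε i • w) - χ 0) =
      fun w => ε i • (SchwartzMap.fderivCLM ℝ W A χ) (ε i • w) := by
    intro i
    ext1 w
    have h1 : HasFDerivAt (fun w : W => ε i • w) (ε i • ContinuousLinearMap.id ℝ W) w :=
      (hasFDerivAt_id w).const_smul (ε i)
    have h2 := ((χ.hasFDerivAt (ε i • w)).comp w h1).sub_const (χ 0)
    have h3 : HasFDerivAt (fun w => χ (ε i • w) - χ 0) _ w := h2
    rw [h3.fderiv]
    ext v
    simp
  obtain ⟨C, hC, hb⟩ := (boundedFamily_schwartz (ι := Unit) (SchwartzMap.fderivCLM ℝ W A χ)).norm_le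
  refine BoundedFamily.of_fderiv (C := C) (fun i => ?_) (fun i w => ?_) ?_
  · exact ((χ.smooth ⊤).comp (contDiff_const_smul _)).sub contDiff_const
  · have := Convex.norm_image_sub_le_of_norm_fderiv_le (𝕜 := ℝ) (f := χ) (C := C) (s := Set.univ)
      (fun x _ => χ.differentiableAt) (fun x _ => by simpa using hb () x) convex_univ
      (Set.mem_univ 0) (Set.mem_univ (ε i • w))
    refine this.trans ?_
    rw [sub_zero, norm_smul, Real.norm_of_nonneg (hε i)]
    have := hε i
    gcongr
    simp
  · simp_rw [hd]
    refine ((boundedFamily_cutoff (SchwartzMap.fderivCLM ℝ W A χ) hε hε1).smul_family ε hε).mono 1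
      hpos fun i w => ?_
    rw [one_mul]
    exact mul_le_mul_of_nonneg_left (by simp) (hε i)

end Cutoff

/-! ### Oscillatory integrals as limits of regularized ones -/

section Osc

variable {ι : Type*} {W : Type*} [NormedAddCommGroup W] [NormedSpace ℝ W] [FiniteDimensional ℝ W]
  [MeasurableSpace W] [BorelSpace W] {μ : Measure W} [μ.IsAddHaarMeasure]
  {J : Type*} [Fintype J] {φ : W → ℂ} {e : J → W} {l : J → W →L[ℝ] ℝ}
  {A A' : Type*} [NormedAddCommGroup A'] [NormedSpace ℂ A'] [NormedAddCommGroup A] [NormedSpace ℂ A]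

/-- A smooth function whose derivatives all grow at most like the same power of the norm. -/
def IsAmplitude (b : W → A) : Prop :=
  ∃ p : ℝ, BoundedFamily (fun (_ : Unit) w => 1 * (1 + ‖w‖) ^ p) (fun _ => b)

theorem BoundedFamily.isAmplitude {R : ι → ℝ} {p : ℝ} {b : ι → W → A}
    (h : BoundedFamily (fun i w => R i * (1 + ‖w‖) ^ p) b) (i : ι) : IsAmplitude (b i) :=
  ⟨p, (h.reindex fun _ => i).mono (R i) (fun _ w => by positivity) fun _ w => by simp⟩

theorem IsAmplitude.hasTemperateGrowth {b : W → A} (h : IsAmplitude b) : b.HasTemperateGrowth := by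
  obtain ⟨p, hp⟩ := h
  exact hp.hasTemperateGrowth ()

theorem IsAmplitude.exists_le {b : W → A} (h : IsAmplitude b) : ∃ p₀ : ℝ, ∀ p, p₀ ≤ p →
    BoundedFamily (fun (_ : Unit) w => 1 * (1 + ‖w‖) ^ p) (fun _ => b) := by
  obtain ⟨p₀, hp⟩ := h
  refine ⟨p₀, fun p hpp => hp.mono 1 (fun _ w => by positivity) fun _ w => ?_⟩
  simp only [one_mul]
  exact Real.rpow_le_rpow_of_exponent_le (by simp) hpp

theorem IsAmplitude.add {b c : W → A} (hb : IsAmplitude b) (hc : IsAmplitude c) :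
    IsAmplitude (fun w => b w + c w) := by
  obtain ⟨p, hp⟩ := hb.exists_le
  obtain ⟨q, hq⟩ := hc.exists_le
  exact ⟨max p q, (hp _ (le_max_left _ _)).add (hq _ (le_max_right _ _))⟩

theorem IsAmplitude.clm_comp {b : W → A} (hb : IsAmplitude b) (T : A →L[ℝ] A') :
    IsAmplitude (fun w => T (b w)) := by
  obtain ⟨p, hp⟩ := hb
  exact ⟨p, hp.clm_comp T⟩

theorem IsAmplitude.smul {a : W → ℂ} {b : W → A} (ha : IsAmplitude a) (hb : IsAmplitude b) :
    IsAmplitude (fun w => a w • b w) := by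
  obtain ⟨p, hp⟩ := ha
  obtain ⟨q, hq⟩ := hb
  refine ⟨p + q, (hp.smul hq).mono 1 (fun _ w => by positivity) fun _ w => ?_⟩
  rw [Real.rpow_add (by positivity)]
  simp

theorem IsAmplitude.fderiv_apply {b : W → A} (hb : IsAmplitude b) (v : W) :
    IsAmplitude (fun w => fderiv ℝ b w v) := by
  obtain ⟨p, hp⟩ := hb
  exact ⟨p, hp.fderiv_apply v⟩

theorem isAmplitude_clm (T : W →L[ℝ] A) : IsAmplitude (T : W → A) :=
  ⟨1, boundedFamily_clm T⟩

/-- The integral of `b` against the phase `φ`, regularized by `χ (ε w)`. -/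
def regInt (μ : Measure W) (φ : W → ℂ) (χ : 𝓢(W, ℂ)) (b : W → A) (ε : ℝ) : A :=
  ∫ w, φ w • χ (ε • w) • b w ∂μ

/-- The Schwartz function `w ↦ χ (ε w) b(w)`. -/
theorem exists_schwartz_cutoff (χ : 𝓢(W, ℂ)) {b : W → A} (hb : b.HasTemperateGrowth) {ε : ℝ}
    (hε : 0 < ε) : ∃ s : 𝓢(W, A), ∀ w, s w = χ (ε • w) • b w := by
  let g : W ≃L[ℝ] W := ContinuousLinearEquiv.smulLeft (Units.mk0 ε hε.ne')
  exact ⟨SchwartzMap.bilinLeftCLM (ContinuousLinearMap.lsmul ℂ ℂ) hb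
    (SchwartzMap.compCLMOfContinuousLinearEquiv ℂ g χ), fun w => rfl⟩

theorem IsPhase.integrable_regInt (hφ : IsPhase φ e l) (χ : 𝓢(W, ℂ)) {b : W → A}
    (hb : b.HasTemperateGrowth) {ε : ℝ} (hε : 0 < ε) :
    Integrable (fun w => φ w • χ (ε • w) • b w) μ := by
  obtain ⟨s, hs⟩ := exists_schwartz_cutoff χ hb hε
  simp_rw [← hs]
  exact hφ.integrable_smul s.integrable

/-- The difference is the integral of an amplitude of size (ε + ε') R (1 + ‖w‖)^{p+1}, to which
`norm_integral_smul_le` applies. With χ = χ' this is the Cauchy property, with χ ≠ χ' the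
independence of the cutoff; both are uniform in the index. -/
theorem IsPhase.regInt_sub_le (hφ : IsPhase φ e l) (χ χ' : 𝓢(W, ℂ)) (hχ' : χ' 0 = 1)
    {b : ι → W → A} {R : ι → ℝ} {p : ℝ}
    (hb : BoundedFamily (fun i w => R i * (1 + ‖w‖) ^ p) b) :
    ∃ C : ℝ, 0 ≤ C ∧ ∀ i, ∀ ε ∈ Set.Ioc (0 : ℝ) 1, ∀ ε' ∈ Set.Ioc (0 : ℝ) 1,
      ‖regInt μ φ χ (b i) ε - χ 0 • regInt μ φ χ' (b i) ε'‖ ≤ C * ((ε + ε') * R i) := by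
  let K := ι × Set.Ioc (0 : ℝ) 1 × Set.Ioc (0 : ℝ) 1
  have hT := fun i => hb.hasTemperateGrowth i
  choose s hs using fun k : K => exists_schwartz_cutoff χ (hT k.1) k.2.1.2.1
  choose s' hs' using fun k : K => exists_schwartz_cutoff χ' (hT k.1) k.2.2.2.1
  have hR : ∀ i, 0 ≤ R i := fun i => by simpa using hb.nonneg i 0
  have hpos : ∀ (k : K) (w : W), 0 ≤ ((k.2.1 + k.2.2 : ℝ) * R k.1) * (1 + ‖w‖) ^ (p + 1) :=
    fun k w => mul_nonneg (mul_nonneg (add_nonneg k.2.1.2.1.le k.2.2.2.1.le) (hR _))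
      (by positivity)
  have h1 := (boundedFamily_cutoff_sub χ (ε := fun k : K => k.2.1) (fun k => k.2.1.2.1.le)
    (fun k => k.2.1.2.2)).smul (hb.reindex fun k : K => k.1)
  have h2 := (boundedFamily_cutoff_sub χ' (ε := fun k : K => k.2.2) (fun k => k.2.2.2.1.le)
    (fun k => k.2.2.2.2)).smul (hb.reindex fun k : K => k.1)
  have hw : ∀ (k : K) (w : W) (t : ℝ), t ≤ k.2.1 + k.2.2 → t * (1 + ‖w‖) *
      (R k.1 * (1 + ‖w‖) ^ p) ≤
      1 * (((k.2.1 + k.2.2 : ℝ) * R k.1) * (1 + ‖w‖) ^ (p + 1)) := by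
    intro k w t ht
    rw [Real.rpow_add_one (by positivity)]
    have := hR k.1
    calc _ = t * (R k.1 * (1 + ‖w‖) ^ p * (1 + ‖w‖)) := by ring
      _ ≤ (k.2.1 + k.2.2 : ℝ) * (R k.1 * (1 + ‖w‖) ^ p * (1 + ‖w‖)) := by gcongr
      _ = _ := by ring
  have h3 := (h1.mono 1 hpos fun k w => hw k w _ (by linarith [k.2.2.2.1])).sub
    ((h2.mono 1 hpos fun k w => hw k w _ (by linarith [k.2.1.2.1])).const_smul (χ 0))
  -- Since χ'(0) = 1, subtracting χ(0) b from both regularized amplitudes cancels; only the two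
  -- small differences of cutoffs remain.
  have h4 : (fun (k : K) w => (χ ((k.2.1 : ℝ) • w) - χ 0) • b k.1 w -
      χ 0 • (χ' ((k.2.2 : ℝ) • w) - χ' 0) • b k.1 w) =
      fun k : K => ((s k - χ 0 • s' k : 𝓢(W, A)) : W → A) := by
    ext k w
    rw [sub_apply, smul_apply, hs, hs', hχ']
    simp only [sub_smul, smul_sub, one_smul]
    abel
  rw [h4] at h3
  obtain ⟨C, hC, h5⟩ := hφ.norm_integral_smul_le (μ := μ) h3
  refine ⟨C, hC, fun i ε hε ε' hε' => ?_⟩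
  have h6 := h5 (i, ⟨ε, hε⟩, ⟨ε', hε'⟩)
  convert h6 using 2
  simp_rw [sub_apply, smul_apply, hs, hs', smul_sub]
  rw [integral_sub]
  · simp_rw [smul_comm (φ _) (χ 0)]
    rw [integral_smul]
    rfl
  · exact hφ.integrable_regInt χ (hT i) hε.1
  · simp_rw [smul_comm (φ _) (χ 0)]
    exact (hφ.integrable_regInt χ' (hT i) hε'.1).smul _

theorem IsPhase.regInt_le (hφ : IsPhase φ e l) (χ : 𝓢(W, ℂ))
    {b : ι → W → A} {R : ι → ℝ} {p : ℝ}
    (hb : BoundedFamily (fun i w => R i * (1 + ‖w‖) ^ p) b) :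
    ∃ C : ℝ, 0 ≤ C ∧ ∀ i, ∀ ε ∈ Set.Ioc (0 : ℝ) 1, ‖regInt μ φ χ (b i) ε‖ ≤ C * R i := by
  let K := ι × Set.Ioc (0 : ℝ) 1
  choose s hs using fun k : K => exists_schwartz_cutoff χ (hb.hasTemperateGrowth k.1) k.2.2.1
  have h1 := (boundedFamily_cutoff χ (ε := fun k : K => k.2) (fun k => k.2.2.1.le)
    (fun k => k.2.2.2)).smul (hb.reindex fun k : K => k.1)
  have h2 : BoundedFamily (fun (k : K) w => R k.1 * (1 + ‖w‖) ^ p)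
      (fun k : K => (s k : W → A)) := by
    convert h1 using 2
    · ext w; simp
    · ext w; rw [hs]
  obtain ⟨C, hC, h5⟩ := hφ.norm_integral_smul_le (μ := μ) h2
  refine ⟨C, hC, fun i ε hε => ?_⟩
  have h6 := h5 (i, ⟨ε, hε⟩)
  simp_rw [hs] at h6
  exact h6

variable (W) in
theorem exists_schwartz_eq_one : ∃ γ : 𝓢(W, ℂ), γ 0 = 1 := by
  let f : ContDiffBump (0 : W) := ⟨1, 2, one_pos, one_lt_two⟩
  have h1 : HasCompactSupport (fun w => (f w : ℂ)) :=
    f.hasCompactSupport.comp_left (g := fun r : ℝ => (r : ℂ)) (by simp)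
  have h2 : ContDiff ℝ ∞ (fun w => (f w : ℂ)) := Complex.ofRealCLM.contDiff.comp f.contDiff
  refine ⟨h1.toSchwartzMap h2, ?_⟩
  change ((f 0 : ℝ) : ℂ) = 1
  rw [f.one_of_mem_closedBall (by simp [f.rIn_pos.le])]
  simp

variable (W) in
/-- A fixed Schwartz function with value `1` at the origin. -/
def unitCutoff : 𝓢(W, ℂ) := (exists_schwartz_eq_one W).choose

variable (W) in
theorem unitCutoff_zero : unitCutoff W 0 = 1 := (exists_schwartz_eq_one W).choose_spec

/-- The oscillatory integral of an amplitude. -/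
def osc (μ : Measure W) (φ : W → ℂ) (b : W → A) : A :=
  limUnder (𝓝[>] (0 : ℝ)) (regInt μ φ (unitCutoff W) b)

theorem Ioc_mem_nhdsGT_zero : Set.Ioc (0 : ℝ) 1 ∈ 𝓝[>] (0 : ℝ) := Ioc_mem_nhdsGT one_pos

theorem exists_tendsto_of_norm_sub_le [CompleteSpace A] {u : ℝ → A} {C : ℝ}
    (h : ∀ ε ∈ Set.Ioc (0 : ℝ) 1, ∀ ε' ∈ Set.Ioc (0 : ℝ) 1, ‖u ε - u ε'‖ ≤ C * (ε + ε')) :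
    ∃ v, Tendsto u (𝓝[>] 0) (𝓝 v) := by
  have hC : 0 ≤ C := by
    have := (norm_nonneg _).trans (h 1 (by simp) 1 (by simp))
    linarith
  refine cauchy_map_iff_exists_tendsto.1 (Metric.cauchy_iff.2 ⟨inferInstance, fun δ hδ => ?_⟩)
  -- The +1 keeps the denominator positive when C = 0.
  set r := min 1 (δ / (2 * (C + 1)))
  have hr : 0 < r := by positivity
  refine ⟨u '' Set.Ioo 0 r, image_mem_map (Ioo_mem_nhdsGT hr), ?_⟩
  rintro _ ⟨s, hs, rfl⟩ _ ⟨t, ht, rfl⟩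
  have hr1 : r ≤ 1 := min_le_left _ _
  have hr2 : r ≤ δ / (2 * (C + 1)) := min_le_right _ _
  rw [dist_eq_norm]
  refine (h s ⟨hs.1, hs.2.le.trans hr1⟩ t ⟨ht.1, ht.2.le.trans hr1⟩).trans_lt ?_
  calc C * (s + t) ≤ (C + 1) * (s + t) := by nlinarith [hs.1, ht.1]
    _ < (C + 1) * (2 * r) := by
      have := hs.2
      have := ht.2
      gcongr
      linarith
    _ ≤ (C + 1) * (2 * (δ / (2 * (C + 1)))) := by gcongr
    _ = δ := by field_simp

theorem IsPhase.tendsto_unitCutoff [CompleteSpace A] (hφ : IsPhase φ e l) {b : W → A}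
    (hb : IsAmplitude b) :
    Tendsto (regInt μ φ (unitCutoff W) b) (𝓝[>] 0) (𝓝 (osc μ φ b)) := by
  obtain ⟨p, hp⟩ := hb
  obtain ⟨C, hC, h⟩ := hφ.regInt_sub_le (μ := μ) (unitCutoff W) (unitCutoff W)
    (unitCutoff_zero W) hp
  refine tendsto_nhds_limUnder (exists_tendsto_of_norm_sub_le (C := C) fun ε hε ε' hε' => ?_)
  simpa [unitCutoff_zero] using h () ε hε ε' hε'

/-- Let ε' → 0 in `regInt_sub_le`. The rate depends on the index only through R, which provides the
uniform convergence needed for differentiating in a parameter. -/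
theorem IsPhase.regInt_sub_osc_le [CompleteSpace A] (hφ : IsPhase φ e l) (χ : 𝓢(W, ℂ))
    {b : ι → W → A} {R : ι → ℝ} {p : ℝ}
    (hb : BoundedFamily (fun i w => R i * (1 + ‖w‖) ^ p) b) :
    ∃ C : ℝ, 0 ≤ C ∧ ∀ i, ∀ ε ∈ Set.Ioc (0 : ℝ) 1,
      ‖regInt μ φ χ (b i) ε - χ 0 • osc μ φ (b i)‖ ≤ C * (ε * R i) := by
  obtain ⟨C, hC, h⟩ := hφ.regInt_sub_le (μ := μ) χ (unitCutoff W) (unitCutoff_zero W) hb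
  refine ⟨C, hC, fun i ε hε => ?_⟩
  have h1 : Tendsto (fun ε' => ‖regInt μ φ χ (b i) ε -
      χ 0 • regInt μ φ (unitCutoff W) (b i) ε'‖) (𝓝[>] 0)
      (𝓝 ‖regInt μ φ χ (b i) ε - χ 0 • osc μ φ (b i)‖) :=
    (((hφ.tendsto_unitCutoff (hb.isAmplitude i)).const_smul (χ 0)).const_sub _).norm
  have h2 : Tendsto (fun ε' : ℝ => C * ((ε + ε') * R i)) (𝓝[>] 0) (𝓝 (C * ((ε + 0) * R i))) := by
    refine tendsto_nhdsWithin_of_tendsto_nhds ?_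
    exact (((continuous_const.add continuous_id).mul continuous_const).const_mul C).tendsto 0
  have h3 := le_of_tendsto_of_tendsto h1 h2 (by
    filter_upwards [Ioc_mem_nhdsGT_zero] with ε' hε' using h i ε hε ε' hε')
  simpa using h3

theorem IsPhase.osc_le [CompleteSpace A] (hφ : IsPhase φ e l)
    {b : ι → W → A} {R : ι → ℝ} {p : ℝ}
    (hb : BoundedFamily (fun i w => R i * (1 + ‖w‖) ^ p) b) :
    ∃ C : ℝ, 0 ≤ C ∧ ∀ i, ‖osc μ φ (b i)‖ ≤ C * R i := by
  obtain ⟨C, hC, h⟩ := hφ.regInt_le (μ := μ) (unitCutoff W) hb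
  refine ⟨C, hC, fun i => ?_⟩
  refine le_of_tendsto (hφ.tendsto_unitCutoff (hb.isAmplitude i)).norm ?_
  filter_upwards [Ioc_mem_nhdsGT_zero] with ε hε using h i ε hε

/-- The value χ(0) is left arbitrary because derivatives of cutoffs also occur as cutoffs. -/
theorem IsPhase.tendsto_regInt [CompleteSpace A] (hφ : IsPhase φ e l) (χ : 𝓢(W, ℂ)) {b : W → A}
    (hb : IsAmplitude b) :
    Tendsto (regInt μ φ χ b) (𝓝[>] 0) (𝓝 (χ 0 • osc μ φ b)) := by
  obtain ⟨p, hp⟩ := hb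
  obtain ⟨C, hC, h⟩ := hφ.regInt_sub_osc_le (μ := μ) χ hp
  rw [tendsto_iff_norm_sub_tendsto_zero]
  refine squeeze_zero' (g := fun ε => C * (ε * 1)) (Eventually.of_forall fun _ => norm_nonneg _)
    (by filter_upwards [Ioc_mem_nhdsGT_zero] with ε hε using h () ε hε) ?_
  refine tendsto_nhdsWithin_of_tendsto_nhds ?_
  have : Continuous fun ε : ℝ => C * (ε * 1) := by fun_prop
  simpa using this.tendsto 0

theorem IsPhase.osc_add [CompleteSpace A] (hφ : IsPhase φ e l) {b c : W → A}
    (hb : IsAmplitude b) (hc : IsAmplitude c) :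
    osc μ φ (fun w => b w + c w) = osc μ φ b + osc μ φ c := by
  refine tendsto_nhds_unique (hφ.tendsto_unitCutoff (hb.add hc))
    (((hφ.tendsto_unitCutoff hb).add (hφ.tendsto_unitCutoff hc)).congr' ?_)
  filter_upwards [self_mem_nhdsWithin] with ε hε
  rw [regInt, regInt, regInt, ← integral_add]
  · simp only [smul_add]
  · exact hφ.integrable_regInt _ hb.hasTemperateGrowth hε
  · exact hφ.integrable_regInt _ hc.hasTemperateGrowth hε

theorem IsPhase.regInt_clm [CompleteSpace A] [CompleteSpace A'] (hφ : IsPhase φ e l)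
    (χ : 𝓢(W, ℂ)) {b : W → A} (hb : IsAmplitude b) (T : A →L[ℂ] A') {ε : ℝ} (hε : 0 < ε) :
    regInt μ φ χ (fun w => T (b w)) ε = T (regInt μ φ χ b ε) := by
  rw [regInt, regInt, ← T.integral_comp_comm (hφ.integrable_regInt χ hb.hasTemperateGrowth hε)]
  simp

theorem IsPhase.osc_clm [CompleteSpace A] [CompleteSpace A'] (hφ : IsPhase φ e l)
    {b : W → A} (hb : IsAmplitude b) (T : A →L[ℂ] A') :
    osc μ φ (fun w => T (b w)) = T (osc μ φ b) := by
  refine tendsto_nhds_unique (hφ.tendsto_unitCutoff (hb.clm_comp (T.restrictScalars ℝ)))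
    (((T.continuous.tendsto _).comp (hφ.tendsto_unitCutoff hb)).congr' ?_)
  filter_upwards [self_mem_nhdsWithin] with ε hε
  exact (hφ.regInt_clm _ hb T hε).symm

/-- Integration by parts for the regularized integrals produces an extra term in which the
derivative hits the cutoff. It carries a factor ε in front of a convergent regularized integral, so
it vanishes in the limit. -/
theorem IsPhase.osc_linear_smul [CompleteSpace A] (hφ : IsPhase φ e l) {b : W → A}
    (hb : IsAmplitude b) (j : J) :
    osc μ φ (fun w => (l j w : ℂ) • b w) = (-Complex.I) • osc μ φ (fun w => fderiv ℝ b w (e j)) := by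
  set γ := unitCutoff W
  have hl : IsAmplitude (fun w => (l j w : ℂ)) := isAmplitude_clm (Complex.ofRealCLM.comp (l j))
  have h1 := hφ.tendsto_unitCutoff (μ := μ) (hl.smul hb)
  have h2 := (hφ.tendsto_unitCutoff (μ := μ) (hb.fderiv_apply (e j))).const_smul (-Complex.I)
  let γ' : 𝓢(W, ℂ) := SchwartzMap.evalCLM ℂ W ℂ (e j) (SchwartzMap.fderivCLM ℂ W ℂ γ)
  have hγ' : ∀ w, γ' w = fderiv ℝ γ w (e j) := fun w => rfl
  -- The term with the differentiated cutoff; the explicit ε comes from the chain rule.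
  have h3 : Tendsto (fun ε : ℝ => (-Complex.I) • ε • regInt μ φ γ' b ε) (𝓝[>] 0) (𝓝 0) := by
    have := (tendsto_nhdsWithin_of_tendsto_nhds tendsto_id :
      Tendsto (fun ε : ℝ => ε) (𝓝[>] 0) (𝓝 0)).smul (hφ.tendsto_regInt (μ := μ) γ' hb)
    simpa using this.const_smul (-Complex.I)
  refine tendsto_nhds_unique h1 ?_
  have h4 := h2.add h3
  rw [add_zero] at h4
  refine h4.congr' ?_
  filter_upwards [self_mem_nhdsWithin] with ε hε
  obtain ⟨s, hs⟩ := exists_schwartz_cutoff γ hb.hasTemperateGrowth hε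
  have h5 : ∀ w, fderiv ℝ s w (e j) =
      γ (ε • w) • fderiv ℝ b w (e j) + (ε : ℂ) • γ' (ε • w) • b w := by
    intro w
    have e1 : (s : W → A) = fun w => γ (ε • w) • b w := funext hs
    have d1 : HasFDerivAt (fun w : W => ε • w) (ε • ContinuousLinearMap.id ℝ W) w :=
      (hasFDerivAt_id w).const_smul ε
    have d2 : HasFDerivAt (fun w => γ (ε • w)) _ w := (γ.hasFDerivAt (ε • w)).comp w d1
    have d3 : HasFDerivAt b (fderiv ℝ b w) w :=
      ((hb.hasTemperateGrowth.1.differentiable (by simp)) w).hasFDerivAt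
    rw [e1, (d2.fun_smul d3).fderiv]
    simp [hγ', smul_smul]
  have h6 := hφ.integral_fderiv_smul (μ := μ) s j
  simp_rw [h5, hs, smul_add] at h6
  rw [integral_add (hφ.integrable_regInt γ (hb.fderiv_apply (e j)).hasTemperateGrowth hε)] at h6
  swap
  · simp_rw [smul_comm (φ _) (ε : ℂ)]
    exact (hφ.integrable_regInt γ' hb.hasTemperateGrowth hε).smul _
  simp_rw [smul_comm (φ _) (ε : ℂ)] at h6
  rw [integral_smul] at h6
  have h7 : (-Complex.I) • (regInt μ φ γ (fun w => fderiv ℝ b w (e j)) ε +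
      (ε : ℂ) • regInt μ φ γ' b ε) = regInt μ φ γ (fun w => (l j w : ℂ) • b w) ε := by
    have h8 : regInt μ φ γ (fun w => (l j w : ℂ) • b w) ε =
        ∫ w, φ w • (l j w : ℂ) • γ (ε • w) • b w ∂μ := by
      simp_rw [regInt, smul_comm (γ _) ((l j _ : ℂ))]
    rw [h8]
    change (-Complex.I) • (_ + (ε : ℂ) • ∫ w, φ w • γ' (ε • w) • b w ∂μ) = _
    rw [show regInt μ φ γ (fun w => fderiv ℝ b w (e j)) ε =
      ∫ w, φ w • γ (ε • w) • fderiv ℝ b w (e j) ∂μ from rfl, h6, smul_smul]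
    simp
  rw [← h7, smul_add]
  congr 2

end Osc

end

end

section

open scoped ContDiff Matrix SchwartzMap LineDeriv Topology
open MeasureTheory Filter

set_option linter.unusedSectionVars false

noncomputable section

/-! ### Differentiation of oscillatory integrals in a parameter -/

section Param

variable {ι : Type*} {W : Type*} [NormedAddCommGroup W] [NormedSpace ℝ W] [FiniteDimensional ℝ W]
  [MeasurableSpace W] [BorelSpace W] {μ : Measure W} [μ.IsAddHaarMeasure]
  {J : Type*} [Fintype J] {φ : W → ℂ} {e : J → W} {l : J → W →L[ℝ] ℝ}
  {A A' : Type*} [NormedAddCommGroup A] [NormedSpace ℂ A] [NormedAddCommGroup A'] [NormedSpace ℂ A']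
  {Z : Type*} [NormedAddCommGroup Z] [NormedSpace ℝ Z]

theorem integrable_rpow_mul_cutoff (χ : 𝓢(W, ℂ)) {ε : ℝ} (hε : 0 < ε) (p : ℝ) :
    Integrable (fun w => (1 + ‖w‖) ^ p * ‖χ (ε • w)‖) μ := by
  let g : W ≃L[ℝ] W := ContinuousLinearEquiv.smulLeft (Units.mk0 ε hε.ne')
  let s : 𝓢(W, ℂ) := SchwartzMap.compCLMOfContinuousLinearEquiv ℂ g χ
  have hs : ∀ w, s w = χ (ε • w) := fun w => rfl
  set N := ⌈p⌉₊
  have hi : Integrable (fun w => 2 ^ (N - 1) * (‖s w‖ + ‖w‖ ^ N * ‖s w‖)) μ :=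
    (s.integrable.norm.add (s.integrable_pow_mul μ N)).const_mul _
  refine hi.mono' ?_ (Eventually.of_forall fun w => ?_)
  · refine Continuous.aestronglyMeasurable ?_
    refine Continuous.mul ?_ (χ.continuous.comp (continuous_const_smul ε)).norm
    exact (continuous_const.add continuous_norm).rpow_const fun w => Or.inl
      (by positivity : (0 : ℝ) < 1 + ‖w‖).ne'
  · rw [Real.norm_of_nonneg (by positivity), ← hs]
    have h1 : (1 + ‖w‖) ^ p ≤ (1 + ‖w‖) ^ N := by
      rw [← Real.rpow_natCast]
      exact Real.rpow_le_rpow_of_exponent_le (by simp) (Nat.le_ceil p)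
    have h2 := add_pow_le zero_le_one (norm_nonneg w) N
    rw [one_pow] at h2
    calc _ ≤ (2 ^ (N - 1) * (1 + ‖w‖ ^ N)) * ‖s w‖ := by gcongr; exact h1.trans h2
      _ = _ := by ring

theorem IsPhase.hasFDerivAt_regInt (hφ : IsPhase φ e l) (χ : 𝓢(W, ℂ)) {U : Set Z} (hU : IsOpen U)
    {b : Z → W → A} {b' : Z → W → Z →L[ℝ] A} {R p : ℝ}
    (hd : ∀ z ∈ U, ∀ w, HasFDerivAt (fun z => b z w) (b' z w) z)
    (hb : BoundedFamily (fun (_ : U) w => R * (1 + ‖w‖) ^ p) (fun z => b z))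
    (hb' : BoundedFamily (fun (_ : U) w => R * (1 + ‖w‖) ^ p) (fun z => b' z))
    {ε : ℝ} (hε : 0 < ε) {z : Z} (hz : z ∈ U) :
    HasFDerivAt (fun z => regInt μ φ χ (b z) ε) (regInt μ φ χ (b' z) ε) z := by
  obtain ⟨C, hC, hbd⟩ := hb'.norm_le
  refine hasFDerivAt_integral_of_dominated_of_fderiv_le (𝕜 := ℝ) (hU.mem_nhds hz)
    (F := fun z w => φ w • χ (ε • w) • b z w) (F' := fun z w => φ w • χ (ε • w) • b' z w)
    (bound := fun w => (C * R) * ((1 + ‖w‖) ^ p * ‖χ (ε • w)‖)) ?_ ?_ ?_ ?_ ?_ ?_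
  · filter_upwards [hU.mem_nhds hz] with y hy
    exact (hφ.integrable_regInt χ (hb.hasTemperateGrowth ⟨y, hy⟩) hε).1
  · exact hφ.integrable_regInt χ (hb.hasTemperateGrowth ⟨z, hz⟩) hε
  · exact (hφ.integrable_regInt χ (hb'.hasTemperateGrowth ⟨z, hz⟩) hε).1
  · refine Eventually.of_forall fun w y hy => ?_
    rw [norm_smul, norm_smul, hφ.norm_eq, one_mul]
    calc _ ≤ ‖χ (ε • w)‖ * (C * (R * (1 + ‖w‖) ^ p)) := by
          gcongr; exact hbd ⟨y, hy⟩ w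
      _ = _ := by ring
  · exact (integrable_rpow_mul_cutoff χ hε p).const_mul _
  · exact Eventually.of_forall fun w y hy => ((hd y hy w).const_smul _).const_smul _

/-- Regularized integrals may be differentiated by dominated convergence. Along ε = 1/(n+1) their
derivatives converge uniformly on U by `regInt_sub_osc_le`, so the limit may be differentiated too.
-/
theorem IsPhase.hasFDerivAt_osc [CompleteSpace A] (hφ : IsPhase φ e l) {U : Set Z} (hU : IsOpen U)
    {b : Z → W → A} {b' : Z → W → Z →L[ℝ] A} {R p : ℝ}
    (hd : ∀ z ∈ U, ∀ w, HasFDerivAt (fun z => b z w) (b' z w) z)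
    (hb : BoundedFamily (fun (_ : U) w => R * (1 + ‖w‖) ^ p) (fun z => b z))
    (hb' : BoundedFamily (fun (_ : U) w => R * (1 + ‖w‖) ^ p) (fun z => b' z))
    {z : Z} (hz : z ∈ U) :
    HasFDerivAt (fun z => osc μ φ (b z)) (osc μ φ (b' z)) z := by
  have hpos : ∀ n : ℕ, (0 : ℝ) < 1 / ((n : ℝ) + 1) := fun n => Nat.one_div_pos_of_nat
  have hle : ∀ n : ℕ, 1 / ((n : ℝ) + 1) ≤ 1 := fun n => by
    rw [div_le_one (by positivity)]; simp
  have htend : Tendsto (fun n : ℕ => 1 / ((n : ℝ) + 1)) atTop (𝓝[>] 0) :=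
    tendsto_nhdsWithin_iff.2 ⟨tendsto_one_div_add_atTop_nhds_zero_nat,
      Eventually.of_forall fun n => hpos n⟩
  obtain ⟨C, hC, hc⟩ := hφ.regInt_sub_osc_le (μ := μ) (unitCutoff W) hb'
  rw [unitCutoff_zero] at hc
  refine hasFDerivAt_of_tendstoUniformlyOn (l := atTop) hU
    (f := fun (n : ℕ) z => regInt μ φ (unitCutoff W) (b z) (1 / ((n : ℝ) + 1)))
    (f' := fun (n : ℕ) z => regInt μ φ (unitCutoff W) (b' z) (1 / ((n : ℝ) + 1)))
    (g' := fun z => osc μ φ (b' z)) ?_ ?_ ?_ hz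
  · rw [Metric.tendstoUniformlyOn_iff]
    intro δ hδ
    have h1 : Tendsto (fun n : ℕ => C * (1 / ((n : ℝ) + 1) * R)) atTop (𝓝 0) := by
      simpa using (tendsto_one_div_add_atTop_nhds_zero_nat.mul_const R).const_mul C
    filter_upwards [h1.eventually (gt_mem_nhds hδ)] with n hn y hy
    rw [dist_comm, dist_eq_norm]
    refine lt_of_le_of_lt ?_ hn
    simpa using hc ⟨y, hy⟩ _ ⟨hpos n, hle n⟩
  · exact fun n y hy => hφ.hasFDerivAt_regInt _ hU hd hb hb' (hpos n) hy
  · intro y hy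
    exact (hφ.tendsto_unitCutoff (hb.isAmplitude ⟨y, hy⟩)).comp htend

end Param

/-! ### Translation-invariant operators defined by oscillatory integrals -/

section Operator

variable {X : Type*} [NormedAddCommGroup X] [NormedSpace ℝ X]

/-- A positive weight that grows at most polynomially relative to each base point. -/
structure IsModerate (θ : X → ℝ) : Prop where
  pos : ∀ x, 0 < θ x
  exists_le : ∃ C p : ℝ, 0 ≤ C ∧ 0 ≤ p ∧ ∀ x y, θ (x + y) ≤ C * θ x * (1 + ‖y‖) ^ p

variable {κ : Type*} {W : Type*} [NormedAddCommGroup W] [NormedSpace ℝ W] [FiniteDimensional ℝ W]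
  [MeasurableSpace W] [BorelSpace W] {μ : Measure W} [μ.IsAddHaarMeasure]
  {J : Type*} [Fintype J] {φ : W → ℂ} {e : J → W} {l : J → W →L[ℝ] ℝ}
  {A A' : Type*} [NormedAddCommGroup A] [NormedSpace ℂ A] [NormedAddCommGroup A'] [NormedSpace ℂ A']
  {θ : X → ℝ} {Q : X → A}

/-- A smooth function whose derivatives are dominated by the weight `θ`. -/
def InClass (θ : X → ℝ) (Q : X → A) : Prop := BoundedFamily (fun (_ : Unit) => θ) (fun _ => Q)

theorem InClass.contDiff (h : InClass θ Q) : ContDiff ℝ ∞ Q := h.smooth ()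

theorem InClass.differentiable (h : InClass θ Q) : Differentiable ℝ Q :=
  h.contDiff.differentiable (by simp)

theorem InClass.fderiv (h : InClass θ Q) : InClass θ (fderiv ℝ Q) := BoundedFamily.fderiv h

theorem InClass.fderiv_apply (h : InClass θ Q) (v : X) :
    InClass θ (fun x => _root_.fderiv ℝ Q x v) := BoundedFamily.fderiv_apply h v

/-- Moderateness splits θ(x + Lw) into θ(x) times a power of 1 + ‖w‖. The base point thus enters
only as the constant R of the uniform estimates, and bounds by θ(x) come out; any larger exponent is
allowed, so that several families can share one. -/
theorem InClass.family (h : InClass θ Q) (hθ : IsModerate θ) (x : κ → X) (L : κ → W →L[ℝ] X)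
    {K : ℝ} (hL : ∀ k, ‖L k‖ ≤ K) : ∃ p₀ : ℝ, ∀ p, p₀ ≤ p →
      BoundedFamily (fun k w => θ (x k) * (1 + ‖w‖) ^ p) (fun k w => Q (x k + L k w)) := by
  obtain ⟨C, p₀, hC, hp, hle⟩ := hθ.exists_le
  have hK : ∀ k, 0 ≤ K := fun k => (norm_nonneg _).trans (hL k)
  refine ⟨p₀, fun p hpp => ?_⟩
  refine ((h.reindex fun _ : κ => ()).comp_affine x L hL).mono (C * (max 1 K) ^ p₀)
    (fun k w => mul_nonneg (hθ.pos _).le (by positivity)) fun k w => ?_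
  have h1 : 1 + ‖L k w‖ ≤ max 1 K * (1 + ‖w‖) := by
    have : ‖L k w‖ ≤ max 1 K * ‖w‖ := ((L k).le_opNorm w).trans
      (by gcongr; exact (hL k).trans (le_max_right _ _))
    have := le_max_left 1 K
    linarith
  have h2 : (1 + ‖L k w‖) ^ p₀ ≤ (max 1 K) ^ p₀ * (1 + ‖w‖) ^ p := by
    calc _ ≤ (max 1 K * (1 + ‖w‖)) ^ p₀ := by gcongr
      _ = (max 1 K) ^ p₀ * (1 + ‖w‖) ^ p₀ := Real.mul_rpow (by positivity) (by positivity)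
      _ ≤ _ := by gcongr; simp
  have h3 := (hθ.pos (x k)).le
  calc _ ≤ C * θ (x k) * (1 + ‖L k w‖) ^ p₀ := hle _ _
    _ ≤ C * θ (x k) * ((max 1 K) ^ p₀ * (1 + ‖w‖) ^ p) := by gcongr
    _ = _ := by ring

theorem InClass.isAmplitude (h : InClass θ Q) (hθ : IsModerate θ) (x : X) (L : W →L[ℝ] X) :
    IsAmplitude (fun w => Q (x + L w)) := by
  obtain ⟨p, hp⟩ := h.family hθ (fun _ : Unit => x) (fun _ => L) (K := ‖L‖) (fun _ => le_rfl)
  exact (hp p le_rfl).isAmplitude ()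

/-- The operator `Q ↦ (x ↦ ∫ φ(w) Q(x + L w) dw)`, as an oscillatory integral. -/
def oscOp (μ : Measure W) (φ : W → ℂ) (L : W →L[ℝ] X) (Q : X → A) (x : X) : A :=
  osc μ φ (fun w => Q (x + L w))

/-- The regularization of `oscOp`. -/
def regOp (μ : Measure W) (φ : W → ℂ) (χ : 𝓢(W, ℂ)) (ε : ℝ) (L : W →L[ℝ] X) (Q : X → A) (x : X) :
    A :=
  regInt μ φ χ (fun w => Q (x + L w)) ε

/-- Freezes the weight at the centre: on the unit ball θ varies by at most the factor C · 2^q. This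
is the local uniformity that differentiation at x requires. -/
theorem InClass.ball_family (h : InClass θ Q) (hθ : IsModerate θ) (x : X) (L : W →L[ℝ] X) :
    ∃ R p₀ : ℝ, ∀ p, p₀ ≤ p → BoundedFamily (fun (_ : Metric.ball x 1) w => R * (1 + ‖w‖) ^ p)
      (fun y w => Q (y + L w)) := by
  obtain ⟨C, q, hC, hq, hle⟩ := hθ.exists_le
  obtain ⟨p₀, hp⟩ := h.family hθ (fun y : Metric.ball x 1 => (y : X)) (fun _ => L) (K := ‖L‖)
    (fun _ => le_rfl)
  have hx := (hθ.pos x).le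
  refine ⟨C * θ x * 2 ^ q, p₀, fun p hpp => (hp p hpp).mono 1 (fun y w => by positivity)
    fun y w => ?_⟩
  rw [one_mul]
  gcongr
  have h1 := hle x (y - x)
  rw [add_sub_cancel] at h1
  refine h1.trans ?_
  have h2 : ‖(y : X) - x‖ < 1 := by rw [← dist_eq_norm]; exact y.2
  gcongr
  linarith

theorem InClass.hasFDerivAt_comp (h : InClass θ Q) (L : W →L[ℝ] X) (x : X) (w : W) :
    HasFDerivAt (fun x => Q (x + L w)) (_root_.fderiv ℝ Q (x + L w)) x := by
  have := (h.differentiable (x + L w)).hasFDerivAt.comp x ((hasFDerivAt_id x).add_const (L w))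
  rwa [ContinuousLinearMap.comp_id] at this

theorem IsPhase.hasFDerivAt_oscOp [CompleteSpace A] (hφ : IsPhase φ e l) (hθ : IsModerate θ)
    (h : InClass θ Q) (L : W →L[ℝ] X) (x : X) :
    HasFDerivAt (oscOp μ φ L Q) (oscOp μ φ L (fderiv ℝ Q) x) x := by
  obtain ⟨R, p, hp⟩ := h.ball_family hθ x L
  obtain ⟨R', p', hp'⟩ := h.fderiv.ball_family hθ x L
  have hR : 0 ≤ R := by simpa using (hp p le_rfl).nonneg ⟨x, by simp⟩ 0
  have hR' : 0 ≤ R' := by simpa using (hp' p' le_rfl).nonneg ⟨x, by simp⟩ 0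
  refine hφ.hasFDerivAt_osc (R := max R R') (p := max p p') (U := Metric.ball x 1)
    Metric.isOpen_ball (b' := fun x w => fderiv ℝ Q (x + L w)) (fun z _ w => h.hasFDerivAt_comp L z w) ?_ ?_ (by simp)
  · exact (hp _ (le_max_left _ _)).mono 1 (fun y w => by positivity)
      fun y w => by rw [one_mul]; gcongr; exact le_max_left _ _
  · exact (hp' _ (le_max_right _ _)).mono 1 (fun y w => by positivity)
      fun y w => by rw [one_mul]; gcongr; exact le_max_right _ _

theorem IsPhase.hasFDerivAt_regOp (hφ : IsPhase φ e l) (χ : 𝓢(W, ℂ)) {ε : ℝ}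
    (hε : 0 < ε) (hθ : IsModerate θ)
    (h : InClass θ Q) (L : W →L[ℝ] X) (x : X) :
    HasFDerivAt (regOp μ φ χ ε L Q) (regOp μ φ χ ε L (fderiv ℝ Q) x) x := by
  obtain ⟨R, p, hp⟩ := h.ball_family hθ x L
  obtain ⟨R', p', hp'⟩ := h.fderiv.ball_family hθ x L
  have hR : 0 ≤ R := by simpa using (hp p le_rfl).nonneg ⟨x, by simp⟩ 0
  have hR' : 0 ≤ R' := by simpa using (hp' p' le_rfl).nonneg ⟨x, by simp⟩ 0
  refine hφ.hasFDerivAt_regInt χ (R := max R R') (p := max p p') (U := Metric.ball x 1)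
    Metric.isOpen_ball (b' := fun x w => fderiv ℝ Q (x + L w)) (fun z _ w => h.hasFDerivAt_comp L z w) ?_ ?_ hε (by simp)
  · exact (hp _ (le_max_left _ _)).mono 1 (fun y w => by positivity)
      fun y w => by rw [one_mul]; gcongr; exact le_max_left _ _
  · exact (hp' _ (le_max_right _ _)).mono 1 (fun y w => by positivity)
      fun y w => by rw [one_mul]; gcongr; exact le_max_right _ _

/-- Evaluation at a vector, as a complex linear map on real linear maps. -/
def evalComplex (A : Type*) [NormedAddCommGroup A] [NormedSpace ℂ A] (v : X) :
    (X →L[ℝ] A) →L[ℂ] A :=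
  LinearMap.mkContinuous
    { toFun := fun T => T v, map_add' := fun _ _ => rfl, map_smul' := fun _ _ => rfl } ‖v‖
    fun T => (T.le_opNorm v).trans_eq (mul_comm _ _)

theorem IsPhase.fderiv_oscOp_apply [CompleteSpace A] (hφ : IsPhase φ e l) (hθ : IsModerate θ)
    (h : InClass θ Q) (L : W →L[ℝ] X) (x v : X) :
    fderiv ℝ (oscOp μ φ L Q) x v = oscOp μ φ L (fun x => fderiv ℝ Q x v) x := by
  rw [(hφ.hasFDerivAt_oscOp hθ h L x).fderiv]
  exact (hφ.osc_clm (h.fderiv.isAmplitude hθ x L) (evalComplex A v)).symm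

theorem IsPhase.fderiv_regOp_apply [CompleteSpace A] (hφ : IsPhase φ e l) (χ : 𝓢(W, ℂ)) {ε : ℝ}
    (hε : 0 < ε) (hθ : IsModerate θ) (h : InClass θ Q) (L : W →L[ℝ] X) (x v : X) :
    fderiv ℝ (regOp μ φ χ ε L Q) x v = regOp μ φ χ ε L (fun x => fderiv ℝ Q x v) x := by
  rw [(hφ.hasFDerivAt_regOp χ hε hθ h L x).fderiv]
  exact (hφ.regInt_clm χ (h.fderiv.isAmplitude hθ x L) (evalComplex A v) hε).symm

/-- In finite dimension, being C^{n+1} can be tested on directional derivatives, and these stay in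
S; no formula for higher derivatives is needed. -/
theorem contDiff_of_closed_under_fderiv [FiniteDimensional ℝ X] {S : Set (X → A)}
    (hd : ∀ f ∈ S, Differentiable ℝ f) (hS : ∀ f ∈ S, ∀ v, (fun x => fderiv ℝ f x v) ∈ S)
    {f : X → A} (hf : f ∈ S) : ContDiff ℝ ∞ f := by
  rw [contDiff_infty]
  intro n
  induction n generalizing f with
  | zero => exact contDiff_zero.2 (hd f hf).continuous
  | succ n ih =>
    rw [Nat.cast_add, Nat.cast_one, contDiff_succ_iff_fderiv_apply]
    exact ⟨hd f hf, by simp, fun v => ih (hS f hf v)⟩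

theorem IsPhase.contDiff_oscOp [FiniteDimensional ℝ X] [CompleteSpace A] (hφ : IsPhase φ e l)
    (hθ : IsModerate θ) (h : InClass θ Q) (L : W →L[ℝ] X) : ContDiff ℝ ∞ (oscOp μ φ L Q) := by
  refine contDiff_of_closed_under_fderiv (S := {f | ∃ Q : X → A, InClass θ Q ∧ f = oscOp μ φ L Q})
    ?_ ?_ ⟨Q, h, rfl⟩
  · rintro _ ⟨Q, h, rfl⟩ x
    exact (hφ.hasFDerivAt_oscOp hθ h L x).differentiableAt
  · rintro _ ⟨Q, h, rfl⟩ v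
    exact ⟨_, h.fderiv_apply v, funext fun x => hφ.fderiv_oscOp_apply hθ h L x v⟩

theorem IsPhase.contDiff_regOp [FiniteDimensional ℝ X] [CompleteSpace A] (hφ : IsPhase φ e l)
    (χ : 𝓢(W, ℂ)) {ε : ℝ} (hε : 0 < ε)
    (hθ : IsModerate θ) (h : InClass θ Q) (L : W →L[ℝ] X) :
    ContDiff ℝ ∞ (regOp μ φ χ ε L Q) := by
  refine contDiff_of_closed_under_fderiv
    (S := {f | ∃ Q : X → A, InClass θ Q ∧ f = regOp μ φ χ ε L Q}) ?_ ?_ ⟨Q, h, rfl⟩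
  · rintro _ ⟨Q, h, rfl⟩ x
    exact (hφ.hasFDerivAt_regOp χ hε hθ h L x).differentiableAt
  · rintro _ ⟨Q, h, rfl⟩ v
    exact ⟨_, h.fderiv_apply v, funext fun x => hφ.fderiv_regOp_apply χ hε hθ h L x v⟩

theorem IsPhase.norm_oscOp_le [CompleteSpace A] (hφ : IsPhase φ e l) (hθ : IsModerate θ)
    (h : InClass θ Q) (L : κ → W →L[ℝ] X) {K : ℝ} (hL : ∀ k, ‖L k‖ ≤ K) :
    ∃ C : ℝ, 0 ≤ C ∧ ∀ k x, ‖oscOp μ φ (L k) Q x‖ ≤ C * θ x := by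
  obtain ⟨p, hp⟩ := h.family hθ (fun i : κ × X => i.2) (fun i => L i.1) (fun i => hL i.1)
  obtain ⟨C, hC, h⟩ := hφ.osc_le (μ := μ) (hp p le_rfl)
  exact ⟨C, hC, fun k x => h (k, x)⟩

theorem IsPhase.oscOp_clm [CompleteSpace A] [CompleteSpace A'] (hφ : IsPhase φ e l)
    (hθ : IsModerate θ) (h : InClass θ Q) (T : A →L[ℂ] A') (L : W →L[ℝ] X) (x : X) :
    oscOp μ φ L (fun x => T (Q x)) x = T (oscOp μ φ L Q x) :=
  hφ.osc_clm (h.isAmplitude hθ x L) T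

variable {K : Type*} [Fintype K]

/-- The second order operator `Q ↦ -i ∑ k, ∂_{p k} ∂_{q k} Q`. -/
def transportOp (p q : K → X) (Q : X → A) : X → A :=
  fun x => (-Complex.I) • ∑ k, fderiv ℝ (fun x => fderiv ℝ Q x (p k)) x (q k)

theorem InClass.add {Q' : X → A} (h : InClass θ Q) (h' : InClass θ Q') :
    InClass θ (fun x => Q x + Q' x) := BoundedFamily.add h h'

theorem InClass.const_smul (h : InClass θ Q) (c : ℂ) : InClass θ (fun x => c • Q x) :=
  BoundedFamily.const_smul h c

theorem InClass.sum {S : Type*} {s : Finset S} {q : S → X → A} (hθ : IsModerate θ)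
    (h : ∀ k ∈ s, InClass θ (q k)) : InClass θ (fun x => ∑ k ∈ s, q k x) :=
  BoundedFamily.sum s (fun _ x => (hθ.pos x).le) h

theorem InClass.transportOp (h : InClass θ Q) (hθ : IsModerate θ) (p q : K → X) :
    InClass θ (transportOp p q Q) :=
  (InClass.sum hθ fun _ _ => (h.fderiv_apply _).fderiv_apply _).const_smul _

theorem IsPhase.osc_sum [CompleteSpace A] (hφ : IsPhase φ e l) {S : Type*} (s : Finset S)
    {b : S → W → A} (hb : ∀ k ∈ s, IsAmplitude (b k)) :
    IsAmplitude (fun w => ∑ k ∈ s, b k w) ∧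
      osc μ φ (fun w => ∑ k ∈ s, b k w) = ∑ k ∈ s, osc μ φ (b k) := by
  classical
  induction s using Finset.induction_on with
  | empty =>
    simp only [Finset.sum_empty]
    refine ⟨isAmplitude_clm (0 : W →L[ℝ] A), ?_⟩
    have := hφ.osc_clm (μ := μ) (isAmplitude_clm (0 : W →L[ℝ] A)) (0 : A →L[ℂ] A)
    simpa using this
  | insert k s hk ih =>
    simp only [Finset.sum_insert hk]
    obtain ⟨h1, h2⟩ := ih fun i hi => hb i (Finset.mem_insert_of_mem hi)
    have h3 := hb k (Finset.mem_insert_self _ _)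
    exact ⟨h3.add h1, by rw [hφ.osc_add h3 h1, h2]⟩

/-- The engine of the expansion. The s-derivative brings out ∑_k l_{τ k}(w) ∂_{p k} Q, and
`osc_linear_smul` exchanges each linear factor for -i times a derivative along e_{τ k}, which by the
chain rule is a derivative of Q along L₀ e_{τ k}. -/
theorem IsPhase.hasDerivAt_oscOp [CompleteSpace A] (hφ : IsPhase φ e l) (hθ : IsModerate θ)
    (h : InClass θ Q) (L₀ L₁ : W →L[ℝ] X) (p : K → X) (τ : K → J)
    (hL₁ : ∀ w, L₁ w = ∑ k, l (τ k) w • p k) (hL₁e : ∀ k, L₁ (e (τ k)) = 0) (x : X) (s : ℝ) :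
    HasDerivAt (fun s : ℝ => oscOp μ φ (L₀ + s • L₁) Q x)
      (oscOp μ φ (L₀ + s • L₁) (transportOp p (fun k => L₀ (e (τ k))) Q) x) s := by
  set U := Metric.ball s 1
  have hLs : ∀ r : U, ‖L₀ + (r : ℝ) • L₁‖ ≤ ‖L₀‖ + (|s| + 1) * ‖L₁‖ := by
    intro r
    refine (norm_add_le _ _).trans ?_
    rw [norm_smul]
    gcongr
    have h1 : dist (r : ℝ) s < 1 := r.2
    rw [Real.dist_eq] at h1
    have := abs_sub_abs_le_abs_sub (r : ℝ) s
    rw [Real.norm_eq_abs]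
    linarith
  obtain ⟨p₀, hp₀⟩ := h.family hθ (fun _ : U => x) (fun r => L₀ + (r : ℝ) • L₁) hLs
  obtain ⟨p₁, hp₁⟩ := h.fderiv.family hθ (fun _ : U => x) (fun r => L₀ + (r : ℝ) • L₁) hLs
  have hx := (hθ.pos x).le
  -- Turns the derivative in the real parameter into a linear map on ℝ, the form in which
  -- `hasFDerivAt_osc` expects it.
  let T : A →L[ℂ] (ℝ →L[ℝ] A) := LinearMap.mkContinuous
    { toFun := fun a => (1 : ℝ →L[ℝ] ℝ).smulRight a
      map_add' := fun a b => by ext; simp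
      map_smul' := fun c a => by ext; simp } 1 fun a => by
        refine (ContinuousLinearMap.norm_smulRight_apply _ _).le.trans ?_
        gcongr
        exact ContinuousLinearMap.norm_id_le
  have hT : ∀ a, T a = (1 : ℝ →L[ℝ] ℝ).smulRight a := fun _ => rfl
  set c : ℝ → W → A := fun r w => fderiv ℝ Q (x + (L₀ + r • L₁) w) (L₁ w) with hc
  have hcfam : ∀ q, p₁ + 1 ≤ q → BoundedFamily (fun (_ : U) w => θ x * (1 + ‖w‖) ^ q)
      (fun r => c r) := by
    intro q hq
    have h1 := (hp₁ (q - 1) (by linarith)).bilinear (ContinuousLinearMap.apply ℝ A).flip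
      (boundedFamily_clm (ι := U) L₁)
    refine h1.mono 1 (fun _ w => by positivity) fun _ w => ?_
    rw [one_mul, one_mul, mul_assoc, ← Real.rpow_add (by positivity)]
    simp
  have hs : s ∈ U := Metric.mem_ball_self one_pos
  have h1 : HasFDerivAt (fun r : ℝ => oscOp μ φ (L₀ + r • L₁) Q x)
      (osc μ φ (fun w => T (c s w))) s := by
    refine hφ.hasFDerivAt_osc (R := θ x) (p := max p₀ (p₁ + 1)) (U := U) Metric.isOpen_ball
      (b := fun r w => Q (x + (L₀ + r • L₁) w)) (b' := fun r w => T (c r w)) ?_ ?_ ?_ hs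
    · intro r _ w
      have d1 : HasDerivAt (fun r : ℝ => x + (L₀ + r • L₁) w) (L₁ w) r := by
        have := (((hasDerivAt_id r).smul_const (L₁ w)).const_add (L₀ w)).const_add x
        simpa using this
      have d2 := (h.differentiable (x + (L₀ + r • L₁) w)).hasFDerivAt.comp_hasDerivAt r d1
      exact d2.hasFDerivAt
    · exact hp₀ _ (le_max_left _ _)
    · exact (hcfam _ (le_max_right _ _)).clm_comp (T.restrictScalars ℝ)
  have hamp : IsAmplitude (c s) := (hcfam _ le_rfl).isAmplitude ⟨s, hs⟩
  rw [hφ.osc_clm hamp T, hT] at h1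
  have h2 := h1.hasDerivAt
  simp only [ContinuousLinearMap.smulRight_apply, one_apply_eq_self, one_smul] at h2
  convert h2 using 1
  set L := L₀ + s • L₁ with hL
  have e1 : c s = fun w => ∑ k, (l (τ k) w : ℂ) • fderiv ℝ Q (x + L w) (p k) := by
    ext w
    rw [hc]
    simp only
    rw [hL₁ w, map_sum]
    refine Finset.sum_congr rfl fun k _ => ?_
    rw [map_smul, Complex.coe_smul]
  have ha : ∀ k, IsAmplitude (fun w => fderiv ℝ Q (x + L w) (p k)) := fun k =>
    (h.fderiv_apply (p k)).isAmplitude hθ x L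
  have hla : ∀ k, IsAmplitude (fun w => (l (τ k) w : ℂ) • fderiv ℝ Q (x + L w) (p k)) := fun k =>
    (isAmplitude_clm (Complex.ofRealCLM.comp (l (τ k)))).smul (ha k)
  rw [e1, (hφ.osc_sum Finset.univ fun k _ => hla k).2]
  -- Because L₁ vanishes on e_{τ k}, the direction L e_{τ k} does not depend on s; the same second
  -- order operator therefore serves for every s.
  have e2 : ∀ k w, fderiv ℝ (fun w => fderiv ℝ Q (x + L w) (p k)) w (e (τ k)) =
      fderiv ℝ (fun x => fderiv ℝ Q x (p k)) (x + L w) (L₀ (e (τ k))) := by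
    intro k w
    have d1 : HasFDerivAt (fun w => x + L w) L w := L.hasFDerivAt.const_add x
    have d2 := ((h.fderiv_apply (p k)).differentiable (x + L w)).hasFDerivAt.comp w d1
    have d3 : HasFDerivAt (fun w => fderiv ℝ Q (x + L w) (p k)) _ w := d2
    rw [d3.fderiv]
    simp [hL, hL₁e]
  have hb : ∀ k, IsAmplitude (fun w =>
      fderiv ℝ (fun x => fderiv ℝ Q x (p k)) (x + L w) (L₀ (e (τ k)))) := fun k =>
    ((h.fderiv_apply (p k)).fderiv_apply _).isAmplitude hθ x L
  have e3 : oscOp μ φ L (transportOp p (fun k => L₀ (e (τ k))) Q) x = (-Complex.I) •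
      ∑ k, osc μ φ (fun w => fderiv ℝ (fun x => fderiv ℝ Q x (p k)) (x + L w) (L₀ (e (τ k)))) := by
    rw [← (hφ.osc_sum Finset.univ fun k _ => hb k).2]
    exact hφ.osc_clm ((hφ.osc_sum (μ := μ) Finset.univ fun k _ => hb k).1)
      ((-Complex.I) • ContinuousLinearMap.id ℂ A)
  rw [e3, Finset.smul_sum]
  refine Finset.sum_congr rfl fun k _ => ?_
  simp_rw [← e2]
  exact (hφ.osc_linear_smul (ha k) (τ k)).symm

end Operator

end

end

section

open scoped ContDiff Matrix SchwartzMap LineDeriv Topology FourierTransform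
open MeasureTheory Filter

set_option linter.unusedSectionVars false

noncomputable section

/-! ### The phase e^{-i⟨y,η⟩}, its normalization, and the Taylor expansion -/

section StandardPhase

variable {n : ℕ}

local notation "E" => EuclideanSpace ℝ (Fin n)

/-- The phase `(y, η) ↦ exp (-i ⟨y, η⟩)`. -/
def phase (n : ℕ) (w : EuclideanSpace ℝ (Fin n) × EuclideanSpace ℝ (Fin n)) : ℂ :=
  Complex.exp (-(Complex.I * (inner ℝ w.1 w.2 : ℝ)))

/-- The standard basis of `ℝⁿ × ℝⁿ`. -/
def phaseDir (n : ℕ) : Fin n ⊕ Fin n → EuclideanSpace ℝ (Fin n) × EuclideanSpace ℝ (Fin n) :=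
  Sum.elim (fun j => (EuclideanSpace.single j 1, 0)) (fun j => (0, EuclideanSpace.single j 1))

/-- The coordinates dual to `phaseDir` under the pairing `⟨y, η⟩`. -/
def phaseForm (n : ℕ) :
    Fin n ⊕ Fin n → (EuclideanSpace ℝ (Fin n) × EuclideanSpace ℝ (Fin n)) →L[ℝ] ℝ :=
  Sum.elim (fun j => (EuclideanSpace.proj j).comp (ContinuousLinearMap.snd ℝ _ _))
    (fun j => (EuclideanSpace.proj j).comp (ContinuousLinearMap.fst ℝ _ _))

theorem hasFDerivAt_phase (w : E × E) : HasFDerivAt (phase n)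
    (phase n w • (-(Complex.I • Complex.ofRealCLM.comp (fderivInnerCLM ℝ (w.1, w.2) ∘L
      (ContinuousLinearMap.fst ℝ E E).prod (ContinuousLinearMap.snd ℝ E E))))) w := by
  have h1 : HasFDerivAt (fun w : E × E => (inner ℝ w.1 w.2 : ℝ)) _ w :=
    (hasFDerivAt_fst (𝕜 := ℝ) (p := w)).inner ℝ (hasFDerivAt_snd (𝕜 := ℝ) (p := w))
  have h2 := ((Complex.ofRealCLM.hasFDerivAt.comp w h1).const_mul Complex.I).neg
  exact h2.cexp

theorem isPhase_phase : IsPhase (phase n) (phaseDir n) (phaseForm n) where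
  norm_eq w := by
    rw [phase, show -(Complex.I * ((inner ℝ w.1 w.2 : ℝ) : ℂ)) =
      ((-(inner ℝ w.1 w.2) : ℝ) : ℂ) * Complex.I by push_cast; ring]
    exact Complex.norm_exp_ofReal_mul_I _
  differentiable w := (hasFDerivAt_phase w).differentiableAt
  fderiv_eq w j := by
    rw [(hasFDerivAt_phase w).fderiv]
    rcases j with j | j <;>
    simp [phaseDir, phaseForm, EuclideanSpace.inner_single_left,
      EuclideanSpace.inner_single_right] <;> ring
  norm_sq_le w := by
    have h1 : ‖w.1‖ ^ 2 = ∑ j, (w.1 j) ^ 2 := by simp [EuclideanSpace.real_norm_sq_eq]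
    have h2 : ‖w.2‖ ^ 2 = ∑ j, (w.2 j) ^ 2 := by simp [EuclideanSpace.real_norm_sq_eq]
    have h3 : ∑ j, (phaseForm n j w) ^ 2 = ‖w.2‖ ^ 2 + ‖w.1‖ ^ 2 := by
      rw [Fintype.sum_sum_type, h1, h2]
      rfl
    -- The product carries the maximum norm, whose square is one of the two summands.
    rw [h3, Prod.norm_def]
    rcases max_choice ‖w.1‖ ‖w.2‖ with h | h <;> rw [h] <;> nlinarith [sq_nonneg ‖w.1‖, sq_nonneg ‖w.2‖]

/-- The normalized Lebesgue measure `(2π)⁻ⁿ dy dη`. -/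
def phaseMeasure (n : ℕ) : Measure (EuclideanSpace ℝ (Fin n) × EuclideanSpace ℝ (Fin n)) :=
  ENNReal.ofReal ((2 * Real.pi) ^ n)⁻¹ • volume

instance isAddHaarMeasure_volume_prod : (volume : Measure (E × E)).IsAddHaarMeasure := by
  rw [Measure.volume_eq_prod]
  infer_instance

instance isAddHaarMeasure_phaseMeasure : (phaseMeasure n).IsAddHaarMeasure := by
  refine Measure.IsAddHaarMeasure.smul _ ?_ ENNReal.ofReal_ne_top
  simp only [ne_eq, ENNReal.ofReal_eq_zero, not_le]
  positivity

theorem integral_phaseMeasure {A : Type*} [NormedAddCommGroup A] [NormedSpace ℝ A]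
    (b : E × E → A) : ∫ w, b w ∂(phaseMeasure n) = ((2 * Real.pi) ^ n)⁻¹ • ∫ w, b w := by
  rw [phaseMeasure, integral_smul_measure, ENNReal.toReal_ofReal (by positivity)]

/-- A product cutoff lets the regularized integral of a constant be computed by Fubini as a Fourier
transform; any one cutoff suffices, as the limit does not depend on it. -/
theorem exists_schwartz_tensor : ∃ (ψ : 𝓢(E, ℂ)) (χ : 𝓢(E × E, ℂ)), ψ 0 = 1 ∧
    ∀ w, χ w = ψ w.1 * ψ w.2 := by
  let f : ContDiffBump (0 : E) := ⟨1, 2, one_pos, one_lt_two⟩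
  have h1 : HasCompactSupport (fun w => (f w : ℂ)) :=
    f.hasCompactSupport.comp_left (g := fun r : ℝ => (r : ℂ)) (by simp)
  have h2 : ContDiff ℝ ∞ (fun w => (f w : ℂ)) := Complex.ofRealCLM.contDiff.comp f.contDiff
  have h3 : HasCompactSupport (fun w : E × E => (f w.1 : ℂ) * (f w.2 : ℂ)) := by
    refine HasCompactSupport.intro (h1.isCompact.prod h1.isCompact) fun w hw => ?_
    by_contra h
    refine hw ⟨subset_tsupport _ ?_, subset_tsupport _ ?_⟩
    · exact left_ne_zero_of_mul h
    · exact right_ne_zero_of_mul h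
  have h4 : ContDiff ℝ ∞ (fun w : E × E => (f w.1 : ℂ) * (f w.2 : ℂ)) :=
    (h2.comp contDiff_fst).mul (h2.comp contDiff_snd)
  refine ⟨h1.toSchwartzMap h2, h3.toSchwartzMap h4, ?_, fun w => rfl⟩
  change ((f 0 : ℝ) : ℂ) = 1
  rw [f.one_of_mem_closedBall (by simp [f.rIn_pos.le])]
  simp

theorem integral_phase_schwartz (ψ : 𝓢(E, ℂ)) (y : E) :
    ∫ η, phase n (y, η) * ψ η = (𝓕 ψ) ((2 * Real.pi)⁻¹ • y) := by
  rw [SchwartzMap.fourier_coe, Real.fourier_eq']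
  congr 1
  ext η
  rw [phase, smul_eq_mul]
  congr 2
  rw [inner_smul_right, real_inner_comm]
  push_cast
  have : (Real.pi : ℂ) ≠ 0 := by exact_mod_cast Real.pi_ne_zero
  field_simp

theorem integral_fourier_scaled (ψ : 𝓢(E, ℂ)) :
    ∫ y, (𝓕 ψ) ((2 * Real.pi)⁻¹ • y) = ((2 * Real.pi) ^ n : ℝ) • ψ 0 := by
  rw [Measure.integral_comp_smul]
  have h1 : ψ 0 = ∫ y, (𝓕 ψ) y := by
    have h2 : 𝓕⁻ (𝓕 ψ) = ψ := FourierTransform.fourierInv_fourier_eq ψ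
    have h3 : (𝓕⁻ (𝓕 ψ)) 0 = ∫ y, (𝓕 ψ) y := by
      rw [SchwartzMap.fourierInv_coe, Real.fourierInv_eq']
      simp
    rw [← h3, h2]
  rw [← h1, finrank_euclideanSpace_fin, abs_of_pos (by positivity)]
  congr 1
  rw [inv_pow, inv_inv]

/-- The inner integral is the Fourier transform of ψ at scale 1/ε. Substituting y = ε y' moves all
of ε into the slowly varying cutoff ψ(ε² y'), so that dominated convergence applies afterwards. -/
theorem integral_phase_cutoff (ψ : 𝓢(E, ℂ)) {ε : ℝ} (hε : 0 < ε) :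
    ∫ y, (∫ η, phase n (y, η) * ψ (ε • η)) * ψ (ε • y) =
      ∫ y, (𝓕 ψ) ((2 * Real.pi)⁻¹ • y) * ψ (ε ^ 2 • y) := by
  have h1 : ∀ y : E, ∫ η, phase n (y, η) * ψ (ε • η) =
      ((ε ^ n)⁻¹ : ℝ) • (𝓕 ψ) ((2 * Real.pi)⁻¹ • ε⁻¹ • y) := by
    intro y
    rw [← integral_phase_schwartz]
    have := Measure.integral_comp_smul volume (fun η : E => phase n (ε⁻¹ • y, η) * ψ η) ε
    rw [finrank_euclideanSpace_fin, abs_of_pos (by positivity)] at this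
    rw [← this]
    congr 1
    ext η
    congr 1
    simp only [phase, inner_smul_left, inner_smul_right]
    congr 4
    simp only [conj_trivial]
    field_simp
  simp_rw [h1]
  have h2 := Measure.integral_comp_smul volume (fun y : E =>
    (𝓕 ψ) ((2 * Real.pi)⁻¹ • y) * ψ (ε ^ 2 • y)) ε⁻¹
  rw [finrank_euclideanSpace_fin, abs_of_pos (by positivity), inv_pow, inv_inv] at h2
  have h3 : ∀ y : E, ((ε ^ n)⁻¹ : ℝ) • (𝓕 ψ) ((2 * Real.pi)⁻¹ • ε⁻¹ • y) * ψ (ε • y) =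
      ((ε ^ n)⁻¹ : ℝ) • ((𝓕 ψ) ((2 * Real.pi)⁻¹ • ε⁻¹ • y) * ψ (ε ^ 2 • ε⁻¹ • y)) := by
    intro y
    rw [smul_mul_assoc, smul_smul (ε ^ 2), show ε ^ 2 * ε⁻¹ = ε by field_simp]
  simp_rw [h3]
  rw [integral_smul, h2, smul_smul, inv_mul_cancel₀ (by positivity), one_smul]

theorem tendsto_integral_phase_cutoff (ψ : 𝓢(E, ℂ)) :
    Tendsto (fun ε : ℝ => ∫ y, (𝓕 ψ) ((2 * Real.pi)⁻¹ • y) * ψ (ε ^ 2 • y)) (𝓝[>] 0)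
      (𝓝 (((2 * Real.pi) ^ n : ℝ) • ψ 0 * ψ 0)) := by
  have hint : Integrable (fun y : E => (𝓕 ψ) ((2 * Real.pi)⁻¹ • y)) :=
    (SchwartzMap.integrable (𝓕 ψ)).comp_smul (by positivity)
  obtain ⟨C, hC, hb⟩ := (boundedFamily_schwartz (ι := Unit) ψ).norm_le
  rw [← integral_fourier_scaled, ← integral_mul_const]
  refine tendsto_integral_filter_of_dominated_convergence
    (fun y => ‖(𝓕 ψ) ((2 * Real.pi)⁻¹ • y)‖ * C) ?_ ?_ (hint.norm.mul_const C) ?_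
  · refine Eventually.of_forall fun ε => Continuous.aestronglyMeasurable ?_
    exact ((𝓕 ψ).continuous.comp (continuous_const_smul _)).mul
      (ψ.continuous.comp (continuous_const_smul _))
  · refine Eventually.of_forall fun ε => Eventually.of_forall fun y => ?_
    rw [norm_mul]
    gcongr
    simpa using hb () (ε ^ 2 • y)
  · refine Eventually.of_forall fun y => tendsto_nhdsWithin_of_tendsto_nhds ?_
    have : Continuous fun ε : ℝ => (𝓕 ψ) ((2 * Real.pi)⁻¹ • y) * ψ (ε ^ 2 • y) :=
      continuous_const.mul (ψ.continuous.comp ((continuous_pow 2).smul continuous_const))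
    simpa using this.tendsto 0

variable {A : Type*} [NormedAddCommGroup A] [NormedSpace ℂ A] [CompleteSpace A]

theorem isAmplitude_const {W : Type*} [NormedAddCommGroup W] [NormedSpace ℝ W] (c : A) :
    IsAmplitude (fun _ : W => c) :=
  ⟨0, BoundedFamily.of_bound (fun _ => contDiff_const) (fun _ _ => by simp) fun k => by
    refine ⟨‖c‖, fun _ w => ?_⟩
    cases k with
    | zero => simp
    | succ k =>
      rw [iteratedFDeriv_succ_const]
      simp⟩

/-- Here the factor (2π)⁻ⁿ is used: Fourier inversion at the origin gives the value 1 for the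
constant amplitude 1, and a vector c follows by applying the linear map z ↦ z c. -/
theorem osc_const (c : A) : osc (phaseMeasure n) (phase n) (fun _ => c) = c := by
  obtain ⟨ψ, χ, hψ, hχ⟩ := exists_schwartz_tensor (n := n)
  have hχ0 : χ 0 = 1 := by rw [hχ]; simp [hψ]
  have h1 := isPhase_phase.tendsto_regInt (μ := phaseMeasure n) χ
    (isAmplitude_const (W := E × E) (1 : ℂ))
  have h2 : Tendsto (regInt (phaseMeasure n) (phase n) χ (fun _ => (1 : ℂ))) (𝓝[>] 0) (𝓝 1) := by
    have h3 := (tendsto_integral_phase_cutoff ψ).const_smul (((2 * Real.pi) ^ n)⁻¹ : ℝ)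
    rw [hψ, mul_one, smul_smul, inv_mul_cancel₀ (by positivity), one_smul] at h3
    refine h3.congr' ?_
    filter_upwards [self_mem_nhdsWithin] with ε hε
    have hi := isPhase_phase.integrable_regInt (μ := (volume : Measure (E × E))) χ
      (isAmplitude_const (W := E × E) (1 : ℂ)).hasTemperateGrowth hε
    rw [← integral_phase_cutoff ψ hε, regInt, integral_phaseMeasure]
    rw [Measure.volume_eq_prod] at hi ⊢
    rw [integral_prod _ hi]
    congr 2
    ext y
    rw [← integral_mul_const]
    congr 1
    ext η
    rw [hχ]
    simp only [Prod.smul_mk, smul_eq_mul]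
    ring
  have h4 := tendsto_nhds_unique h1 h2
  rw [hχ0, one_smul] at h4
  have h5 := isPhase_phase.osc_clm (μ := phaseMeasure n) (isAmplitude_const (W := E × E) (1 : ℂ))
    ((1 : ℂ →L[ℂ] ℂ).smulRight c)
  simpa [h4] using h5

variable {X : Type*} [NormedAddCommGroup X] [NormedSpace ℝ X] {θ : X → ℝ} {Q : X → A}

theorem sum_coord_smul_single {F : Type*} [AddCommGroup F] [Module ℝ F]
    (y : E) (M : E →ₗ[ℝ] F) : ∑ j, y j • M (EuclideanSpace.single j 1) = M y := by
  have h : y = ∑ j, y j • (EuclideanSpace.single j (1 : ℝ) : E) := by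
    ext i
    simp [Finset.sum_apply, Pi.single_apply]
  conv_rhs => rw [h]
  simp

/-- Fourier inversion for amplitudes that do not depend on η. Along s M y the derivative formula
applies with L₀ = 0, where the second order operator is zero; the integral is constant in s, and at
s = 0 the amplitude is the constant Q(x). -/
theorem oscOp_fst (hθ : IsModerate θ) (h : InClass θ Q) (M : E →L[ℝ] X) (x : X) :
    oscOp (phaseMeasure n) (phase n) (M.comp (ContinuousLinearMap.fst ℝ E E)) Q x = Q x := by
  have h1 : ∀ s : ℝ, HasDerivAt (fun s : ℝ => oscOp (phaseMeasure n) (phase n)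
      (0 + s • M.comp (ContinuousLinearMap.fst ℝ E E)) Q x) 0 s := by
    intro s
    have := isPhase_phase.hasDerivAt_oscOp (μ := phaseMeasure n) hθ h 0
      (M.comp (ContinuousLinearMap.fst ℝ E E)) (K := Fin n)
      (fun j => M (EuclideanSpace.single j 1)) Sum.inr
      (fun w => (sum_coord_smul_single w.1 (M : E →ₗ[ℝ] X)).symm) (fun j => by simp [phaseDir]) x s
    convert this using 1
    have h2 : transportOp (fun j : Fin n => M (EuclideanSpace.single j 1))
        (fun k : Fin n => (0 : E × E →L[ℝ] X) (phaseDir n (Sum.inr k))) Q = fun _ => 0 := by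
      ext x
      simp [transportOp]
    rw [h2]
    exact (osc_const (n := n) (0 : A)).symm
  have h3 := is_const_of_deriv_eq_zero (fun s => (h1 s).differentiableAt) (fun s => (h1 s).deriv) 1 0
  simp only [one_smul, zero_add, zero_smul] at h3
  rw [h3]
  simpa [oscOp] using osc_const (n := n) (Q x)

/-- The remainder of the expansion of `oscOp` along `L₀ + s L₁` in powers of `s`. -/
def oscRemainder (p q : Fin n → X) (L₀ L₁ : E × E →L[ℝ] X) (N : ℕ) (s : ℝ) (Q : X → A) (x : X) : A :=
  oscOp (phaseMeasure n) (phase n) (L₀ + s • L₁) Q x -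
    ∑ k ∈ Finset.range N, (s ^ k / k.factorial : ℝ) • ((transportOp p q)^[k] Q) x

/-- The linear map `(y, η) ↦ ∑ j, y j • q j`. -/
def fstCombo (q : Fin n → X) : E × E →L[ℝ] X :=
  (∑ j, (EuclideanSpace.proj (𝕜 := ℝ) j : E →L[ℝ] ℝ).smulRight (q j)).comp
    (ContinuousLinearMap.fst ℝ E E)

/-- The linear map `(y, η) ↦ ∑ j, η j • p j`. -/
def sndCombo (p : Fin n → X) : E × E →L[ℝ] X :=
  (∑ j, (EuclideanSpace.proj (𝕜 := ℝ) j : E →L[ℝ] ℝ).smulRight (p j)).comp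
    (ContinuousLinearMap.snd ℝ E E)

theorem fstCombo_apply (q : Fin n → X) (w : E × E) : fstCombo q w = ∑ j, w.1 j • q j := by
  simp [fstCombo]

theorem sndCombo_apply (p : Fin n → X) (w : E × E) : sndCombo p w = ∑ j, w.2 j • p j := by
  simp [sndCombo]

theorem hasDerivAt_oscOp_combo (hθ : IsModerate θ) (h : InClass θ Q) (p q : Fin n → X) (x : X)
    (s : ℝ) : HasDerivAt
      (fun s : ℝ => oscOp (phaseMeasure n) (phase n) (fstCombo q + s • sndCombo p) Q x)
      (oscOp (phaseMeasure n) (phase n) (fstCombo q + s • sndCombo p) (transportOp p q Q) x) s := by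
  have hq : (fun k => fstCombo q (phaseDir n (Sum.inl k))) = q := by
    ext k
    simp [fstCombo_apply, phaseDir]
  have := isPhase_phase.hasDerivAt_oscOp (μ := phaseMeasure n) hθ h (fstCombo q) (sndCombo p)
    p Sum.inl (fun w => sndCombo_apply p w) (fun k => by simp [sndCombo_apply, phaseDir]) x s
  rwa [hq] at this

/-- Differentiating in s lowers N by one and replaces Q by its transport, exactly as for Taylor
remainders; the term k = 0 is constant in s and disappears. -/
theorem hasDerivAt_oscRemainder (hθ : IsModerate θ) (h : InClass θ Q) (p q : Fin n → X) (N : ℕ)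
    (x : X) (s : ℝ) :
    HasDerivAt (fun s => oscRemainder p q (fstCombo q) (sndCombo p) (N + 1) s Q x)
      (oscRemainder p q (fstCombo q) (sndCombo p) N s (transportOp p q Q) x) s := by
  have h1 : (fun s => oscRemainder p q (fstCombo q) (sndCombo p) (N + 1) s Q x) = fun s =>
      oscOp (phaseMeasure n) (phase n) (fstCombo q + s • sndCombo p) Q x -
        (∑ k ∈ Finset.range N, (s ^ (k + 1) / (k + 1).factorial : ℝ) •
          ((transportOp p q)^[k] (transportOp p q Q)) x + Q x) := by
    ext s
    rw [oscRemainder, Finset.sum_range_succ']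
    simp
  rw [h1]
  refine (hasDerivAt_oscOp_combo hθ h p q x s).sub (HasDerivAt.add_const _ ?_)
  refine HasDerivAt.fun_sum fun k _ => HasDerivAt.smul_const ?_ _
  have h2 := (hasDerivAt_pow (k + 1) s).div_const ((k + 1).factorial : ℝ)
  convert h2 using 1
  rw [Nat.factorial_succ]
  push_cast
  have : (k.factorial : ℝ) ≠ 0 := by positivity
  field_simp

theorem oscRemainder_zero (hθ : IsModerate θ) (h : InClass θ Q) (p q : Fin n → X) (N : ℕ)
    (x : X) : oscRemainder p q (fstCombo q) (sndCombo p) (N + 1) 0 Q x = 0 := by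
  rw [oscRemainder, Finset.sum_range_succ', zero_smul, add_zero, fstCombo, oscOp_fst hθ h]
  simp

/-- Induction on N: the remainder vanishes at s = 0 and its derivative is the preceding remainder of
the transported function. Integrating over a subinterval of [0,1] does not increase the bound; the
gain of 1/N! is not needed. -/
theorem norm_oscRemainder_le (hθ : IsModerate θ) (h : InClass θ Q) (p q : Fin n → X) (N : ℕ)
    (x : X) {C : ℝ} (hC : ∀ s ∈ Set.Icc (0 : ℝ) 1,
      ‖oscOp (phaseMeasure n) (phase n) (fstCombo q + s • sndCombo p)
        ((transportOp p q)^[N] Q) x‖ ≤ C) :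
    ∀ s ∈ Set.Icc (0 : ℝ) 1, ‖oscRemainder p q (fstCombo q) (sndCombo p) N s Q x‖ ≤ C := by
  induction N generalizing Q with
  | zero => simpa [oscRemainder] using hC
  | succ N ih =>
    intro s hs
    have h1 := ih (h.transportOp hθ p q) hC
    have hC0 : 0 ≤ C := (norm_nonneg _).trans (h1 0 (by simp))
    have h2 := norm_image_sub_le_of_norm_deriv_le_segment'
      (f := fun s => oscRemainder p q (fstCombo q) (sndCombo p) (N + 1) s Q x) (a := 0) (b := 1)
      (fun r _ => (hasDerivAt_oscRemainder hθ h p q N x r).hasDerivWithinAt)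
      (fun r hr => h1 r ⟨hr.1, hr.2.le⟩) s hs
    simp only [oscRemainder_zero hθ h p q N x, sub_zero] at h2
    exact h2.trans (mul_le_of_le_one_right hC0 hs.2)

end StandardPhase

end

end

section

open scoped ContDiff Matrix SchwartzMap Topology
open MeasureTheory Filter

set_option linter.unusedSectionVars false

noncomputable section

namespace PsiCalculus

/-! ### Multi-index powers of operators that commute on an invariant set -/

section MultiIndex

variable {n : ℕ}

theorem len_add (a b : Fin n → ℕ) : len (a + b) = len a + len b := by
  simp [len, Finset.sum_add_distrib]

theorem len_single (j : Fin n) : len (Pi.single j 1) = 1 := by simp [len]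

@[simp] theorem len_zero : len (0 : Fin n → ℕ) = 0 := by simp [len]

theorem multiIndex_induction {P : (Fin n → ℕ) → Prop} (h0 : P 0)
    (hs : ∀ a j, P a → P (a + Pi.single j 1)) (a : Fin n → ℕ) : P a := by
  induction h : len a generalizing a with
  | zero =>
    have : a = 0 := by
      ext i
      exact (Finset.sum_eq_zero_iff.1 h) i (Finset.mem_univ i)
    rwa [this]
  | succ k ih =>
    have : ∃ j, a j ≠ 0 := by
      by_contra! hc
      simp [len, hc] at h
    obtain ⟨j, hj⟩ := this
    have e : a = (a - Pi.single j 1) + Pi.single j 1 := by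
      ext i
      by_cases hij : i = j
      · subst hij; simp; omega
      · simp [hij]
    rw [e]
    refine hs _ j (ih _ ?_)
    rw [e, len_add, len_single] at h
    omega

variable {X Y : Type*} {T : Fin n → X → X} {S : Set X}

theorem multiPow_zero (f : X) : multiPow T 0 f = f := by
  unfold multiPow
  induction List.finRange n with
  | nil => rfl
  | cons j l ih => simp

theorem iterate_mem (hS : ∀ j, ∀ f ∈ S, T j f ∈ S) (j : Fin n) (k : ℕ) {f : X} (hf : f ∈ S) :
    (T j)^[k] f ∈ S := by
  induction k with
  | zero => exact hf
  | succ k ih => rw [Function.iterate_succ_apply']; exact hS _ _ ih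

theorem multiPow_mem (hS : ∀ j, ∀ f ∈ S, T j f ∈ S) (a : Fin n → ℕ) {f : X} (hf : f ∈ S) :
    multiPow T a f ∈ S := by
  unfold multiPow
  induction List.finRange n with
  | nil => exact hf
  | cons j l ih => exact iterate_mem hS j _ ih

theorem map_iterate {T' : Fin n → Y → Y} (Φ : X → Y) (hS : ∀ j, ∀ f ∈ S, T j f ∈ S)
    (hΦ : ∀ j, ∀ f ∈ S, Φ (T j f) = T' j (Φ f)) (j : Fin n) (k : ℕ) {f : X} (hf : f ∈ S) :
    Φ ((T j)^[k] f) = (T' j)^[k] (Φ f) := by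
  induction k with
  | zero => rfl
  | succ k ih =>
    rw [Function.iterate_succ_apply', Function.iterate_succ_apply', hΦ j _ (iterate_mem hS j k hf),
      ih]

theorem map_multiPow {T' : Fin n → Y → Y} (Φ : X → Y) (hS : ∀ j, ∀ f ∈ S, T j f ∈ S)
    (hΦ : ∀ j, ∀ f ∈ S, Φ (T j f) = T' j (Φ f)) (a : Fin n → ℕ) {f : X} (hf : f ∈ S) :
    Φ (multiPow T a f) = multiPow T' a (Φ f) := by
  unfold multiPow
  suffices H : ∀ l : List (Fin n), l.foldr (fun j F => (T j)^[a j] F) f ∈ S ∧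
      Φ (l.foldr (fun j F => (T j)^[a j] F) f) = l.foldr (fun j F => (T' j)^[a j] F) (Φ f) from
    (H _).2
  intro l
  induction l with
  | nil => exact ⟨hf, rfl⟩
  | cons j l ih =>
    refine ⟨iterate_mem hS j _ ih.1, ?_⟩
    simp only [List.foldr_cons]
    rw [map_iterate Φ hS hΦ j _ ih.1, ih.2]

theorem apply_multiPow (hS : ∀ j, ∀ f ∈ S, T j f ∈ S)
    (hT : ∀ i j, ∀ f ∈ S, T i (T j f) = T j (T i f)) (i : Fin n) (a : Fin n → ℕ) {f : X}
    (hf : f ∈ S) : T i (multiPow T a f) = multiPow T a (T i f) :=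
  map_multiPow (T i) hS (hT i) a hf

/-- Commutation is assumed only on an invariant set S, since partial derivatives and δ_j commute
only on smooth functions. The new factor is carried through the ordered product up to position i. -/
theorem multiPow_add_single (hS : ∀ j, ∀ f ∈ S, T j f ∈ S)
    (hT : ∀ i j, ∀ f ∈ S, T i (T j f) = T j (T i f)) (i : Fin n) (a : Fin n → ℕ) {f : X}
    (hf : f ∈ S) : multiPow T (a + Pi.single i 1) f = T i (multiPow T a f) := by
  unfold multiPow
  suffices H : ∀ l : List (Fin n), l.Nodup →
      l.foldr (fun j F => (T j)^[a j] F) f ∈ S ∧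
      l.foldr (fun j F => (T j)^[(a + Pi.single i 1 : Fin n → ℕ) j] F) f =
        if i ∈ l then T i (l.foldr (fun j F => (T j)^[a j] F) f)
        else l.foldr (fun j F => (T j)^[a j] F) f by
    have := (H _ (List.nodup_finRange n)).2
    rwa [if_pos (List.mem_finRange i)] at this
  intro l hl
  induction l with
  | nil => exact ⟨hf, by simp⟩
  | cons j l ih =>
    obtain ⟨h1, h2⟩ := ih (List.nodup_cons.1 hl).2
    have hjl := (List.nodup_cons.1 hl).1
    refine ⟨iterate_mem hS j _ h1, ?_⟩
    simp only [List.foldr_cons]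
    rw [h2]
    by_cases hij : i = j
    · subst hij
      rw [if_neg hjl, if_pos (by simp)]
      simp only [Pi.add_apply, Pi.single_eq_same]
      rw [Function.iterate_succ_apply']
    · have e : (a + Pi.single i 1 : Fin n → ℕ) j = a j := by simp [Ne.symm hij]
      rw [e]
      simp only [List.mem_cons, hij, false_or]
      split_ifs
      · exact (map_iterate (T i) hS (hT i) j (a j) h1).symm
      · rfl

theorem multiPow_single (hS : ∀ j, ∀ f ∈ S, T j f ∈ S)
    (hT : ∀ i j, ∀ f ∈ S, T i (T j f) = T j (T i f)) (i : Fin n) {f : X} (hf : f ∈ S) :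
    multiPow T (Pi.single i 1) f = T i f := by
  have := multiPow_add_single hS hT i 0 hf
  rwa [zero_add, multiPow_zero] at this

end MultiIndex

/-! ### Partial derivatives of smooth functions -/

section SmoothFunctions

variable {n : ℕ} {A : Type*} [NormedAddCommGroup A] [NormedSpace ℝ A]

theorem fderiv_fderiv_apply_comm {V : Type*} [NormedAddCommGroup V] [NormedSpace ℝ V] {f : V → A}
    (hf : ContDiff ℝ ∞ f) (u v x : V) :
    fderiv ℝ (fun x => fderiv ℝ f x u) x v = fderiv ℝ (fun x => fderiv ℝ f x v) x u := by
  have hd : Differentiable ℝ (fderiv ℝ f) :=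
    (hf.fderiv_right (m := ∞) (by simp)).differentiable (by simp)
  have h1 : ∀ u v : V, fderiv ℝ (fun x => fderiv ℝ f x u) x v = fderiv ℝ (fderiv ℝ f) x v u := by
    intro u v
    rw [fderiv_clm_apply (hd x) (differentiableAt_const u)]
    simp
  rw [h1, h1]
  exact (hf.contDiffAt.isSymmSndFDerivAt (by
    rw [minSmoothness_of_isRCLikeNormedField]
    exact WithTop.coe_le_coe.2 (le_top : (2 : ℕ∞) ≤ ⊤))).eq v u

theorem contDiff_fderiv_apply {V : Type*} [NormedAddCommGroup V] [NormedSpace ℝ V] {f : V → A}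
    (hf : ContDiff ℝ ∞ f) (v : V) : ContDiff ℝ ∞ (fun x => fderiv ℝ f x v) :=
  (hf.fderiv_right (m := ∞) (by simp)).clm_apply contDiff_const

theorem contDiff_partialD (j : Fin n) (f : EuclideanSpace ℝ (Fin n) → A)
    (hf : f ∈ {f : EuclideanSpace ℝ (Fin n) → A | ContDiff ℝ ∞ f}) :
    partialD j f ∈ {f : EuclideanSpace ℝ (Fin n) → A | ContDiff ℝ ∞ f} :=
  contDiff_fderiv_apply hf _

theorem partialD_comm (i j : Fin n) (f : EuclideanSpace ℝ (Fin n) → A)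
    (hf : f ∈ {f : EuclideanSpace ℝ (Fin n) → A | ContDiff ℝ ∞ f}) :
    partialD i (partialD j f) = partialD j (partialD i f) := by
  ext x
  exact fderiv_fderiv_apply_comm hf _ _ x

theorem partialPow_zero (f : EuclideanSpace ℝ (Fin n) → A) : partialPow 0 f = f :=
  multiPow_zero f

theorem partialPow_add_single (a : Fin n → ℕ) (j : Fin n) {f : EuclideanSpace ℝ (Fin n) → A}
    (hf : ContDiff ℝ ∞ f) : partialPow (a + Pi.single j 1) f = partialD j (partialPow a f) :=
  multiPow_add_single contDiff_partialD partialD_comm j a hf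

theorem partialPow_single (j : Fin n) {f : EuclideanSpace ℝ (Fin n) → A}
    (hf : ContDiff ℝ ∞ f) : partialPow (Pi.single j 1) f = partialD j f :=
  multiPow_single contDiff_partialD partialD_comm j hf

theorem partialPow_partialD (a : Fin n → ℕ) (j : Fin n) {f : EuclideanSpace ℝ (Fin n) → A}
    (hf : ContDiff ℝ ∞ f) : partialPow a (partialD j f) = partialD j (partialPow a f) :=
  (apply_multiPow contDiff_partialD partialD_comm j a hf).symm

theorem partialD_const_smul {𝕜 : Type*} [NormedField 𝕜] [NormedSpace 𝕜 A] [SMulCommClass ℝ 𝕜 A]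
    (c : 𝕜) (j : Fin n) {f : EuclideanSpace ℝ (Fin n) → A} (hf : ContDiff ℝ ∞ f) :
    partialD j (fun x => c • f x) = fun x => c • partialD j f x := by
  ext x
  have h : HasFDerivAt (fun x => c • f x) (c • fderiv ℝ f x) x :=
    ((hf.differentiable (by simp)) x).hasFDerivAt.const_smul c
  simp [partialD, h.fderiv]

theorem partialD_add (j : Fin n) {f g : EuclideanSpace ℝ (Fin n) → A} (hf : ContDiff ℝ ∞ f)
    (hg : ContDiff ℝ ∞ g) :
    partialD j (fun x => f x + g x) = fun x => partialD j f x + partialD j g x := by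
  ext x
  have h : HasFDerivAt (fun x => f x + g x) (fderiv ℝ f x + fderiv ℝ g x) x :=
    ((hf.differentiable (by simp)) x).hasFDerivAt.add ((hg.differentiable (by simp)) x).hasFDerivAt
  simp [partialD, h.fderiv]

theorem fderiv_eq_sum_partialD {f : EuclideanSpace ℝ (Fin n) → A}
    (x v : EuclideanSpace ℝ (Fin n)) : fderiv ℝ f x v = ∑ j, v j • partialD j f x :=
  (sum_coord_smul_single v (fderiv ℝ f x : EuclideanSpace ℝ (Fin n) →ₗ[ℝ] A)).symm

end SmoothFunctions

end PsiCalculus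

namespace TwistedSystem

open PsiCalculus

variable {n : ℕ} {A : Type*} [CStarAlgebra A] (D : TwistedSystem n A)

-- Smooth orbits and the function (t,ξ) ↦ α_t(f ξ)

local notation "E" => EuclideanSpace ℝ (Fin n)

theorem norm_act (t : E) (a : A) : ‖D.act t a‖ = ‖a‖ :=
  NonUnitalStarAlgHom.norm_map (D.act t) (D.act t).injective a

/-- The automorphism `α_t` as a continuous linear map. -/
def actL (t : E) : A →L[ℂ] A :=
  LinearMap.mkContinuous (D.act t : A →ₗ[ℂ] A) 1 fun a => by
    simpa using (D.norm_act t a).le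

@[simp]
theorem actL_apply (t : E) (a : A) : D.actL t a = D.act t a := rfl

/-- Strong continuity gives joint continuity because every α_t is isometric. -/
theorem continuous_act {Y : Type*} [TopologicalSpace Y] {t : Y → E} {u : Y → A}
    (ht : Continuous t) (hu : Continuous u) : Continuous fun y => D.act (t y) (u y) := by
  rw [continuous_iff_continuousAt]
  intro y
  have h1 : Tendsto (fun z => D.act (t z) (u y)) (𝓝 y) (𝓝 (D.act (t y) (u y))) :=
    ((D.act_continuous (u y)).comp ht).tendsto y
  have h2 : Tendsto (fun z => D.act (t z) (u z) - D.act (t z) (u y)) (𝓝 y) (𝓝 0) := by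
    have h3 : Tendsto (fun z => ‖u z - u y‖) (𝓝 y) (𝓝 0) :=
      tendsto_iff_norm_sub_tendsto_zero.1 (hu.tendsto y)
    refine squeeze_zero_norm (fun z => ?_) h3
    rw [← map_sub, norm_act]
  have h4 := h2.add h1
  simpa [ContinuousAt] using h4

/-- The smooth functions `u` with `u (t + s) = α_t (u s)`. -/
def equivariant : Set (E → A) :=
  {u | ContDiff ℝ ∞ u ∧ ∀ t s, u (t + s) = D.act t (u s)}

theorem equivariant_orbit {a : A} (ha : D.IsSmoothElt a) :
    (fun t => D.act t a) ∈ D.equivariant :=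
  ⟨ha, fun t s => D.act_add t s a⟩

theorem eq_orbit {u : E → A} (hu : u ∈ D.equivariant) : u = fun t => D.act t (u 0) := by
  ext t
  simpa using hu.2 t 0

theorem isSmoothElt_of_equivariant {u : E → A} (hu : u ∈ D.equivariant) :
    D.IsSmoothElt (u 0) := by
  rw [IsSmoothElt, ← D.eq_orbit hu]
  exact hu.1

/-- Translation in t is the bounded map α_t, which commutes with differentiation. Hence derivatives
of an orbit are again orbits, determined by their value at 0. -/
theorem partialD_equivariant (j : Fin n) (u : E → A) (hu : u ∈ D.equivariant) :
    partialD j u ∈ D.equivariant := by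
  refine ⟨contDiff_partialD j u hu.1, fun t s => ?_⟩
  have h1 : HasFDerivAt (fun s => u (t + s)) (fderiv ℝ u (t + s)) s := by
    have := ((hu.1.differentiable (by simp)) (t + s)).hasFDerivAt.comp s
      ((hasFDerivAt_id s).const_add t)
    rwa [ContinuousLinearMap.comp_id] at this
  have h2 : HasFDerivAt (fun s => u (t + s)) (((D.actL t).restrictScalars ℝ).comp (fderiv ℝ u s)) s := by
    have e : (fun s => u (t + s)) = fun s => (D.actL t).restrictScalars ℝ (u s) := by
      ext s; exact hu.2 t s
    rw [e]
    exact ((D.actL t).restrictScalars ℝ).hasFDerivAt.comp s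
      ((hu.1.differentiable (by simp)) s).hasFDerivAt
  rw [partialD, h1.unique h2]
  rfl

theorem partialPow_equivariant (c : Fin n → ℕ) {u : E → A} (hu : u ∈ D.equivariant) :
    partialPow c u ∈ D.equivariant :=
  multiPow_mem D.partialD_equivariant c hu

theorem delta_zero_index (a : A) : D.delta 0 a = a := by
  simp [delta, partialPow_zero, D.act_zero]

theorem orbit_smul (c : ℂ) (a : A) : (fun t => D.act t (c • a)) = fun t => c • D.act t a := by
  ext t; exact map_smul _ _ _

theorem IsSmoothElt.smul {a : A} (ha : D.IsSmoothElt a) (c : ℂ) : D.IsSmoothElt (c • a) := by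
  rw [IsSmoothElt, orbit_smul]
  exact ContDiff.const_smul c ha

theorem isSmoothElt_delta {a : A} (ha : D.IsSmoothElt a) (c : Fin n → ℕ) :
    D.IsSmoothElt (D.delta c a) :=
  IsSmoothElt.smul D (D.isSmoothElt_of_equivariant
    (D.partialPow_equivariant c (D.equivariant_orbit ha))) _

theorem delta_single {a : A} (ha : D.IsSmoothElt a) (j : Fin n) :
    D.delta (Pi.single j 1) a = Complex.I⁻¹ • partialD j (fun t => D.act t a) 0 := by
  rw [delta, partialPow_single j ha, len_single, pow_one]

/-- The derivative ∂^c of the orbit of a is the orbit of its own value at 0, so one further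
derivative at 0 is δ_j applied to δ^c a. -/
theorem delta_add_single {a : A} (ha : D.IsSmoothElt a) (c : Fin n → ℕ) (j : Fin n) :
    D.delta (c + Pi.single j 1) a = D.delta (Pi.single j 1) (D.delta c a) := by
  have h1 := D.partialPow_equivariant c (D.equivariant_orbit ha)
  have h2 := D.eq_orbit h1
  rw [D.delta_single (D.isSmoothElt_delta ha c), delta, delta, orbit_smul]
  simp_rw [← congrFun h2]
  rw [partialD_const_smul _ _ h1.1, partialPow_add_single _ _ ha, len_add, len_single, pow_succ,
    smul_smul, mul_comm]

theorem delta_delta_single {a : A} (ha : D.IsSmoothElt a) (c : Fin n → ℕ) (j : Fin n) :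
    D.delta c (D.delta (Pi.single j 1) a) = D.delta (c + Pi.single j 1) a := by
  induction c using multiIndex_induction with
  | h0 => rw [delta_zero_index, zero_add]
  | hs c i ih =>
    rw [D.delta_add_single (D.isSmoothElt_delta ha _), ih, ← D.delta_add_single ha]
    congr 1
    abel

/-- The function `(t, ξ) ↦ α_t (f ξ)`. -/
def joint (f : E → A) (z : E × E) : A := D.act z.1 (f z.2)

/-- The derivation `δ_j` acting pointwise on functions. -/
def del (j : Fin n) (f : E → A) : E → A := fun x => D.delta (Pi.single j 1) (f x)

/-- The functions `f` for which `(t, ξ) ↦ α_t (f ξ)` is smooth. -/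
def jointSmooth : Set (E → A) := {f | ContDiff ℝ ∞ (D.joint f)}

theorem joint_zero (f : E → A) (x : E) : D.joint f (0, x) = f x := D.act_zero _

/-- Identities between δ_j and ∂_j are proved after passing to `joint`, where both are directional
derivatives. -/
theorem joint_injective : Function.Injective D.joint := fun f g h => by
  ext x
  rw [← D.joint_zero f, h, joint_zero]

variable {D} {f : EuclideanSpace ℝ (Fin n) → A}

theorem contDiff_joint (hf : f ∈ D.jointSmooth) : ContDiff ℝ ∞ (D.joint f) := hf

theorem jointSmooth_contDiff (hf : f ∈ D.jointSmooth) : ContDiff ℝ ∞ f := by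
  have h1 : ContDiff ℝ ∞ (fun x : E => D.joint f (0, x)) :=
    ContDiff.comp (contDiff_joint hf) (contDiff_const.prodMk contDiff_id)
  simpa only [joint_zero] using h1

theorem jointSmooth_isSmoothElt (hf : f ∈ D.jointSmooth) (x : E) : D.IsSmoothElt (f x) :=
  ContDiff.comp (contDiff_joint hf) (contDiff_id.prodMk contDiff_const)

theorem joint_partialD (hf : f ∈ D.jointSmooth) (j : Fin n) :
    D.joint (partialD j f) = fun z => fderiv ℝ (D.joint f) z (0, EuclideanSpace.single j 1) := by
  ext ⟨t, x⟩
  have h1 : HasFDerivAt (fun x => D.joint f (t, x))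
      ((fderiv ℝ (D.joint f) (t, x)).comp (ContinuousLinearMap.inr ℝ E E)) x :=
    (((contDiff_joint hf).differentiable (by simp)) (t, x)).hasFDerivAt.comp x
      (hasFDerivAt_prodMk_right t x)
  have h2 : HasFDerivAt (fun x => D.joint f (t, x))
      (((D.actL t).restrictScalars ℝ).comp (fderiv ℝ f x)) x :=
    ((D.actL t).restrictScalars ℝ).hasFDerivAt.comp x
      (((jointSmooth_contDiff hf).differentiable (by simp)) x).hasFDerivAt
  have h3 := congrArg (fun T => T (EuclideanSpace.single j 1)) (h2.unique h1)
  simpa [joint, partialD] using h3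

theorem joint_del (hf : f ∈ D.jointSmooth) (j : Fin n) :
    D.joint (D.del j f) = fun z => (-Complex.I) •
      fderiv ℝ (D.joint f) z (EuclideanSpace.single j 1, 0) := by
  ext ⟨t, x⟩
  have hx := jointSmooth_isSmoothElt hf x
  have h1 : HasFDerivAt (fun t => D.joint f (t, x))
      ((fderiv ℝ (D.joint f) (t, x)).comp (ContinuousLinearMap.inl ℝ E E)) t :=
    HasFDerivAt.comp (f := fun t => (t, x)) t (((contDiff_joint hf).differentiable (by simp)) (t, x)).hasFDerivAt
      (hasFDerivAt_prodMk_left t x)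
  have h2 : partialD j (fun t => D.act t (f x)) t =
      fderiv ℝ (D.joint f) (t, x) (EuclideanSpace.single j 1, 0) := by
    have : fderiv ℝ (fun t => D.act t (f x)) t = _ := h1.fderiv
    rw [partialD, this]
    simp
  have h3 := congrFun (D.eq_orbit (D.partialD_equivariant j _ (D.equivariant_orbit hx))) t
  rw [← h2, h3]
  simp only [joint, del]
  rw [D.delta_single hx, map_smul, Complex.inv_I]

theorem partialD_jointSmooth (j : Fin n) (f : E → A) (hf : f ∈ D.jointSmooth) :
    partialD j f ∈ D.jointSmooth := by
  rw [jointSmooth, Set.mem_ofPred_eq, joint_partialD hf]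
  exact contDiff_fderiv_apply hf _

theorem del_jointSmooth (j : Fin n) (f : E → A) (hf : f ∈ D.jointSmooth) :
    D.del j f ∈ D.jointSmooth := by
  rw [jointSmooth, Set.mem_ofPred_eq, joint_del hf]
  exact (contDiff_fderiv_apply hf _).const_smul _

theorem fderiv_const_smul_apply' {V : Type*} [NormedAddCommGroup V] [NormedSpace ℝ V] {u : V → A}
    (hu : ContDiff ℝ ∞ u) (c : ℂ) (x v : V) :
    fderiv ℝ (fun x => c • u x) x v = c • fderiv ℝ u x v := by
  have h : HasFDerivAt (fun x => c • u x) (c • fderiv ℝ u x) x :=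
    ((hu.differentiable (by simp)) x).hasFDerivAt.const_smul c
  rw [h.fderiv]; rfl

/-- Symmetry of second derivatives of `joint f`. -/
theorem del_comm (i j : Fin n) (f : E → A) (hf : f ∈ D.jointSmooth) :
    D.del i (D.del j f) = D.del j (D.del i f) := by
  apply D.joint_injective
  rw [joint_del (del_jointSmooth j f hf), joint_del (del_jointSmooth i f hf), joint_del hf,
    joint_del hf]
  ext z
  rw [fderiv_const_smul_apply' (contDiff_fderiv_apply hf _),
    fderiv_const_smul_apply' (contDiff_fderiv_apply hf _), fderiv_fderiv_apply_comm hf]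

theorem del_partialD (i j : Fin n) (f : E → A) (hf : f ∈ D.jointSmooth) :
    D.del i (partialD j f) = partialD j (D.del i f) := by
  apply D.joint_injective
  rw [joint_del (partialD_jointSmooth j f hf), joint_partialD (del_jointSmooth i f hf),
    joint_del hf, joint_partialD hf]
  ext z
  rw [fderiv_const_smul_apply' (contDiff_fderiv_apply hf _), fderiv_fderiv_apply_comm hf]

theorem delta_comp_eq_multiPow (hf : f ∈ D.jointSmooth) (c : Fin n → ℕ) :
    (fun x => D.delta c (f x)) = multiPow D.del c f := by
  induction c using multiIndex_induction with
  | h0 => simp [delta_zero_index, multiPow_zero]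
  | hs c j ih =>
    rw [multiPow_add_single del_jointSmooth del_comm j c hf, ← ih]
    ext x
    exact D.delta_add_single (jointSmooth_isSmoothElt hf x) c j

theorem partialPow_jointSmooth (b : Fin n → ℕ) (hf : f ∈ D.jointSmooth) :
    partialPow b f ∈ D.jointSmooth :=
  multiPow_mem partialD_jointSmooth b hf

theorem delta_jointSmooth (c : Fin n → ℕ) (hf : f ∈ D.jointSmooth) :
    (fun x => D.delta c (f x)) ∈ D.jointSmooth := by
  rw [delta_comp_eq_multiPow hf]
  exact multiPow_mem del_jointSmooth c hf

theorem isSmoothMap_of_jointSmooth (hf : f ∈ D.jointSmooth) : D.IsSmoothMap f where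
  mem b x := jointSmooth_isSmoothElt (partialPow_jointSmooth b hf) x
  smooth c := jointSmooth_contDiff (delta_jointSmooth c hf)

end TwistedSystem

end

end

section

open scoped ContDiff Matrix SchwartzMap Topology
open MeasureTheory Filter

set_option linter.unusedSectionVars false

noncomputable section

/-! ### Smooth maps into A^∞ are the jointly smooth ones -/

namespace TwistedSystem

open PsiCalculus

variable {n : ℕ} {A : Type*} [CStarAlgebra A] {D : TwistedSystem n A}

local notation "E" => EuclideanSpace ℝ (Fin n)

variable (D) in
/-- The operator `a ↦ ∫₀ʳ α_{σ v} a dσ`. -/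
def actAverage (v : E) (r : ℝ) : A →L[ℝ] A :=
  LinearMap.mkContinuous
    { toFun := fun a => ∫ σ in (0 : ℝ)..r, D.act (σ • v) a
      map_add' := fun a b => by
        simp only [map_add]
        exact intervalIntegral.integral_add
          ((D.continuous_act (by fun_prop) continuous_const).intervalIntegrable _ _)
          ((D.continuous_act (by fun_prop) continuous_const).intervalIntegrable _ _)
      map_smul' := fun c a => by
        simp only [RingHom.id_apply]
        rw [← intervalIntegral.integral_smul]
        congr 1
        ext σ
        exact ((D.actL (σ • v)).restrictScalars ℝ).map_smul c a }
    |r| fun a => by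
      have := intervalIntegral.norm_integral_le_of_norm_le_const (a := (0 : ℝ)) (b := r)
        (f := fun σ => D.act (σ • v) a) (C := ‖a‖) fun σ _ => (D.norm_act _ _).le
      rw [sub_zero, mul_comm] at this
      exact this

theorem actAverage_apply (v : E) (r : ℝ) (a : A) :
    D.actAverage v r a = ∫ σ in (0 : ℝ)..r, D.act (σ • v) a := rfl

theorem hasDerivAt_orbit {a : A} (ha : D.IsSmoothElt a) (j : Fin n) (r : ℝ) :
    HasDerivAt (fun r : ℝ => D.act (r • EuclideanSpace.single j (1 : ℝ)) a)
      (D.act (r • EuclideanSpace.single j (1 : ℝ)) (Complex.I • D.delta (Pi.single j 1) a)) r := by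
  set v : E := EuclideanSpace.single j 1
  have h1 : HasDerivAt (fun r : ℝ => r • v) v r := by
    simpa using (hasDerivAt_id r).smul_const v
  have h2 : HasDerivAt (fun r : ℝ => D.act (r • v) a) (partialD j (fun t => D.act t a) (r • v)) r := by
    have h := ((ContDiff.differentiable ha (by simp)) (r • v)).hasFDerivAt
    exact HasFDerivAt.comp_hasDerivAt (l := fun t => D.act t a) (f := fun r : ℝ => r • v) r h h1
  have h3 := congrFun (D.eq_orbit (D.partialD_equivariant j _ (D.equivariant_orbit ha))) (r • v)
  rw [h3] at h2
  convert h2 using 2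
  rw [D.delta_single ha, smul_smul, mul_inv_cancel₀ Complex.I_ne_zero, one_smul]

/-- The fundamental theorem of calculus along an orbit. The right side is a bounded operator applied
to δ_j a, which is what makes δ_j a closed operator. -/
theorem act_sub_eq_actAverage {a : A} (ha : D.IsSmoothElt a) (j : Fin n) (r : ℝ) :
    D.act (r • EuclideanSpace.single j (1 : ℝ)) a - a =
      D.actAverage (EuclideanSpace.single j 1) r (Complex.I • D.delta (Pi.single j 1) a) := by
  rw [actAverage_apply, intervalIntegral.integral_eq_sub_of_hasDerivAt
    (fun σ _ => hasDerivAt_orbit ha j σ)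
    ((D.continuous_act (by fun_prop) continuous_const).intervalIntegrable _ _), zero_smul,
    D.act_zero]

/-- `δ_k` is a closed operator, so that it commutes with partial derivatives. -/
theorem delta_single_partialD {h : E → A} (hs : ∀ x, D.IsSmoothElt (h x))
    (hd : Differentiable ℝ h) (k j : Fin n) (hd' : Differentiable ℝ (D.del k h)) (x : E)
    (hx : D.IsSmoothElt (partialD j h x)) :
    D.delta (Pi.single k 1) (partialD j h x) = partialD j (D.del k h) x := by
  set v : E := EuclideanSpace.single k 1 with hv
  -- The integrated identity for h(x) contains only bounded operators, so it may be differentiated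
  -- in x; differentiating the result in r at 0 then recovers δ_k of the partial derivative.
  have h1 : ∀ r : ℝ, D.act (r • v) (partialD j h x) - partialD j h x =
      D.actAverage v r (Complex.I • partialD j (D.del k h) x) := by
    intro r
    have e : (fun x => D.act (r • v) (h x) - h x) =
        fun x => D.actAverage v r (Complex.I • D.del k h x) :=
      funext fun x => act_sub_eq_actAverage (hs x) k r
    have d1 : HasFDerivAt (fun x => D.act (r • v) (h x) - h x)
        (((D.actL (r • v)).restrictScalars ℝ).comp (fderiv ℝ h x) - fderiv ℝ h x) x :=
      (((D.actL (r • v)).restrictScalars ℝ).hasFDerivAt.comp x (hd x).hasFDerivAt).sub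
        (hd x).hasFDerivAt
    have d2 : HasFDerivAt (fun x => D.actAverage v r (Complex.I • D.del k h x))
        ((D.actAverage v r).comp (Complex.I • fderiv ℝ (D.del k h) x)) x :=
      (D.actAverage v r).hasFDerivAt.comp x ((hd' x).hasFDerivAt.const_smul Complex.I)
    rw [e] at d1
    have := congrArg (fun T => T (EuclideanSpace.single j 1)) (d1.unique d2)
    simpa [partialD] using this
  have h2 : HasDerivAt (fun r : ℝ => D.act (r • v) (partialD j h x) - partialD j h x)
      (Complex.I • D.delta (Pi.single k 1) (partialD j h x)) 0 := by
    have := (hasDerivAt_orbit hx k 0).sub_const (partialD j h x)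
    rwa [zero_smul, D.act_zero] at this
  have h3 : HasDerivAt (fun r : ℝ => D.act (r • v) (partialD j h x) - partialD j h x)
      (Complex.I • partialD j (D.del k h) x) 0 := by
    simp_rw [h1, actAverage_apply]
    have hc : Continuous fun σ : ℝ => D.act (σ • v) (Complex.I • partialD j (D.del k h) x) :=
      D.continuous_act (by fun_prop) continuous_const
    have := intervalIntegral.integral_hasDerivAt_right (hc.intervalIntegrable 0 0)
      (hc.stronglyMeasurableAtFilter _ _) hc.continuousAt
    rwa [zero_smul, D.act_zero] at this
  have h4 := h2.unique h3
  exact smul_right_injective A Complex.I_ne_zero h4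

namespace IsSmoothMap

variable {f : EuclideanSpace ℝ (Fin n) → A}

theorem contDiff (hf : D.IsSmoothMap f) : ContDiff ℝ ∞ f := by
  simpa only [delta_zero_index] using hf.smooth 0

theorem isSmoothElt (hf : D.IsSmoothMap f) (x : E) : D.IsSmoothElt (f x) := by
  simpa only [partialPow_zero] using hf.mem 0 x

theorem isSmoothElt_partialD (hf : D.IsSmoothMap f) (j : Fin n) (x : E) :
    D.IsSmoothElt (partialD j f x) := by
  simpa only [partialPow_single j hf.contDiff] using hf.mem (Pi.single j 1) x

/-- Closedness of each δ_k, one index at a time. The induction hypothesis also supplies that ∂_j(δ^c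
f) takes smooth values, as closedness requires. -/
theorem delta_partialD (hf : D.IsSmoothMap f) (c : Fin n → ℕ) (j : Fin n) :
    (fun x => D.delta c (partialD j f x)) = partialD j (fun x => D.delta c (f x)) := by
  induction c using multiIndex_induction with
  | h0 => simp only [delta_zero_index]
  | hs c k ih =>
    have e : D.del k (fun x => D.delta c (f x)) = fun x => D.delta (c + Pi.single k 1) (f x) :=
      funext fun x => (D.delta_add_single (hf.isSmoothElt x) c k).symm
    rw [← e]
    ext x
    rw [D.delta_add_single (hf.isSmoothElt_partialD j x), congrFun ih x]
    refine delta_single_partialD (fun x => D.isSmoothElt_delta (hf.isSmoothElt x) c)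
      ((hf.smooth c).differentiable (by simp)) k j ?_ x ?_
    · rw [e]; exact (hf.smooth _).differentiable (by simp)
    · rw [← congrFun ih x]
      exact D.isSmoothElt_delta (hf.isSmoothElt_partialD j x) c

theorem partialD (hf : D.IsSmoothMap f) (j : Fin n) : D.IsSmoothMap (partialD j f) where
  mem b x := by
    rw [partialPow_partialD b j hf.contDiff, ← partialPow_add_single b j hf.contDiff]
    exact hf.mem _ x
  smooth c := by
    rw [hf.delta_partialD]
    exact contDiff_partialD j _ (hf.smooth c)

theorem del_partialD (hf : D.IsSmoothMap f) (k j : Fin n) :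
    D.del k (PsiCalculus.partialD j f) = PsiCalculus.partialD j (D.del k f) :=
  hf.delta_partialD (Pi.single k 1) j

theorem del (hf : D.IsSmoothMap f) (k : Fin n) : D.IsSmoothMap (D.del k f) where
  mem b x := by
    have : partialPow b (D.del k f) = D.del k (partialPow b f) :=
      (map_multiPow (S := {f | D.IsSmoothMap f}) (D.del k) (fun j f hf => hf.partialD j)
        (fun j f hf => hf.del_partialD k j) b hf).symm
    rw [this]
    exact D.isSmoothElt_delta (hf.mem b x) _
  smooth c := by
    have : (fun x => D.delta c (D.del k f x)) = fun x => D.delta (c + Pi.single k 1) (f x) :=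
      funext fun x => D.delta_delta_single (hf.isSmoothElt x) c k
    rw [this]
    exact hf.smooth _

end IsSmoothMap

/-- The derivative of `joint f` in terms of `δ_j f` and `∂_j f`. -/
def jointDeriv (D : TwistedSystem n A) (f : E → A) (z : E × E) : E × E →L[ℝ] A :=
  (∑ j, (EuclideanSpace.proj (𝕜 := ℝ) j : E →L[ℝ] ℝ).smulRight
    (Complex.I • D.joint (D.del j f) z)).coprod
  (∑ j, (EuclideanSpace.proj (𝕜 := ℝ) j : E →L[ℝ] ℝ).smulRight (D.joint (partialD j f) z))

theorem continuous_joint {f : E → A} (hf : Continuous f) : Continuous (D.joint f) :=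
  D.continuous_act continuous_fst (hf.comp continuous_snd)

theorem continuous_sum_smulRight {Y : Type*} [TopologicalSpace Y] {u : Fin n → Y → A}
    (hu : ∀ j, Continuous (u j)) : Continuous fun y =>
      ∑ j, (EuclideanSpace.proj (𝕜 := ℝ) j : E →L[ℝ] ℝ).smulRight (u j y) :=
  continuous_finsetSum _ fun j _ =>
    (ContinuousLinearMap.smulRightL ℝ E A (EuclideanSpace.proj j)).continuous.comp (hu j)

theorem fderiv_eq_sum_smulRight {u : E → A} (x : E) : fderiv ℝ u x =
    ∑ j, (EuclideanSpace.proj (𝕜 := ℝ) j : E →L[ℝ] ℝ).smulRight (partialD j u x) := by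
  ext v
  rw [fderiv_eq_sum_partialD]
  simp

/-- Separate derivatives in t and in ξ exist and are jointly continuous, hence the total derivative
exists. -/
theorem IsSmoothMap.hasFDerivAt_joint {f : E → A} (hf : D.IsSmoothMap f) (z : E × E) :
    HasFDerivAt (D.joint f) (D.jointDeriv f z) z := by
  refine HasStrictFDerivAt.hasFDerivAt ?_
  refine hasStrictFDerivAt_uncurry_coprod (u := z) (f := fun t x => D.act t (f x))
    (f₁ := fun t x => ∑ j, (EuclideanSpace.proj (𝕜 := ℝ) j : E →L[ℝ] ℝ).smulRight
      (Complex.I • D.joint (D.del j f) (t, x)))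
    (f₂ := fun t x => ∑ j, (EuclideanSpace.proj (𝕜 := ℝ) j : E →L[ℝ] ℝ).smulRight
      (D.joint (PsiCalculus.partialD j f) (t, x)))
    (Eventually.of_forall fun v => ?_) (Eventually.of_forall fun v => ?_) ?_ ?_
  · have h1 : HasFDerivAt (fun t => D.act t (f v.2)) (fderiv ℝ (fun t => D.act t (f v.2)) v.1) v.1 :=
      ((ContDiff.differentiable (hf.isSmoothElt v.2) (by simp)) v.1).hasFDerivAt
    refine h1.congr_fderiv ?_
    rw [fderiv_eq_sum_smulRight]
    refine Finset.sum_congr rfl fun j _ => ?_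
    have hx := hf.isSmoothElt v.2
    have h3 := congrFun (D.eq_orbit (D.partialD_equivariant j _ (D.equivariant_orbit hx))) v.1
    rw [h3]
    simp only [joint, TwistedSystem.del]
    rw [D.delta_single hx, map_smul, smul_smul, mul_inv_cancel₀ Complex.I_ne_zero, one_smul]
  · have h1 : HasFDerivAt (fun x => D.act v.1 (f x))
        (((D.actL v.1).restrictScalars ℝ).comp (fderiv ℝ f v.2)) v.2 :=
      ((D.actL v.1).restrictScalars ℝ).hasFDerivAt.comp v.2
        ((hf.contDiff.differentiable (by simp)) v.2).hasFDerivAt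
    refine h1.congr_fderiv ?_
    ext w
    rw [fderiv_eq_sum_smulRight]
    change _ = (∑ j, (EuclideanSpace.proj (𝕜 := ℝ) j : E →L[ℝ] ℝ).smulRight
      (D.joint (PsiCalculus.partialD j f) v)) w
    simp [joint]
  · exact (continuous_sum_smulRight fun j =>
      (continuous_joint (hf.del j).contDiff.continuous).const_smul Complex.I).continuousAt
  · exact (continuous_sum_smulRight fun j =>
      (continuous_joint (hf.partialD j).contDiff.continuous)).continuousAt

/-- Directional derivatives of `joint f` are combinations of `joint (δ_j f)` and `joint (∂_j f)`,
and δ_j f, ∂_j f are again smooth maps; so the order of differentiability can be raised step by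
step. -/
theorem IsSmoothMap.jointSmooth {f : E → A} (hf : D.IsSmoothMap f) : f ∈ D.jointSmooth := by
  change ContDiff ℝ ∞ (D.joint f)
  rw [contDiff_infty]
  intro N
  induction N generalizing f with
  | zero => exact contDiff_zero.2 (continuous_joint hf.contDiff.continuous)
  | succ N ih =>
    rw [Nat.cast_add, Nat.cast_one, contDiff_succ_iff_fderiv_apply]
    refine ⟨fun z => (hf.hasFDerivAt_joint z).differentiableAt, by simp, fun v => ?_⟩
    have : (fun z => fderiv ℝ (D.joint f) z v) = fun z =>
        ∑ j, v.1 j • (Complex.I • D.joint (D.del j f) z) + ∑ j, v.2 j • D.joint (PsiCalculus.partialD j f) z := by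
      ext z
      rw [(hf.hasFDerivAt_joint z).fderiv]
      simp [jointDeriv]
    rw [this]
    exact (ContDiff.sum fun j _ => ((ih (hf.del j)).const_smul _).const_smul _).add
      (ContDiff.sum fun j _ => (ih (hf.partialD j)).const_smul _)

theorem isSmoothMap_iff {f : E → A} : D.IsSmoothMap f ↔ f ∈ D.jointSmooth :=
  ⟨IsSmoothMap.jointSmooth, isSmoothMap_of_jointSmooth⟩

end TwistedSystem

end

end

section

open scoped ContDiff Matrix SchwartzMap Topology
open MeasureTheory Filter

set_option linter.unusedSectionVars false

noncomputable section

/-! ### Japanese brackets and moderate weights -/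

section Weights

variable {X V A : Type*} [NormedAddCommGroup X] [NormedSpace ℝ X] [NormedAddCommGroup V]
  [NormedSpace ℝ V] [NormedAddCommGroup A] [NormedSpace ℂ A]

/-- The power `(1 + |x|²)^{m/2}` of the Japanese bracket. -/
def bracket (m : ℝ) (x : V) : ℝ := (1 + ‖x‖ ^ 2) ^ (m / 2)

theorem bracket_pos (m : ℝ) (x : V) : 0 < bracket m x := Real.rpow_pos_of_pos (by positivity) _

theorem bracket_add (m m' : ℝ) (x : V) : bracket (m + m') x = bracket m x * bracket m' x := by
  rw [bracket, add_div, Real.rpow_add (by positivity)]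
  rfl

theorem bracket_mono {m m' : ℝ} (h : m ≤ m') (x : V) : bracket m x ≤ bracket m' x :=
  Real.rpow_le_rpow_of_exponent_le (by nlinarith [sq_nonneg ‖x‖]) (by linarith)

theorem one_add_norm_add_sq_le (x y : V) :
    1 + ‖x + y‖ ^ 2 ≤ 2 * (1 + ‖x‖ ^ 2) * (1 + ‖y‖) ^ 2 := by
  have h := norm_add_le x y
  have hx := norm_nonneg x
  have hy := norm_nonneg y
  have h2 : ‖x + y‖ ^ 2 ≤ (‖x‖ + ‖y‖) ^ 2 := pow_le_pow_left₀ (norm_nonneg _) h 2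
  nlinarith [sq_nonneg (‖x‖ - ‖y‖), mul_nonneg hy (sq_nonneg ‖x‖), sq_nonneg (‖x‖ * ‖y‖)]

/-- Peetre's inequality. -/
theorem isModerate_bracket (m : ℝ) : IsModerate (bracket m : V → ℝ) := by
  refine ⟨bracket_pos m, (2 : ℝ) ^ (|m| / 2), |m|, by positivity, abs_nonneg m, fun x y => ?_⟩
  have h1 : ((2 : ℝ) * (1 + ‖y‖) ^ 2) ^ (|m| / 2) = 2 ^ (|m| / 2) * (1 + ‖y‖) ^ |m| := by
    rw [Real.mul_rpow (by positivity) (by positivity), ← Real.rpow_natCast, ← Real.rpow_mul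
      (by positivity)]
    congr 2
    push_cast
    ring
  have hx : 0 < 1 + ‖x‖ ^ 2 := by positivity
  have hxy : 0 < 1 + ‖x + y‖ ^ 2 := by positivity
  have hD : 0 < 2 * (1 + ‖y‖) ^ 2 := by positivity
  rw [mul_right_comm, ← h1]
  unfold bracket
  rcases le_total 0 m with hm | hm
  · rw [abs_of_nonneg hm, ← Real.mul_rpow hD.le hx.le]
    refine Real.rpow_le_rpow hxy.le ?_ (by positivity)
    linarith [one_add_norm_add_sq_le x y]
  · have h2 : 1 + ‖x‖ ^ 2 ≤ (2 * (1 + ‖y‖) ^ 2) * (1 + ‖x + y‖ ^ 2) := by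
      have := one_add_norm_add_sq_le (x + y) (-y)
      rw [add_neg_cancel_right, norm_neg] at this
      linarith
    have h3 := Real.rpow_le_rpow_of_nonpos hx h2 (z := m / 2) (by linarith)
    rw [Real.mul_rpow hD.le hxy.le] at h3
    rw [abs_of_nonpos hm, neg_div, Real.rpow_neg hD.le, inv_mul_eq_div, le_div_iff₀ (by positivity)]
    linarith

theorem IsModerate.comp_clm {θ : V → ℝ} (h : IsModerate θ) (L : X →L[ℝ] V) :
    IsModerate (fun x => θ (L x)) := by
  obtain ⟨C, p, hC, hp, hle⟩ := h.exists_le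
  refine ⟨fun x => h.pos _, C * (1 + ‖L‖) ^ p, p, by positivity, hp, fun x y => ?_⟩
  have h0 := h.pos (L x)
  rw [map_add]
  refine (hle _ _).trans ?_
  have h1 : (1 + ‖L y‖) ^ p ≤ (1 + ‖L‖) ^ p * (1 + ‖y‖) ^ p := by
    rw [← Real.mul_rpow (by positivity) (by positivity)]
    refine Real.rpow_le_rpow (by positivity) ?_ hp
    nlinarith [L.le_opNorm y, norm_nonneg L, norm_nonneg y]
  calc C * θ (L x) * (1 + ‖L y‖) ^ p ≤ C * θ (L x) * ((1 + ‖L‖) ^ p * (1 + ‖y‖) ^ p) := by gcongr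
    _ = _ := by ring

theorem IsModerate.mul {θ θ' : X → ℝ} (h : IsModerate θ) (h' : IsModerate θ') :
    IsModerate (fun x => θ x * θ' x) := by
  obtain ⟨C, p, hC, hp, hle⟩ := h.exists_le
  obtain ⟨C', p', hC', hp', hle'⟩ := h'.exists_le
  refine ⟨fun x => mul_pos (h.pos x) (h'.pos x), C * C', p + p', by positivity, by positivity,
    fun x y => ?_⟩
  have h0 := h.pos x
  have h0' := h'.pos x
  rw [Real.rpow_add (by positivity)]
  calc _ ≤ (C * θ x * (1 + ‖y‖) ^ p) * (C' * θ' x * (1 + ‖y‖) ^ p') :=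
        mul_le_mul (hle x y) (hle' x y) (h'.pos _).le (by positivity)
    _ = _ := by ring

theorem IsModerate.add {θ θ' : X → ℝ} (h : IsModerate θ) (h' : IsModerate θ') :
    IsModerate (fun x => θ x + θ' x) := by
  obtain ⟨C, p, hC, hp, hle⟩ := h.exists_le
  obtain ⟨C', p', hC', hp', hle'⟩ := h'.exists_le
  refine ⟨fun x => add_pos (h.pos x) (h'.pos x), C + C', p + p', by positivity, by positivity,
    fun x y => ?_⟩
  have h0 := h.pos x
  have h0' := h'.pos x
  have h1 : (1 + ‖y‖) ^ p ≤ (1 + ‖y‖) ^ (p + p') :=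
    Real.rpow_le_rpow_of_exponent_le (by linarith [norm_nonneg y]) (by linarith)
  have h2 : (1 + ‖y‖) ^ p' ≤ (1 + ‖y‖) ^ (p + p') :=
    Real.rpow_le_rpow_of_exponent_le (by linarith [norm_nonneg y]) (by linarith)
  have h3 : 0 ≤ (1 + ‖y‖) ^ (p + p') := by positivity
  calc _ ≤ C * θ x * (1 + ‖y‖) ^ (p + p') + C' * θ' x * (1 + ‖y‖) ^ (p + p') := by
        refine add_le_add ((hle x y).trans ?_) ((hle' x y).trans ?_) <;> gcongr
    _ ≤ _ := by
        have : 0 ≤ (C * θ' x + C' * θ x) * (1 + ‖y‖) ^ (p + p') := by positivity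
        nlinarith

theorem InClass.mono {θ θ' : X → ℝ} {Q : X → A} (h : InClass θ Q) (hle : ∀ x, θ x ≤ θ' x) :
    InClass θ' Q :=
  BoundedFamily.mono h 1 (fun i x => (h.nonneg i x).trans (hle x)) fun _ x => by
    simpa using hle x

/-- Bounds on the functions of S alone suffice: in a basis the total derivative is a finite
combination of directional derivatives, which lie in S again. -/
theorem inClass_of_closed_under_fderiv [FiniteDimensional ℝ X] {θ : X → ℝ} (hθ : ∀ x, 0 ≤ θ x)
    {S : Set (X → A)} (hs : ∀ f ∈ S, ContDiff ℝ ∞ f) (hb : ∀ f ∈ S, ∃ C : ℝ, ∀ x, ‖f x‖ ≤ C * θ x)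
    (hS : ∀ f ∈ S, ∀ v, (fun x => fderiv ℝ f x v) ∈ S) {f : X → A} (hf : f ∈ S) : InClass θ f := by
  refine BoundedFamily.of_bound (fun _ => hs f hf) (fun _ => hθ) fun k => ?_
  suffices H : ∃ C : ℝ, ∀ x, ‖iteratedFDeriv ℝ k f x‖ ≤ C * θ x by
    obtain ⟨C, hC⟩ := H
    exact ⟨C, fun _ => hC⟩
  induction k generalizing f with
  | zero => simpa using hb f hf
  | succ k ih =>
    let β := Module.finBasis ℝ X
    let T : Fin (Module.finrank ℝ X) → A →L[ℝ] (X →L[ℝ] A) := fun i =>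
      ContinuousLinearMap.smulRightL ℝ X A (LinearMap.toContinuousLinearMap (β.coord i))
    have h1 : fderiv ℝ f = fun x => ∑ i, T i (fderiv ℝ f x (β i)) := by
      ext x v
      have h2 : fderiv ℝ f x v = fderiv ℝ f x (∑ i, β.repr v i • β i) := by rw [β.sum_repr]
      rw [h2, map_sum]
      simp [T]
    choose C hC using fun i => ih (hS f hf (β i))
    have hd : ∀ i, ContDiff ℝ ∞ (fun x => fderiv ℝ f x (β i)) := fun i => hs _ (hS f hf (β i))
    refine ⟨∑ i, ‖T i‖ * C i, fun x => ?_⟩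
    rw [← norm_iteratedFDeriv_fderiv, h1, iteratedFDeriv_fun_sum_apply
      (f := fun i x => T i (fderiv ℝ f x (β i))) (fun i _ =>
        ((T i).contDiff.comp ((hd i).of_le (mod_cast le_top))).contDiffAt), Finset.sum_mul]
    refine (norm_sum_le _ _).trans (Finset.sum_le_sum fun i _ => ?_)
    refine ((T i).norm_iteratedFDeriv_comp_left (hd i).contDiffAt (mod_cast le_top)).trans ?_
    rw [mul_assoc]
    exact mul_le_mul_of_nonneg_left (hC i x) (norm_nonneg _)

end Weights

/-! ### Linear structure and differentiation of symbols -/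

namespace TwistedSystem

open PsiCalculus

variable {n : ℕ} {A : Type*} [CStarAlgebra A] {D : TwistedSystem n A}

local notation "E" => EuclideanSpace ℝ (Fin n)

variable {f g : EuclideanSpace ℝ (Fin n) → A} {m m' : ℝ}

theorem joint_smul (c : ℂ) (f : E → A) :
    D.joint (fun x => c • f x) = fun z => c • D.joint f z := by
  ext z; exact map_smul _ _ _

theorem joint_add (f g : E → A) :
    D.joint (fun x => f x + g x) = fun z => D.joint f z + D.joint g z := by
  ext z; exact map_add _ _ _

theorem joint_sum {J : Type*} (s : Finset J) (f : J → E → A) :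
    D.joint (fun x => ∑ j ∈ s, f j x) = fun z => ∑ j ∈ s, D.joint (f j) z := by
  ext z; exact map_sum _ _ _

theorem jointSmooth_smul (hf : f ∈ D.jointSmooth) (c : ℂ) : (fun x => c • f x) ∈ D.jointSmooth := by
  rw [jointSmooth, Set.mem_ofPred_eq, joint_smul]
  exact (contDiff_joint hf).const_smul c

theorem jointSmooth_add (hf : f ∈ D.jointSmooth) (hg : g ∈ D.jointSmooth) :
    (fun x => f x + g x) ∈ D.jointSmooth := by
  rw [jointSmooth, Set.mem_ofPred_eq, joint_add]
  exact (contDiff_joint hf).add (contDiff_joint hg)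

theorem del_smul (hf : f ∈ D.jointSmooth) (c : ℂ) (j : Fin n) :
    D.del j (fun x => c • f x) = fun x => c • D.del j f x := by
  apply D.joint_injective
  rw [joint_del (jointSmooth_smul hf c), joint_smul, joint_smul, joint_del hf]
  ext z
  rw [fderiv_const_smul_apply' hf, smul_comm]

theorem del_add (hf : f ∈ D.jointSmooth) (hg : g ∈ D.jointSmooth) (j : Fin n) :
    D.del j (fun x => f x + g x) = fun x => D.del j f x + D.del j g x := by
  apply D.joint_injective
  rw [joint_del (jointSmooth_add hf hg), joint_add, joint_add, joint_del hf, joint_del hg]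
  ext z
  rw [fderiv_fun_add ((contDiff_joint hf).differentiable (by simp) z)
    ((contDiff_joint hg).differentiable (by simp) z), add_apply, smul_add]

/-- All symbol estimates reduce to bounds on the functions themselves, provided that the graded
family is stable under ∂_j (with a drop of one in degree) and under δ_j. -/
theorem isSymbol_of_closed {S : ℝ → Set (E → A)} (h1 : ∀ r, ∀ f ∈ S r, f ∈ D.jointSmooth)
    (h2 : ∀ r, ∀ f ∈ S r, ∃ C : ℝ, ∀ x, ‖f x‖ ≤ C * bracket r x)
    (h3 : ∀ r, ∀ f ∈ S r, ∀ j, partialD j f ∈ S (r - 1))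
    (h4 : ∀ r, ∀ f ∈ S r, ∀ j, D.del j f ∈ S r) (hf : f ∈ S m) : D.IsSymbol m f := by
  have hfj := h1 m f hf
  refine ⟨isSmoothMap_of_jointSmooth hfj, fun a b => ?_⟩
  have hb : partialPow b f ∈ S (m - len b) := by
    induction b using multiIndex_induction with
    | h0 => simpa [partialPow_zero] using hf
    | hs b j ih =>
      rw [partialPow_add_single b j (jointSmooth_contDiff hfj), len_add, len_single]
      have := h3 _ _ ih j
      rwa [sub_sub, ← Nat.cast_succ] at this
  have ha : (fun x => D.delta a (partialPow b f x)) ∈ S (m - len b) := by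
    rw [delta_comp_eq_multiPow (h1 _ _ hb)]
    exact multiPow_mem (fun j g hg => h4 _ g hg j) a hb
  obtain ⟨C, hC⟩ := h2 _ _ ha
  -- The definition of a symbol asks for a strictly positive constant.
  refine ⟨max C 1, by positivity, fun x => (hC x).trans ?_⟩
  exact mul_le_mul_of_nonneg_right (le_max_left _ _) (bracket_pos _ x).le

namespace IsSymbol

theorem jointSmooth (hf : D.IsSymbol m f) : f ∈ D.jointSmooth := hf.smooth.jointSmooth

theorem contDiff (hf : D.IsSymbol m f) : ContDiff ℝ ∞ f := hf.smooth.contDiff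

theorem norm_le (hf : D.IsSymbol m f) : ∃ C : ℝ, ∀ x, ‖f x‖ ≤ C * bracket m x := by
  obtain ⟨C, -, hC⟩ := hf.bound 0 0
  refine ⟨C, fun x => ?_⟩
  simpa [delta_zero_index, partialPow_zero, bracket] using hC x

theorem partialD (hf : D.IsSymbol m f) (j : Fin n) :
    D.IsSymbol (m - 1) (PsiCalculus.partialD j f) := by
  refine ⟨hf.smooth.partialD j, fun a b => ?_⟩
  obtain ⟨C, h0, hC⟩ := hf.bound a (b + Pi.single j 1)
  refine ⟨C, h0, fun x => ?_⟩
  rw [partialPow_partialD b j hf.contDiff, ← partialPow_add_single b j hf.contDiff]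
  refine (hC x).trans_eq ?_
  rw [len_add, len_single]
  push_cast
  rw [show m - ((len b : ℝ) + 1) = m - 1 - len b by ring]

theorem del (hf : D.IsSymbol m f) (j : Fin n) : D.IsSymbol m (D.del j f) := by
  refine ⟨hf.smooth.del j, fun a b => ?_⟩
  obtain ⟨C, h0, hC⟩ := hf.bound (a + Pi.single j 1) b
  refine ⟨C, h0, fun x => ?_⟩
  have : partialPow b (D.del j f) = D.del j (partialPow b f) :=
    (map_multiPow (S := D.jointSmooth) (D.del j) partialD_jointSmooth
      (fun k f hf => del_partialD j k f hf) b hf.jointSmooth).symm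
  rw [this]
  have h := D.delta_delta_single (hf.smooth.mem b x) a j
  rw [TwistedSystem.del, h]
  exact hC x

theorem mono (hf : D.IsSymbol m f) (h : m ≤ m') : D.IsSymbol m' f := by
  refine ⟨hf.smooth, fun a b => ?_⟩
  obtain ⟨C, h0, hC⟩ := hf.bound a b
  refine ⟨C, h0, fun x => (hC x).trans ?_⟩
  exact mul_le_mul_of_nonneg_left (bracket_mono (by linarith) x) h0.le

theorem const_smul (hf : D.IsSymbol m f) (c : ℂ) : D.IsSymbol m (fun x => c • f x) := by
  refine isSymbol_of_closed (S := fun r => {h | ∃ f, D.IsSymbol r f ∧ h = fun x => c • f x})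
    ?_ ?_ ?_ ?_ ⟨f, hf, rfl⟩
  · rintro r _ ⟨f, hf, rfl⟩
    exact jointSmooth_smul hf.jointSmooth c
  · rintro r _ ⟨f, hf, rfl⟩
    obtain ⟨C, hC⟩ := hf.norm_le
    refine ⟨‖c‖ * C, fun x => ?_⟩
    rw [norm_smul, mul_assoc]
    exact mul_le_mul_of_nonneg_left (hC x) (norm_nonneg c)
  · rintro r _ ⟨f, hf, rfl⟩ j
    exact ⟨_, hf.partialD j, partialD_const_smul c j hf.contDiff⟩
  · rintro r _ ⟨f, hf, rfl⟩ j
    exact ⟨_, hf.del j, del_smul hf.jointSmooth c j⟩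

theorem add (hf : D.IsSymbol m f) (hg : D.IsSymbol m g) : D.IsSymbol m (fun x => f x + g x) := by
  refine isSymbol_of_closed
    (S := fun r => {h | ∃ f g, D.IsSymbol r f ∧ D.IsSymbol r g ∧ h = fun x => f x + g x})
    ?_ ?_ ?_ ?_ ⟨f, g, hf, hg, rfl⟩
  · rintro r _ ⟨f, g, hf, hg, rfl⟩
    exact jointSmooth_add hf.jointSmooth hg.jointSmooth
  · rintro r _ ⟨f, g, hf, hg, rfl⟩
    obtain ⟨C, hC⟩ := hf.norm_le
    obtain ⟨C', hC'⟩ := hg.norm_le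
    refine ⟨C + C', fun x => ?_⟩
    rw [add_mul]
    exact (norm_add_le _ _).trans (add_le_add (hC x) (hC' x))
  · rintro r _ ⟨f, g, hf, hg, rfl⟩ j
    exact ⟨_, _, hf.partialD j, hg.partialD j, partialD_add j hf.contDiff hg.contDiff⟩
  · rintro r _ ⟨f, g, hf, hg, rfl⟩ j
    exact ⟨_, _, hf.del j, hg.del j, del_add hf.jointSmooth hg.jointSmooth j⟩

end IsSymbol

theorem isSymbol_zero (m : ℝ) : D.IsSymbol m (fun _ => (0 : A)) := by
  refine isSymbol_of_closed (S := fun _ => {fun _ => (0 : A)}) ?_ ?_ ?_ ?_ rfl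
  · rintro r _ rfl
    have : D.joint (fun _ => (0 : A)) = fun _ => 0 := by ext z; exact map_zero _
    rw [TwistedSystem.jointSmooth, Set.mem_ofPred_eq, this]
    exact contDiff_const
  · rintro r _ rfl
    exact ⟨0, fun x => by simp⟩
  · rintro r _ rfl j
    rw [Set.mem_singleton_iff]
    ext x
    simp [partialD]
  · rintro r _ rfl j
    rw [Set.mem_singleton_iff]
    ext x
    have : D.IsSmoothElt (0 : A) := by
      simp only [IsSmoothElt, map_zero]
      exact contDiff_const
    rw [del, D.delta_single this]
    simp [partialD]

theorem IsSymbol.congr (hf : D.IsSymbol m f) (h : ∀ x, f x = g x) : D.IsSymbol m g :=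
  funext h ▸ hf

theorem IsSymbol.sum {J : Type*} (s : Finset J) {f : J → E → A}
    (hf : ∀ j ∈ s, D.IsSymbol m (f j)) : D.IsSymbol m (fun x => ∑ j ∈ s, f j x) := by
  classical
  induction s using Finset.induction_on with
  | empty => simpa using isSymbol_zero m
  | insert j s hj ih =>
    simp only [Finset.sum_insert hj]
    exact (hf j (Finset.mem_insert_self _ _)).add
      (ih fun i hi => hf i (Finset.mem_insert_of_mem hi))

end TwistedSystem

end

end

section

open scoped ContDiff Matrix SchwartzMap Topology
open MeasureTheory Filter

set_option linter.unusedSectionVars false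

noncomputable section

/-! ### Products of symbols as functions of two independent points -/

namespace TwistedSystem

open PsiCalculus

variable {n : ℕ} {A : Type*} [CStarAlgebra A] {D : TwistedSystem n A}

local notation "E" => EuclideanSpace ℝ (Fin n)

variable {f g : EuclideanSpace ℝ (Fin n) → A} {m m' M : ℝ}

variable (D) in
/-- The operator which corresponds under `joint` to the derivative in the direction `v`. -/
def dirD (v : E × E) (f : E → A) : E → A := fun x =>
  (∑ j, (v.1 j * Complex.I : ℂ) • D.del j f x) + ∑ j, (v.2 j : ℂ) • partialD j f x

theorem IsSymbol.dirD (hf : D.IsSymbol m f) (v : E × E) : D.IsSymbol m (D.dirD v f) :=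
  (IsSymbol.sum _ fun j _ => (hf.del j).const_smul _).add
    (IsSymbol.sum _ fun j _ => ((hf.partialD j).mono (by linarith)).const_smul _)

theorem fderiv_joint (hf : f ∈ D.jointSmooth) (z v : E × E) :
    fderiv ℝ (D.joint f) z v = D.joint (D.dirD v f) z := by
  rw [((isSmoothMap_iff.2 hf).hasFDerivAt_joint z).fderiv]
  simp only [joint, dirD, map_add, map_sum, map_smul]
  simp [jointDeriv, joint, mul_smul]

/-- Only boundedness of derivatives by the weight is recorded, not the gain in ξ; the oscillatory
integrals need no more, and the gain is tracked separately by the order of the pair symbols. -/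
theorem IsSymbol.inClass_joint (hf : D.IsSymbol m f) :
    InClass (fun z : E × E => bracket m z.2) (D.joint f) := by
  refine inClass_of_closed_under_fderiv (fun z => (bracket_pos _ _).le)
    (S := D.joint '' {f | D.IsSymbol m f}) ?_ ?_ ?_ ⟨f, hf, rfl⟩
  · rintro _ ⟨f, hf, rfl⟩
    exact IsSymbol.jointSmooth hf
  · rintro _ ⟨f, hf, rfl⟩
    obtain ⟨C, hC⟩ := IsSymbol.norm_le hf
    exact ⟨C, fun z => by rw [joint, norm_act]; exact hC z.2⟩
  · rintro _ ⟨f, hf, rfl⟩ v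
    exact ⟨_, IsSymbol.dirD hf v, funext fun z => (fderiv_joint (IsSymbol.jointSmooth hf) z v).symm⟩

variable (D) in
/-- The function `((t, ξ), (s, ζ)) ↦ α_t (f ξ) α_s (g ζ)`. -/
def pairFun (f g : E → A) (x : (E × E) × (E × E)) : A := D.joint f x.1 * D.joint g x.2

theorem fderiv_pairFun (hf : f ∈ D.jointSmooth) (hg : g ∈ D.jointSmooth)
    (x v : (E × E) × (E × E)) : fderiv ℝ (D.pairFun f g) x v =
      D.pairFun (D.dirD v.1 f) g x + D.pairFun f (D.dirD v.2 g) x := by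
  have h1 : HasFDerivAt (fun x : (E × E) × (E × E) => D.joint f x.1)
      ((fderiv ℝ (D.joint f) x.1).comp (ContinuousLinearMap.fst ℝ _ _)) x :=
    ((contDiff_joint hf).differentiable (by simp) x.1).hasFDerivAt.comp x hasFDerivAt_fst
  have h2 : HasFDerivAt (fun x : (E × E) × (E × E) => D.joint g x.2)
      ((fderiv ℝ (D.joint g) x.2).comp (ContinuousLinearMap.snd ℝ _ _)) x :=
    ((contDiff_joint hg).differentiable (by simp) x.2).hasFDerivAt.comp x hasFDerivAt_snd
  have h3 : fderiv ℝ (D.pairFun f g) x = _ := (h1.mul' h2).fderiv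
  rw [h3]
  simp [fderiv_joint hf, fderiv_joint hg, pairFun, add_comm]

theorem isModerate_pairWeight (m m' : ℝ) :
    IsModerate (fun x : (E × E) × (E × E) => bracket m x.1.2 * bracket m' x.2.2) :=
  ((isModerate_bracket m).comp_clm
    ((ContinuousLinearMap.snd ℝ E E).comp (ContinuousLinearMap.fst ℝ (E × E) (E × E)))).mul
  ((isModerate_bracket m').comp_clm
    ((ContinuousLinearMap.snd ℝ E E).comp (ContinuousLinearMap.snd ℝ (E × E) (E × E))))

theorem IsSymbol.inClass_pairFun (hf : D.IsSymbol m f) (hg : D.IsSymbol m' g) :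
    InClass (fun x : (E × E) × (E × E) => bracket m x.1.2 * bracket m' x.2.2) (D.pairFun f g) := by
  have h1 := BoundedFamily.comp_affine hf.inClass_joint (fun _ => 0)
    (fun _ => ContinuousLinearMap.fst ℝ (E × E) (E × E)) (fun _ => le_rfl)
  have h2 := BoundedFamily.comp_affine hg.inClass_joint (fun _ => 0)
    (fun _ => ContinuousLinearMap.snd ℝ (E × E) (E × E)) (fun _ => le_rfl)
  have h3 := h1.bilinear (ContinuousLinearMap.mul ℝ A) h2
  simp only [zero_add] at h3
  exact h3

variable (D) in
/-- Finite sums of functions `pairFun f g` with symbols `f` and `g` of total order `M`. -/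
inductive PairSymbol (M : ℝ) : ((E × E) × (E × E) → A) → Prop
  | pair (m m' : ℝ) (f g : E → A) (hf : D.IsSymbol m f) (hg : D.IsSymbol m' g) (h : m + m' = M) :
      PairSymbol M (D.pairFun f g)
  | add (Q Q' : (E × E) × (E × E) → A) (hQ : PairSymbol M Q) (hQ' : PairSymbol M Q') :
      PairSymbol M (fun x => Q x + Q' x)

variable {Q : (EuclideanSpace ℝ (Fin n) × EuclideanSpace ℝ (Fin n)) ×
  (EuclideanSpace ℝ (Fin n) × EuclideanSpace ℝ (Fin n)) → A}

/-- The diagonal embedding of directions. -/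
def diag (v : E × E) : (E × E) × (E × E) := (v, v)

namespace PairSymbol

/-- Off the diagonal the two bracket factors, and the weights of different summands, are not
comparable with one bracket; the sum of the weights serves there. On the diagonal they all collapse
to `bracket M`. -/
theorem exists_inClass (h : D.PairSymbol M Q) : ∃ θ, IsModerate θ ∧ InClass θ Q ∧
    ∃ K : ℝ, 0 ≤ K ∧ ∀ z, θ (diag z) ≤ K * bracket M z.2 := by
  induction h with
  | pair m m' f g hf hg h =>
    refine ⟨_, isModerate_pairWeight m m', hf.inClass_pairFun hg, 1, zero_le_one, fun z => ?_⟩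
    rw [one_mul, ← h, bracket_add]
    rfl
  | add Q Q' hQ hQ' ih ih' =>
    obtain ⟨θ, h1, h2, K, hK, h3⟩ := ih
    obtain ⟨θ', h1', h2', K', hK', h3'⟩ := ih'
    refine ⟨_, h1.add h1', (h2.mono fun x => ?_).add (h2'.mono fun x => ?_), K + K',
      by positivity, fun z => ?_⟩
    · linarith [h1'.pos x]
    · linarith [h1.pos x]
    · rw [add_mul]
      exact add_le_add (h3 z) (h3' z)

theorem contDiff (h : D.PairSymbol M Q) : ContDiff ℝ ∞ Q := by
  obtain ⟨θ, -, h2, -⟩ := h.exists_inClass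
  exact h2.contDiff

theorem differentiable (h : D.PairSymbol M Q) : Differentiable ℝ Q :=
  h.contDiff.differentiable (by simp)

theorem smul (h : D.PairSymbol M Q) (c : ℂ) : D.PairSymbol M (fun x => c • Q x) := by
  induction h with
  | pair m m' f g hf hg h =>
    have : (fun x => c • D.pairFun f g x) = D.pairFun (fun x => c • f x) g := by
      ext x
      simp [pairFun, joint_smul]
    rw [this]
    exact .pair m m' _ _ (hf.const_smul c) hg h
  | add Q Q' hQ hQ' ih ih' =>
    simp only [smul_add]
    exact .add _ _ ih ih'

theorem zero (M : ℝ) : D.PairSymbol M (fun _ => (0 : A)) := by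
  have := PairSymbol.pair (D := D) (M := M) M 0 _ _ (isSymbol_zero M) (isSymbol_zero 0) (by simp)
  convert this using 1
  ext x
  simp [pairFun, joint]

theorem sum {J : Type*} (s : Finset J) {Q : J → (E × E) × (E × E) → A}
    (h : ∀ j ∈ s, D.PairSymbol M (Q j)) : D.PairSymbol M (fun x => ∑ j ∈ s, Q j x) := by
  classical
  induction s using Finset.induction_on with
  | empty => simpa using zero M
  | insert j s hj ih =>
    simp only [Finset.sum_insert hj]
    exact .add _ _ (h j (Finset.mem_insert_self _ _))
      (ih fun i hi => h i (Finset.mem_insert_of_mem hi))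

/-- Since α_τ is multiplicative, it moves both time variables by the same amount. -/
theorem act (h : D.PairSymbol M Q) (τ : E) (x : (E × E) × (E × E)) :
    D.act τ (Q x) = Q (x + diag (τ, 0)) := by
  induction h with
  | pair m m' f g hf hg h =>
    simp [pairFun, joint, diag, add_comm _ τ, D.act_add]
  | add Q Q' hQ hQ' ih ih' =>
    rw [map_add, ih, ih']

end PairSymbol

theorem dirD_zero (f : E → A) : D.dirD 0 f = fun _ => 0 := by
  ext x; simp [dirD]

theorem dirD_single_fst (f : E → A) (j : Fin n) :
    D.dirD (EuclideanSpace.single j 1, 0) f = fun x => Complex.I • D.del j f x := by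
  ext x
  simp [dirD, apply_ite, ite_mul]

theorem dirD_single_snd (f : E → A) (j : Fin n) :
    D.dirD (0, EuclideanSpace.single j 1) f = partialD j f := by
  ext x
  simp [dirD, ite_smul]

namespace PairSymbol

theorem fderiv_add (h : D.PairSymbol M Q) {Q' : (E × E) × (E × E) → A} (h' : D.PairSymbol M Q')
    (v : (E × E) × (E × E)) : (fun x => fderiv ℝ (fun x => Q x + Q' x) x v) =
      fun x => fderiv ℝ Q x v + fderiv ℝ Q' x v := by
  ext x
  rw [fderiv_fun_add (h.differentiable x) (h'.differentiable x), add_apply]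

theorem fderiv_apply (h : D.PairSymbol M Q) (v : (E × E) × (E × E)) :
    D.PairSymbol M (fun x => fderiv ℝ Q x v) := by
  induction h with
  | pair m m' f g hf hg h =>
    simp_rw [fderiv_pairFun hf.jointSmooth hg.jointSmooth]
    exact .add _ _ (.pair m m' _ _ (hf.dirD _) hg h) (.pair m m' _ _ hf (hg.dirD _) h)
  | add Q Q' hQ hQ' ih ih' =>
    rw [hQ.fderiv_add hQ']
    exact .add _ _ ih ih'

/-- By Leibniz, a derivative in ξ falls on exactly one factor in each term and lowers the total
order by one. -/
theorem fderiv_diag_single (h : D.PairSymbol M Q) (j : Fin n) :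
    D.PairSymbol (M - 1) (fun x => fderiv ℝ Q x (diag (0, EuclideanSpace.single j 1))) := by
  induction h with
  | pair m m' f g hf hg h =>
    simp_rw [fderiv_pairFun hf.jointSmooth hg.jointSmooth, diag, dirD_single_snd]
    exact .add _ _ (.pair (m - 1) m' _ _ (hf.partialD j) hg (by linarith))
      (.pair m (m' - 1) _ _ hf (hg.partialD j) (by linarith))
  | add Q Q' hQ hQ' ih ih' =>
    rw [hQ.fderiv_add hQ']
    exact .add _ _ ih ih'

end PairSymbol

variable (n) in
/-- The directions in which the first factor of the amplitude is moved. -/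
def leftDir (j : Fin n) : (E × E) × (E × E) := ((0, EuclideanSpace.single j 1), 0)

variable (D) in
/-- The directions in which the second factor of the amplitude is moved. -/
def rightDir (j : Fin n) : (E × E) × (E × E) :=
  (0, (-EuclideanSpace.single j 1, WithLp.toLp 2 fun k => D.B k j))

variable (D) in
/-- The operator `-i δ_j + ∂_{B,j}`, which is `∂_{y_j}|_{y=0} α_{-y}(g(ξ + B y))`. -/
def twistDel (j : Fin n) (g : E → A) : E → A :=
  fun x => (-Complex.I) • D.del j g x + twistedD D.B j g x

theorem dirD_rightDir (g : E → A) (j : Fin n) : D.dirD (D.rightDir j).2 g = D.twistDel j g := by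
  ext x
  simp [dirD, rightDir, twistDel, twistedD, apply_ite, ite_mul]

theorem IsSymbol.twistDel (hg : D.IsSymbol m g) (j : Fin n) : D.IsSymbol m (D.twistDel j g) := by
  rw [← dirD_rightDir]
  exact hg.dirD _

theorem pairFun_zero_left (g : E → A) : D.pairFun (fun _ => 0) g = fun _ => 0 := by
  ext x; simp [pairFun, joint]

theorem pairFun_zero_right (f : E → A) : D.pairFun f (fun _ => 0) = fun _ => 0 := by
  ext x; simp [pairFun, joint]

/-- The left directions move only the first factor and the right directions only the second, so no
cross terms arise. -/
theorem transportOp_pairFun (hf : D.IsSymbol m f) (hg : D.IsSymbol m' g) :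
    transportOp (leftDir n) D.rightDir (D.pairFun f g) = fun x => (-Complex.I) •
      ∑ j, D.pairFun (partialD j f) (D.twistDel j g) x := by
  have h1 : ∀ j, (fun x => fderiv ℝ (D.pairFun f g) x (leftDir n j)) =
      D.pairFun (partialD j f) g := by
    intro j
    ext x
    rw [fderiv_pairFun hf.jointSmooth hg.jointSmooth]
    simp only [leftDir, dirD_single_snd, dirD_zero, pairFun_zero_right, add_zero]
  ext x
  simp only [transportOp, h1]
  congr 1
  refine Finset.sum_congr rfl fun j _ => ?_
  rw [fderiv_pairFun (hf.partialD j).jointSmooth hg.jointSmooth, dirD_rightDir]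
  simp only [rightDir, dirD_zero, pairFun_zero_left, zero_add]

namespace PairSymbol

theorem transportOp_add (h : D.PairSymbol M Q) {Q' : (E × E) × (E × E) → A}
    (h' : D.PairSymbol M Q') (p q : Fin n → (E × E) × (E × E)) :
    transportOp p q (fun x => Q x + Q' x) = fun x => transportOp p q Q x + transportOp p q Q' x := by
  ext x
  simp only [transportOp, h.fderiv_add h']
  rw [← smul_add, ← Finset.sum_add_distrib]
  congr 1
  refine Finset.sum_congr rfl fun j _ => ?_
  rw [fderiv_fun_add ((h.fderiv_apply _).differentiable x) ((h'.fderiv_apply _).differentiable x),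
    add_apply]

theorem transportOp_smul (h : D.PairSymbol M Q) (c : ℂ) (p q : Fin n → (E × E) × (E × E)) :
    transportOp p q (fun x => c • Q x) = fun x => c • transportOp p q Q x := by
  ext x
  simp only [transportOp, fderiv_const_smul_apply' h.contDiff,
    fderiv_const_smul_apply' (h.fderiv_apply _).contDiff]
  rw [smul_comm c, ← Finset.smul_sum]

/-- The drop in order comes from ∂_j f alone: the operator acting on g contains δ_j, which keeps the
order. -/
theorem transportOp_order (h : D.PairSymbol M Q) :
    D.PairSymbol (M - 1) (transportOp (leftDir n) D.rightDir Q) := by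
  induction h with
  | pair m m' f g hf hg h =>
    rw [transportOp_pairFun hf hg]
    exact (PairSymbol.sum _ fun j _ => .pair (m - 1) m' _ _ (hf.partialD j) (hg.twistDel j)
      (by linarith)).smul _
  | add Q Q' hQ hQ' ih ih' =>
    rw [hQ.transportOp_add hQ']
    exact .add _ _ ih ih'

theorem iterate_transportOp (h : D.PairSymbol M Q) (k : ℕ) :
    D.PairSymbol (M - k) ((transportOp (leftDir n) D.rightDir)^[k] Q) := by
  induction k with
  | zero => simpa using h
  | succ k ih =>
    rw [Function.iterate_succ_apply', Nat.cast_succ, ← sub_sub]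
    exact ih.transportOp_order

/-- An operator with constant coefficients commutes with directional derivatives. -/
theorem fderiv_transportOp (h : D.PairSymbol M Q) (p q : Fin n → (E × E) × (E × E))
    (x v : (E × E) × (E × E)) : fderiv ℝ (transportOp p q Q) x v =
      transportOp p q (fun x => fderiv ℝ Q x v) x := by
  have hc : ∀ j, ContDiff ℝ ∞ (fun x => fderiv ℝ (fun x => fderiv ℝ Q x (p j)) x (q j)) :=
    fun j => ((h.fderiv_apply _).fderiv_apply _).contDiff
  unfold transportOp
  rw [fderiv_const_smul_apply' (ContDiff.sum fun j _ => hc j),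
    fderiv_fun_sum (fun j _ => (hc j).differentiable (by simp) x), sum_apply]
  congr 1
  refine Finset.sum_congr rfl fun j _ => ?_
  rw [fderiv_fderiv_apply_comm (h.fderiv_apply _).contDiff]
  simp_rw [fun x => fderiv_fderiv_apply_comm h.contDiff (p j) v x]

end PairSymbol

end TwistedSystem

end

end

section

open scoped ContDiff Matrix SchwartzMap Topology
open MeasureTheory Filter

set_option linter.unusedSectionVars false

noncomputable section

/-! ### Commuting operators on pair symbols, the composition product and its remainders -/

namespace TwistedSystem

open PsiCalculus

variable {n : ℕ} {A : Type*} [CStarAlgebra A] {D : TwistedSystem n A}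

local notation "E" => EuclideanSpace ℝ (Fin n)

variable {f g : EuclideanSpace ℝ (Fin n) → A} {m m' M : ℝ}

variable {Q : (EuclideanSpace ℝ (Fin n) × EuclideanSpace ℝ (Fin n)) ×
  (EuclideanSpace ℝ (Fin n) × EuclideanSpace ℝ (Fin n)) → A}

variable (D) in
/-- Operators on pair symbols that are homogeneous and commute with directional derivatives and
with the action. -/
structure IsPairOperator (Ψ : ((E × E) × (E × E) → A) → (E × E) × (E × E) → A) : Prop where
  contDiff : ∀ {M Q}, D.PairSymbol M Q → ContDiff ℝ ∞ (Ψ Q)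
  act : ∀ {M Q}, D.PairSymbol M Q → ∀ τ x, D.act τ (Ψ Q x) = Ψ Q (x + diag (τ, 0))
  fderiv : ∀ {M Q}, D.PairSymbol M Q → ∀ x v, fderiv ℝ (Ψ Q) x v = Ψ (fun x => fderiv ℝ Q x v) x
  smul : ∀ {M Q}, D.PairSymbol M Q → ∀ (c : ℂ) x, Ψ (fun x => c • Q x) x = c • Ψ Q x

/-- The restriction to the diagonal over `t = 0`. -/
def restrict (u : (E × E) × (E × E) → A) (ξ : E) : A := u (diag (0, ξ))

theorem contDiff_diag : ContDiff ℝ ∞ (diag (n := n)) :=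
  ((ContinuousLinearMap.id ℝ (E × E)).prod (ContinuousLinearMap.id ℝ (E × E))).contDiff

theorem fderiv_comp_diag {u : (E × E) × (E × E) → A} (hu : ContDiff ℝ ∞ u) (z v : E × E) :
    fderiv ℝ (fun z => u (diag z)) z v = fderiv ℝ u (diag z) (diag v) := by
  have h1 : HasFDerivAt (diag (n := n))
      ((ContinuousLinearMap.id ℝ (E × E)).prod (ContinuousLinearMap.id ℝ (E × E))) z :=
    ((ContinuousLinearMap.id ℝ (E × E)).prod (ContinuousLinearMap.id ℝ (E × E))).hasFDerivAt
  have h2 : HasFDerivAt (fun z => u (diag z)) _ z :=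
    (hu.differentiable (by simp) (diag z)).hasFDerivAt.comp z h1
  rw [h2.fderiv]
  rfl

namespace IsPairOperator

variable {Ψ Ψ' : ((EuclideanSpace ℝ (Fin n) × EuclideanSpace ℝ (Fin n)) ×
  (EuclideanSpace ℝ (Fin n) × EuclideanSpace ℝ (Fin n)) → A) →
  (EuclideanSpace ℝ (Fin n) × EuclideanSpace ℝ (Fin n)) ×
  (EuclideanSpace ℝ (Fin n) × EuclideanSpace ℝ (Fin n)) → A}

theorem joint_restrict (hΨ : D.IsPairOperator Ψ) (hQ : D.PairSymbol M Q) :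
    D.joint (restrict (Ψ Q)) = fun z => Ψ Q (diag z) := by
  ext z
  rw [joint, restrict, hΨ.act hQ]
  simp [diag]

theorem jointSmooth (hΨ : D.IsPairOperator Ψ) (hQ : D.PairSymbol M Q) :
    restrict (Ψ Q) ∈ D.jointSmooth := by
  rw [TwistedSystem.jointSmooth, Set.mem_ofPred_eq, hΨ.joint_restrict hQ]
  exact (hΨ.contDiff hQ).comp contDiff_diag

/-- A derivative of the restriction is the derivative of Ψ Q along the diagonal, and Ψ passes it on
to Q, where it lowers the order. -/
theorem partialD_restrict (hΨ : D.IsPairOperator Ψ) (hQ : D.PairSymbol M Q) (j : Fin n) :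
    partialD j (restrict (Ψ Q)) =
      restrict (Ψ (fun x => _root_.fderiv ℝ Q x (diag (0, EuclideanSpace.single j 1)))) := by
  apply D.joint_injective
  rw [joint_partialD (hΨ.jointSmooth hQ), hΨ.joint_restrict hQ,
    hΨ.joint_restrict (hQ.fderiv_diag_single j)]
  ext z
  rw [fderiv_comp_diag (hΨ.contDiff hQ), hΨ.fderiv hQ]

end IsPairOperator

/-- The action of `δ_j` on pair symbols. -/
def pairDel (j : Fin n) (Q : (E × E) × (E × E) → A) : (E × E) × (E × E) → A :=
  fun x => (-Complex.I) • fderiv ℝ Q x (diag (EuclideanSpace.single j 1, 0))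

theorem PairSymbol.pairDel (hQ : D.PairSymbol M Q) (j : Fin n) : D.PairSymbol M (pairDel j Q) :=
  (hQ.fderiv_apply _).smul _

namespace IsPairOperator

variable {Ψ Ψ' : ((EuclideanSpace ℝ (Fin n) × EuclideanSpace ℝ (Fin n)) ×
  (EuclideanSpace ℝ (Fin n) × EuclideanSpace ℝ (Fin n)) → A) →
  (EuclideanSpace ℝ (Fin n) × EuclideanSpace ℝ (Fin n)) ×
  (EuclideanSpace ℝ (Fin n) × EuclideanSpace ℝ (Fin n)) → A}

theorem del_restrict (hΨ : D.IsPairOperator Ψ) (hQ : D.PairSymbol M Q) (j : Fin n) :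
    D.del j (restrict (Ψ Q)) = restrict (Ψ (pairDel j Q)) := by
  apply D.joint_injective
  rw [joint_del (hΨ.jointSmooth hQ), hΨ.joint_restrict hQ, hΨ.joint_restrict (hQ.pairDel j)]
  ext z
  rw [fderiv_comp_diag (hΨ.contDiff hQ), hΨ.fderiv hQ]
  exact (hΨ.smul (hQ.fderiv_apply _) _ _).symm

/-- The bound `hb` is asked for every pair symbol, so it may be used for the differentiated ones. As
∂_j and δ_j of the restriction are restrictions of Ψ at such pair symbols, no derivative has to be
estimated. -/
theorem isSymbol (hΨ : D.IsPairOperator Ψ) {r : ℝ} (hb : ∀ {M Q}, D.PairSymbol M Q →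
    ∃ C : ℝ, ∀ z, ‖Ψ Q (diag z)‖ ≤ C * bracket (M - r) z.2) (hQ : D.PairSymbol M Q) :
    D.IsSymbol (M - r) (restrict (Ψ Q)) := by
  refine isSymbol_of_closed
    (S := fun s => {h | ∃ M Q, D.PairSymbol M Q ∧ M - r = s ∧ h = restrict (Ψ Q)})
    ?_ ?_ ?_ ?_ ⟨M, Q, hQ, rfl, rfl⟩
  · rintro s _ ⟨M, Q, hQ, rfl, rfl⟩
    exact hΨ.jointSmooth hQ
  · rintro s _ ⟨M, Q, hQ, rfl, rfl⟩
    obtain ⟨C, hC⟩ := hb hQ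
    exact ⟨C, fun x => hC (0, x)⟩
  · rintro s _ ⟨M, Q, hQ, rfl, rfl⟩ j
    exact ⟨M - 1, _, hQ.fderiv_diag_single j, by ring, hΨ.partialD_restrict hQ j⟩
  · rintro s _ ⟨M, Q, hQ, rfl, rfl⟩ j
    exact ⟨M, _, hQ.pairDel j, rfl, hΨ.del_restrict hQ j⟩

theorem delta_restrict (hΨ : D.IsPairOperator Ψ) (hQ : D.PairSymbol M Q) (c : Fin n → ℕ) (ξ : E) :
    D.delta c (restrict (Ψ Q) ξ) = restrict (Ψ (multiPow pairDel c Q)) ξ := by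
  have h1 := delta_comp_eq_multiPow (hΨ.jointSmooth hQ) c
  rw [← map_multiPow (S := {Q | D.PairSymbol M Q}) (fun Q => restrict (Ψ Q))
    (fun j Q hQ => PairSymbol.pairDel hQ j) (fun j Q hQ => (hΨ.del_restrict hQ j).symm) c hQ] at h1
  exact congrFun h1 ξ

theorem id : D.IsPairOperator (fun Q => Q) where
  contDiff hQ := hQ.contDiff
  act hQ := hQ.act
  fderiv _ _ _ := rfl
  smul _ _ _ := rfl

theorem sub (hΨ : D.IsPairOperator Ψ) (hΨ' : D.IsPairOperator Ψ') :
    D.IsPairOperator (fun Q x => Ψ Q x - Ψ' Q x) where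
  contDiff hQ := (hΨ.contDiff hQ).sub (hΨ'.contDiff hQ)
  act hQ τ x := by rw [map_sub, hΨ.act hQ, hΨ'.act hQ]
  fderiv hQ x v := by
    rw [fderiv_fun_sub ((hΨ.contDiff hQ).differentiable (by simp) x)
      ((hΨ'.contDiff hQ).differentiable (by simp) x), sub_apply, hΨ.fderiv hQ, hΨ'.fderiv hQ]
  smul hQ c x := by rw [hΨ.smul hQ, hΨ'.smul hQ, smul_sub]

theorem const_smul (hΨ : D.IsPairOperator Ψ) (r : ℝ) :
    D.IsPairOperator (fun Q x => r • Ψ Q x) where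
  contDiff hQ := (hΨ.contDiff hQ).const_smul r
  act hQ τ x := by
    rw [← hΨ.act hQ]
    exact ((D.actL τ).restrictScalars ℝ).map_smul r _
  fderiv hQ x v := by
    rw [fderiv_fun_const_smul ((hΨ.contDiff hQ).differentiable (by simp) x), smul_apply,
      hΨ.fderiv hQ]
  smul hQ c x := by rw [hΨ.smul hQ, smul_comm]

theorem sum {J : Type*} (s : Finset J) {Ψ : J → ((E × E) × (E × E) → A) → (E × E) × (E × E) → A}
    (hΨ : ∀ j ∈ s, D.IsPairOperator (Ψ j)) : D.IsPairOperator (fun Q x => ∑ j ∈ s, Ψ j Q x) where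
  contDiff hQ := ContDiff.sum fun j hj => (hΨ j hj).contDiff hQ
  act hQ τ x := by
    rw [map_sum]
    exact Finset.sum_congr rfl fun j hj => (hΨ j hj).act hQ τ x
  fderiv hQ x v := by
    rw [fderiv_fun_sum fun j hj => ((hΨ j hj).contDiff hQ).differentiable (by simp) x, sum_apply]
    exact Finset.sum_congr rfl fun j hj => (hΨ j hj).fderiv hQ x v
  smul hQ c x := by
    rw [Finset.smul_sum]
    exact Finset.sum_congr rfl fun j hj => (hΨ j hj).smul hQ c x

theorem iterate_transportOp (k : ℕ) :
    D.IsPairOperator (transportOp (leftDir n) D.rightDir)^[k] where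
  contDiff hQ := (hQ.iterate_transportOp k).contDiff
  act hQ := (hQ.iterate_transportOp k).act
  fderiv {M Q} hQ x v := by
    induction k generalizing M Q with
    | zero => rfl
    | succ k ih =>
      rw [Function.iterate_succ_apply, ih hQ.transportOp_order, Function.iterate_succ_apply]
      exact congrFun (congrArg _ (funext fun x => hQ.fderiv_transportOp _ _ x v)) x
  smul {M Q} hQ c x := by
    induction k generalizing M Q with
    | zero => rfl
    | succ k ih =>
      rw [Function.iterate_succ_apply, Function.iterate_succ_apply, ← ih hQ.transportOp_order,
        hQ.transportOp_smul]

/-- The action passes through the integral because α_τ is a continuous linear map, and a diagonal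
time shift of Q commutes with the translations by L w. -/
theorem oscOp (L : E × E →L[ℝ] (E × E) × (E × E)) :
    D.IsPairOperator (oscOp (phaseMeasure n) (phase n) L) where
  contDiff hQ := by
    obtain ⟨θ, hθ, h, -⟩ := hQ.exists_inClass
    exact isPhase_phase.contDiff_oscOp hθ h L
  act {M Q} hQ τ x := by
    obtain ⟨θ, hθ, h, -⟩ := hQ.exists_inClass
    have h1 := isPhase_phase.oscOp_clm (μ := phaseMeasure n) hθ h (D.actL τ) L x
    rw [← actL_apply, ← h1]
    simp only [_root_.oscOp, actL_apply, hQ.act, add_right_comm _ _ (diag (τ, 0))]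
  fderiv hQ x v := by
    obtain ⟨θ, hθ, h, -⟩ := hQ.exists_inClass
    exact isPhase_phase.fderiv_oscOp_apply hθ h L x v
  smul hQ c x := by
    obtain ⟨θ, hθ, h, -⟩ := hQ.exists_inClass
    exact isPhase_phase.oscOp_clm hθ h (c • ContinuousLinearMap.id ℂ A) L x

theorem regOp (χ : 𝓢(E × E, ℂ)) {ε : ℝ} (hε : 0 < ε) (L : E × E →L[ℝ] (E × E) × (E × E)) :
    D.IsPairOperator (regOp (phaseMeasure n) (phase n) χ ε L) where
  contDiff hQ := by
    obtain ⟨θ, hθ, h, -⟩ := hQ.exists_inClass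
    exact isPhase_phase.contDiff_regOp χ hε hθ h L
  act {M Q} hQ τ x := by
    obtain ⟨θ, hθ, h, -⟩ := hQ.exists_inClass
    have h1 := isPhase_phase.regInt_clm (μ := phaseMeasure n) χ (h.isAmplitude hθ x L)
      (D.actL τ) hε
    rw [← actL_apply, _root_.regOp, ← h1]
    simp only [_root_.regOp, actL_apply, hQ.act, add_right_comm _ _ (diag (τ, 0))]
  fderiv hQ x v := by
    obtain ⟨θ, hθ, h, -⟩ := hQ.exists_inClass
    exact isPhase_phase.fderiv_regOp_apply χ hε hθ h L x v
  smul hQ c x := by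
    obtain ⟨θ, hθ, h, -⟩ := hQ.exists_inClass
    exact isPhase_phase.regInt_clm χ (h.isAmplitude hθ x L) (c • ContinuousLinearMap.id ℂ A) hε

end IsPairOperator

/-- The identity is a commuting operator with r = 0. -/
theorem IsSymbol.mul (hf : D.IsSymbol m f) (hg : D.IsSymbol m' g) :
    D.IsSymbol (m + m') (fun x => f x * g x) := by
  have h := IsPairOperator.isSymbol (D := D) (r := 0) IsPairOperator.id (fun {M Q} hQ => ?_)
    (PairSymbol.pair m m' f g hf hg rfl)
  · have e : restrict (D.pairFun f g) = fun x => f x * g x := by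
      ext x
      simp [restrict, diag, pairFun, joint_zero]
    rwa [e, sub_zero] at h
  · obtain ⟨θ, hθ, h, K, hK, hle⟩ := hQ.exists_inClass
    obtain ⟨C, hC, hb⟩ := BoundedFamily.norm_le h
    refine ⟨C * K, fun z => (hb () _).trans ?_⟩
    rw [mul_assoc, sub_zero]
    exact mul_le_mul_of_nonneg_left (hle z) hC

variable (D) in
/-- The operator `f ♯ g - ∑_{k < N} …` on pair symbols. -/
def remainderOp (N : ℕ) (Q : (E × E) × (E × E) → A) : (E × E) × (E × E) → A :=
  oscRemainder (leftDir n) D.rightDir (fstCombo D.rightDir) (sndCombo (leftDir n)) N 1 Q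

theorem isPairOperator_remainderOp (N : ℕ) : D.IsPairOperator (D.remainderOp N) :=
  (IsPairOperator.oscOp _).sub (IsPairOperator.sum _ fun k _ =>
    (IsPairOperator.iterate_transportOp k).const_smul _)

/-- After N transports the total order is M - N, and the integral estimate is uniform over the maps
L₀ + s L₁ with s in [0,1], whose norms are bounded together. -/
theorem PairSymbol.norm_remainderOp_le (hQ : D.PairSymbol M Q) (N : ℕ) :
    ∃ C : ℝ, ∀ z, ‖D.remainderOp N Q (diag z)‖ ≤ C * bracket (M - N) z.2 := by
  obtain ⟨θ, hθ, h, -⟩ := hQ.exists_inClass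
  obtain ⟨θ', hθ', h', K, hK, hle⟩ := (hQ.iterate_transportOp N).exists_inClass
  obtain ⟨C, hC, hb⟩ := isPhase_phase.norm_oscOp_le (μ := phaseMeasure n) hθ' h'
    (fun s : Set.Icc (0 : ℝ) 1 => fstCombo D.rightDir + (s : ℝ) • sndCombo (leftDir n))
    (K := ‖fstCombo D.rightDir‖ + ‖sndCombo (leftDir n)‖) (fun s => by
      refine (norm_add_le _ _).trans (add_le_add le_rfl ?_)
      rw [norm_smul, Real.norm_of_nonneg s.2.1]
      exact mul_le_of_le_one_left (norm_nonneg _) s.2.2)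
  refine ⟨C * K, fun z => ?_⟩
  refine norm_oscRemainder_le hθ h (leftDir n) D.rightDir N (diag z) (fun s hs => ?_) 1 (by simp)
  refine (hb ⟨s, hs⟩ (diag z)).trans ?_
  rw [mul_assoc]
  exact mul_le_mul_of_nonneg_left (hle z) hC

theorem PairSymbol.isSymbol_remainderOp (hQ : D.PairSymbol M Q) (N : ℕ) :
    D.IsSymbol (M - N) (restrict (D.remainderOp N Q)) :=
  (isPairOperator_remainderOp N).isSymbol (fun hQ => hQ.norm_remainderOp_le N) hQ

variable (D) in
/-- The linear map `(y, η) ↦ ((0, η), (-y, B y))`. -/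
def shift : E × E →L[ℝ] (E × E) × (E × E) :=
  fstCombo D.rightDir + (1 : ℝ) • sndCombo (leftDir n)

theorem shift_apply (w : E × E) :
    D.shift w = ((0, w.2), (-w.1, WithLp.toLp 2 (D.B *ᵥ w.1.ofLp))) := by
  have h1 : ∑ j, w.2 j • EuclideanSpace.single j (1 : ℝ) = w.2 :=
    sum_coord_smul_single w.2 LinearMap.id
  have h2 : ∑ j, w.1 j • EuclideanSpace.single j (1 : ℝ) = w.1 :=
    sum_coord_smul_single w.1 LinearMap.id
  simp only [shift, one_smul, add_apply, fstCombo_apply, sndCombo_apply]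
  ext k <;> simp only [Prod.fst_add, Prod.snd_add, Prod.fst_sum, Prod.snd_sum, leftDir, rightDir,
    Prod.smul_mk, smul_zero, Finset.sum_const_zero, add_zero, zero_add, h1, smul_neg,
    Finset.sum_neg_distrib, h2]
  simp [Matrix.mulVec, dotProduct, mul_comm]

theorem pairFun_shift (f g : E → A) (ξ : E) (w : E × E) :
    D.pairFun f g (diag (0, ξ) + D.shift w) = D.compAmplitude f g ξ w.1 w.2 := by
  rw [shift_apply]
  simp [pairFun, diag, joint, compAmplitude, D.act_zero, add_comm]

/-- Fubini for an integrand made integrable by the cutoff; η is the outer variable of the iterated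
integral but the second coordinate of the product. -/
theorem regularizedIntegral_eq (hf : D.IsSymbol m f) (hg : D.IsSymbol m' g)
    (χ : 𝓢(E × E, ℂ)) (ξ : E) {ε : ℝ} (hε : 0 < ε) :
    regularizedIntegral χ (D.compAmplitude f g ξ) ε =
      restrict (regOp (phaseMeasure n) (phase n) χ ε D.shift (D.pairFun f g)) ξ := by
  have hi := isPhase_phase.integrable_regInt (μ := (volume : Measure (E × E))) χ
    ((hf.inClass_pairFun hg).isAmplitude (isModerate_pairWeight m m') (diag (0, ξ))
      D.shift).hasTemperateGrowth hε
  rw [restrict, regOp, regInt, integral_phaseMeasure, regularizedIntegral]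
  simp only [pairFun_shift] at hi ⊢
  rw [Measure.volume_eq_prod] at hi ⊢
  rw [integral_prod_symm _ hi]
  simp only [smul_smul]
  rfl

theorem hasOscIntegral_restrict (hf : D.IsSymbol m f) (hg : D.IsSymbol m' g) (ξ : E) :
    D.HasOscIntegral (D.compAmplitude f g ξ)
      (restrict (oscOp (phaseMeasure n) (phase n) D.shift (D.pairFun f g)) ξ) := by
  intro χ hχ
  have hQ : D.PairSymbol (m + m') (D.pairFun f g) := .pair m m' f g hf hg rfl
  refine ⟨jointSmooth_isSmoothElt ((IsPairOperator.oscOp D.shift).jointSmooth hQ) ξ, ?_,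
    fun c => ?_⟩
  · filter_upwards [self_mem_nhdsWithin] with ε hε
    rw [regularizedIntegral_eq hf hg χ ξ hε]
    exact jointSmooth_isSmoothElt ((IsPairOperator.regOp χ hε D.shift).jointSmooth hQ) ξ
  -- δ^c passes through both the regularized and the limiting operator onto Q. Each seminorm of the
  -- difference is therefore the norm of such a difference for another pair symbol, where norm
  -- convergence is known.
  · have hc : D.PairSymbol (m + m') (multiPow pairDel c (D.pairFun f g)) :=
      multiPow_mem (S := {Q | D.PairSymbol (m + m') Q})
        (fun j Q hQ => PairSymbol.pairDel hQ j) c hQ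
    obtain ⟨θ, hθ, h, -⟩ := hc.exists_inClass
    have h1 := isPhase_phase.tendsto_regInt (μ := phaseMeasure n) χ
      (h.isAmplitude hθ (diag (0, ξ)) D.shift)
    rw [show χ 0 = 1 from hχ, one_smul, tendsto_iff_norm_sub_tendsto_zero] at h1
    refine h1.congr' ?_
    filter_upwards [self_mem_nhdsWithin] with ε hε
    have h2 := ((IsPairOperator.regOp χ hε D.shift).sub
      (IsPairOperator.oscOp (D := D) D.shift)).delta_restrict hQ c ξ
    rw [regularizedIntegral_eq hf hg χ ξ hε]
    exact congrArg norm h2.symm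

/-- One admissible cutoff must exist, and the seminorm with c = 0 is the norm of A. -/
theorem HasOscIntegral.unique {a : E → E → A} {u v : A} (hu : D.HasOscIntegral a u)
    (hv : D.HasOscIntegral a v) : u = v := by
  have hχ := unitCutoff_zero (E × E)
  have h1 := (hu _ hχ).2.2 0
  have h2 := (hv _ hχ).2.2 0
  simp only [delta_zero_index] at h1 h2
  rw [← tendsto_iff_norm_sub_tendsto_zero] at h1 h2
  exact tendsto_nhds_unique h1 h2

theorem HasOscIntegral.oscIntegral_eq {a : E → E → A} {v : A} (hv : D.HasOscIntegral a v) :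
    D.oscIntegral a = v := by
  have h : ∃ v, D.HasOscIntegral a v := ⟨v, hv⟩
  rw [oscIntegral, dif_pos h]
  exact h.choose_spec.unique hv

theorem sharp_eq (hf : D.IsSymbol m f) (hg : D.IsSymbol m' g) : D.sharp f g =
    restrict (oscOp (phaseMeasure n) (phase n) D.shift (D.pairFun f g)) :=
  funext fun ξ => (hasOscIntegral_restrict hf hg ξ).oscIntegral_eq

theorem hasOscIntegral_sharp (hf : D.IsSymbol m f) (hg : D.IsSymbol m' g) (ξ : E) :
    D.HasOscIntegral (D.compAmplitude f g ξ) (D.sharp f g ξ) := by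
  rw [sharp_eq hf hg]
  exact hasOscIntegral_restrict hf hg ξ

theorem isSymbol_sharp_sub (hf : D.IsSymbol m f) (hg : D.IsSymbol m' g) (N : ℕ) :
    D.IsSymbol (m + m' - N) fun ξ => D.sharp f g ξ - ∑ k ∈ Finset.range N,
      ((k.factorial : ℝ)⁻¹) •
        restrict ((transportOp (leftDir n) D.rightDir)^[k] (D.pairFun f g)) ξ := by
  have h := (PairSymbol.pair m m' f g hf hg rfl).isSymbol_remainderOp N
  convert h using 1
  ext ξ
  rw [sharp_eq hf hg]
  simp only [restrict, remainderOp, oscRemainder, one_pow, one_div]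
  rfl

end TwistedSystem

end

end

section

open scoped ContDiff Matrix SchwartzMap Topology
open MeasureTheory Filter

set_option linter.unusedSectionVars false

noncomputable section

/-! ### Multinomial and binomial identities -/

namespace PsiCalculus

variable {n : ℕ} {V : Type*} [AddCommGroup V] [Module ℂ V]

theorem fact_add_single (a : Fin n → ℕ) (j : Fin n) :
    fact (a + Pi.single j 1) = (a j + 1) * fact a := by
  unfold fact
  rw [← Finset.mul_prod_erase _ _ (Finset.mem_univ j),
    ← Finset.mul_prod_erase Finset.univ (fun i => (a i).factorial) (Finset.mem_univ j), ← mul_assoc]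
  congr 1
  · simp [Nat.factorial_succ]
  · refine Finset.prod_congr rfl fun i hi => ?_
    simp [Finset.ne_of_mem_erase hi]

theorem fact_ne_zero (a : Fin n → ℕ) : fact a ≠ 0 :=
  Finset.prod_ne_zero_iff.2 fun _ _ => Nat.factorial_ne_zero _

theorem mem_piAntidiag_univ {a : Fin n → ℕ} {k : ℕ} :
    a ∈ Finset.piAntidiag Finset.univ k ↔ len a = k := by
  simp [Finset.mem_piAntidiag, len]

theorem sub_single_add_single {a : Fin n → ℕ} {j : Fin n} (h : a j ≠ 0) :
    a - Pi.single j 1 + Pi.single j 1 = a := by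
  ext i
  by_cases hij : i = j
  · subst hij
    simp
    omega
  · simp [hij]

/-- A multi-index a of length k + 1 is reached from a - e_j, and 1/(a - e_j)! = a_j / a!. Summing
over j gives ∑_j a_j = k + 1; indices with a_j = 0 are not reached but have coefficient zero. -/
theorem sum_inv_fact_succ (q : (Fin n → ℕ) → V) (k : ℕ) :
    ∑ a ∈ Finset.piAntidiag Finset.univ k, (fact a : ℂ)⁻¹ • ∑ j, q (a + Pi.single j 1) =
      (k + 1 : ℂ) • ∑ a ∈ Finset.piAntidiag Finset.univ (k + 1), (fact a : ℂ)⁻¹ • q a := by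
  have h1 : ∀ j : Fin n, ∑ a ∈ Finset.piAntidiag Finset.univ k,
      (fact a : ℂ)⁻¹ • q (a + Pi.single j 1) =
      ∑ a ∈ Finset.piAntidiag Finset.univ (k + 1), ((a j : ℂ) * (fact a : ℂ)⁻¹) • q a := by
    intro j
    refine Finset.sum_of_injOn (fun a => a + Pi.single j 1)
      (fun a _ b _ h => add_right_cancel h) (fun a ha => ?_) (fun a ha hn => ?_) (fun a _ => ?_)
    · have ha' := mem_piAntidiag_univ.1 ha
      exact mem_piAntidiag_univ.2 (by rw [len_add, len_single, ha'])
    · have : a j = 0 := by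
        by_contra hj
        refine hn ⟨a - Pi.single j 1, ?_, sub_single_add_single hj⟩
        have ha' := mem_piAntidiag_univ.1 ha
        rw [← sub_single_add_single hj, len_add, len_single] at ha'
        exact mem_piAntidiag_univ.2 (by omega)
      simp [this]
    · have h2 : (fact a : ℂ) ≠ 0 := Nat.cast_ne_zero.2 (fact_ne_zero a)
      have h3 : ((a j : ℂ) + 1) ≠ 0 := by exact_mod_cast Nat.succ_ne_zero (a j)
      congr 1
      rw [fact_add_single]
      simp only [Pi.add_apply, Pi.single_eq_same]
      push_cast
      field_simp
  simp_rw [Finset.smul_sum]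
  rw [Finset.sum_comm]
  simp_rw [h1]
  rw [Finset.sum_comm]
  refine Finset.sum_congr rfl fun a ha => ?_
  rw [← Finset.sum_smul, ← Finset.sum_mul, smul_smul]
  congr 2
  have := mem_piAntidiag_univ.1 ha
  rw [len] at this
  exact_mod_cast this

theorem binom_symm {a c : Fin n → ℕ} (h : c ≤ a) : binom a (a - c) = binom a c :=
  Finset.prod_congr rfl fun i _ => Nat.choose_symm (h i)

theorem binom_eq_zero {a c : Fin n → ℕ} (h : ¬ c ≤ a) : binom a c = 0 := by
  obtain ⟨i, hi⟩ := not_forall.1 h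
  exact Finset.prod_eq_zero (Finset.mem_univ i) (Nat.choose_eq_zero_of_lt (not_le.1 hi))

/-- Pascal's rule in coordinate j; the case distinction guards against truncated subtraction. -/
theorem binom_add_single (a c : Fin n → ℕ) (j : Fin n) :
    binom (a + Pi.single j 1) c =
      binom a c + if c j = 0 then 0 else binom a (c - Pi.single j 1) := by
  have h1 : ∀ b b' : Fin n → ℕ, binom b b' =
      (b j).choose (b' j) * ∏ i ∈ Finset.univ.erase j, (b i).choose (b' i) := fun b b' =>
    (Finset.mul_prod_erase Finset.univ (fun i => (b i).choose (b' i)) (Finset.mem_univ j)).symm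
  have h2 : ∏ i ∈ Finset.univ.erase j, ((a + Pi.single j 1 : Fin n → ℕ) i).choose (c i) =
      ∏ i ∈ Finset.univ.erase j, (a i).choose (c i) :=
    Finset.prod_congr rfl fun i hi => by simp [Finset.ne_of_mem_erase hi]
  have h3 : ∏ i ∈ Finset.univ.erase j, (a i).choose ((c - Pi.single j 1 : Fin n → ℕ) i) =
      ∏ i ∈ Finset.univ.erase j, (a i).choose (c i) :=
    Finset.prod_congr rfl fun i hi => by simp [Finset.ne_of_mem_erase hi]
  rw [h1 (a + Pi.single j 1) c, h1 a c, h1 a (c - Pi.single j 1), h2, h3]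
  simp only [Pi.add_apply, Pi.sub_apply, Pi.single_eq_same]
  rcases hc : c j with _ | d
  · simp
  · rw [Nat.choose_succ_succ]
    simp
    ring

/-- The recursion for binomial sums over multi-indices. -/
theorem sum_binom_add_single (T : (Fin n → ℕ) → (Fin n → ℕ) → V) (a : Fin n → ℕ) (j : Fin n) :
    ∑ c ∈ Finset.Iic (a + Pi.single j 1), binom (a + Pi.single j 1) (a + Pi.single j 1 - c) •
        T (a + Pi.single j 1 - c) c =
      ∑ c ∈ Finset.Iic a, binom a (a - c) •
        (T (a - c + Pi.single j 1) c + T (a - c) (c + Pi.single j 1)) := by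
  have e : ∀ c ≤ a, a + Pi.single j 1 - c = a - c + Pi.single j 1 := fun c hc =>
    tsub_add_eq_add_tsub hc ▸ rfl
  -- Pascal's rule splits the sum: one part is a sum over c ≤ a, the other becomes one after c ↦ c +
  -- e_j.
  have h1 : ∀ c ∈ Finset.Iic (a + Pi.single j 1),
      binom (a + Pi.single j 1) (a + Pi.single j 1 - c) • T (a + Pi.single j 1 - c) c =
      binom a c • T (a + Pi.single j 1 - c) c +
        (if c j = 0 then 0 else binom a (c - Pi.single j 1)) • T (a + Pi.single j 1 - c) c := by
    intro c hc
    rw [binom_symm (Finset.mem_Iic.1 hc), binom_add_single, add_smul]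
  rw [Finset.sum_congr rfl h1, Finset.sum_add_distrib]
  simp only [smul_add]
  rw [Finset.sum_add_distrib]
  congr 1
  · symm
    refine (Finset.sum_congr rfl fun c hc => ?_).trans
      (Finset.sum_subset (Finset.Iic_subset_Iic.2 le_self_add) fun c _ hc => ?_)
    · have hc' := Finset.mem_Iic.1 hc
      rw [binom_symm hc', e c hc']
    · rw [binom_eq_zero (fun h => hc (Finset.mem_Iic.2 h)), zero_smul]
  · symm
    refine Finset.sum_of_injOn (fun c => c + Pi.single j 1)
      (fun a _ b _ h => add_right_cancel h) (fun c hc => ?_) (fun c hc hn => ?_) (fun c hc => ?_)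
    · have hc' : c ≤ a := Finset.mem_Iic.1 hc
      exact Finset.mem_coe.2 (Finset.mem_Iic.2 (add_le_add hc' le_rfl))
    · by_cases hj : c j = 0
      · simp [hj]
      · exfalso
        refine hn ⟨c - Pi.single j 1, ?_, sub_single_add_single hj⟩
        have hc' := Finset.mem_Iic.1 hc
        exact Finset.mem_coe.2 (Finset.mem_Iic.2 (tsub_le_iff_right.2 hc'))
    · have hc' := Finset.mem_Iic.1 hc
      rw [binom_symm hc', add_tsub_add_eq_tsub_right]
      simp

end PsiCalculus

end

end

section

open scoped ContDiff Matrix SchwartzMap Topology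
open MeasureTheory Filter

set_option linter.unusedSectionVars false

noncomputable section

/-! ### Powers of the transport operator and of -iδ + ∂_B -/

namespace TwistedSystem

open PsiCalculus

variable {n : ℕ} {A : Type*} [CStarAlgebra A] {D : TwistedSystem n A}

local notation "E" => EuclideanSpace ℝ (Fin n)

variable {f g : EuclideanSpace ℝ (Fin n) → A} {m m' M : ℝ}

theorem joint_dirD (hf : f ∈ D.jointSmooth) (v : E × E) :
    D.joint (D.dirD v f) = fun z => fderiv ℝ (D.joint f) z v :=
  funext fun z => (fderiv_joint hf z v).symm

theorem dirD_jointSmooth (v : E × E) (hf : f ∈ D.jointSmooth) : D.dirD v f ∈ D.jointSmooth := by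
  rw [jointSmooth, Set.mem_ofPred_eq, joint_dirD hf]
  exact contDiff_fderiv_apply hf v

theorem dirD_comm (v w : E × E) (hf : f ∈ D.jointSmooth) :
    D.dirD v (D.dirD w f) = D.dirD w (D.dirD v f) := by
  apply D.joint_injective
  rw [joint_dirD (dirD_jointSmooth w hf), joint_dirD (dirD_jointSmooth v hf), joint_dirD hf,
    joint_dirD hf]
  ext z
  exact fderiv_fderiv_apply_comm hf w v z

theorem dirD_smul (v : E × E) (hf : f ∈ D.jointSmooth) (c : ℂ) :
    D.dirD v (fun x => c • f x) = fun x => c • D.dirD v f x := by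
  apply D.joint_injective
  rw [joint_dirD (jointSmooth_smul hf c), joint_smul, joint_smul, joint_dirD hf]
  ext z
  exact fderiv_const_smul_apply' hf c z v

theorem jointSmooth_sum {J : Type*} (s : Finset J) {h : J → E → A}
    (hh : ∀ i ∈ s, h i ∈ D.jointSmooth) : (fun x => ∑ i ∈ s, h i x) ∈ D.jointSmooth := by
  rw [jointSmooth, Set.mem_ofPred_eq, joint_sum]
  exact ContDiff.sum fun i hi => contDiff_joint (hh i hi)

theorem dirD_sum (v : E × E) {J : Type*} (s : Finset J) {h : J → E → A}
    (hh : ∀ i ∈ s, h i ∈ D.jointSmooth) :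
    D.dirD v (fun x => ∑ i ∈ s, h i x) = fun x => ∑ i ∈ s, D.dirD v (h i) x := by
  apply D.joint_injective
  rw [joint_dirD (jointSmooth_sum s hh), joint_sum, joint_sum]
  ext z
  rw [fderiv_fun_sum fun i hi => (contDiff_joint (hh i hi)).differentiable (by simp) z, sum_apply]
  exact Finset.sum_congr rfl fun i hi => fderiv_joint (hh i hi) z v

theorem del_eq_dirD (j : Fin n) (f : E → A) :
    D.del j f = fun x => (-Complex.I) • D.dirD (EuclideanSpace.single j 1, 0) f x := by
  ext x
  simp [dirD_single_fst, smul_smul]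

theorem twistedD_eq_dirD (D : TwistedSystem n A) (j : Fin n) (f : E → A) :
    twistedD D.B j f = D.dirD (0, WithLp.toLp 2 fun k => D.B k j) f := by
  ext x
  simp [dirD, twistedD]

theorem twistedD_jointSmooth (j : Fin n) (f : E → A) (hf : f ∈ D.jointSmooth) :
    twistedD D.B j f ∈ D.jointSmooth := by
  rw [twistedD_eq_dirD]
  exact dirD_jointSmooth _ hf

theorem twistedD_comm (i j : Fin n) (f : E → A) (hf : f ∈ D.jointSmooth) :
    twistedD D.B i (twistedD D.B j f) = twistedD D.B j (twistedD D.B i f) := by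
  simp only [twistedD_eq_dirD]
  exact dirD_comm _ _ hf

theorem twistedD_del (i j : Fin n) (f : E → A) (hf : f ∈ D.jointSmooth) :
    twistedD D.B i (D.del j f) = D.del j (twistedD D.B i f) := by
  simp only [twistedD_eq_dirD, del_eq_dirD]
  rw [dirD_smul _ (dirD_jointSmooth _ hf), dirD_comm _ _ hf]

theorem twistedPow_jointSmooth (c : Fin n → ℕ) (hf : f ∈ D.jointSmooth) :
    twistedPow D.B c f ∈ D.jointSmooth :=
  multiPow_mem twistedD_jointSmooth c hf

theorem twistDel_jointSmooth (j : Fin n) (f : E → A) (hf : f ∈ D.jointSmooth) :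
    D.twistDel j f ∈ D.jointSmooth := by
  rw [← dirD_rightDir]
  exact dirD_jointSmooth _ hf

theorem twistDel_comm (i j : Fin n) (f : E → A) (hf : f ∈ D.jointSmooth) :
    D.twistDel i (D.twistDel j f) = D.twistDel j (D.twistDel i f) := by
  simp only [← dirD_rightDir]
  exact dirD_comm _ _ hf

variable (D) in
/-- The term `(-i)^{|b|} δ^b ∂_B^c g`. -/
def twistTerm (g : E → A) (b c : Fin n → ℕ) : E → A :=
  fun x => (-Complex.I) ^ len b • D.delta b (twistedPow D.B c g x)

theorem twistTerm_jointSmooth (hg : g ∈ D.jointSmooth) (b c : Fin n → ℕ) :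
    D.twistTerm g b c ∈ D.jointSmooth :=
  jointSmooth_smul (delta_jointSmooth b (twistedPow_jointSmooth c hg)) _

/-- The two summands of -iδ_j + ∂_{B,j} raise the two indices separately; ∂_{B,j} must first be
commuted past δ^b. -/
theorem twistDel_twistTerm (hg : g ∈ D.jointSmooth) (b c : Fin n → ℕ) (j : Fin n) :
    D.twistDel j (D.twistTerm g b c) = fun x =>
      D.twistTerm g (b + Pi.single j 1) c x + D.twistTerm g b (c + Pi.single j 1) x := by
  have h1 := twistedPow_jointSmooth c hg
  have h2 := delta_jointSmooth b h1
  have h3 : D.del j (fun x => D.delta b (twistedPow D.B c g x)) =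
      fun x => D.delta (b + Pi.single j 1) (twistedPow D.B c g x) :=
    funext fun x => (D.delta_add_single (jointSmooth_isSmoothElt h1 x) b j).symm
  have h4 : twistedD D.B j (fun x => D.delta b (twistedPow D.B c g x)) =
      fun x => D.delta b (twistedPow D.B (c + Pi.single j 1) g x) := by
    have h5 : twistedPow D.B (c + Pi.single j 1) g = twistedD D.B j (twistedPow D.B c g) :=
      multiPow_add_single twistedD_jointSmooth twistedD_comm j c hg
    rw [h5, delta_comp_eq_multiPow (twistedD_jointSmooth j _ h1), delta_comp_eq_multiPow h1]
    exact map_multiPow (twistedD D.B j) del_jointSmooth (fun k f hf => twistedD_del j k f hf) b h1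
  unfold twistTerm
  rw [← dirD_rightDir, dirD_smul _ h2, dirD_rightDir]
  ext x
  simp only [twistDel, h3, h4]
  rw [smul_add, smul_smul, len_add, len_single, pow_succ]

/-- The binomial theorem for the commuting operators -iδ_j and ∂_{B,j}. -/
theorem multiPow_twistDel (hg : g ∈ D.jointSmooth) (a : Fin n → ℕ) :
    multiPow D.twistDel a g = ∑ c ∈ Finset.Iic a, binom a (a - c) • D.twistTerm g (a - c) c := by
  induction a using multiIndex_induction with
  | h0 =>
    have : Finset.Iic (0 : Fin n → ℕ) = {0} := by
      ext c
      simp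
    rw [multiPow_zero, this, Finset.sum_singleton]
    ext x
    simp [twistTerm, binom, twistedPow, multiPow_zero, delta_zero_index]
  | hs a j ih =>
    rw [multiPow_add_single twistDel_jointSmooth twistDel_comm j a hg, ih,
      sum_binom_add_single (D.twistTerm g) a j]
    have h1 : (∑ c ∈ Finset.Iic a, binom a (a - c) • D.twistTerm g (a - c) c) = fun x =>
        ∑ c ∈ Finset.Iic a, (binom a (a - c) : ℂ) • D.twistTerm g (a - c) c x := by
      ext x
      simp [Finset.sum_apply, Nat.cast_smul_eq_nsmul]
    rw [h1, ← dirD_rightDir, dirD_sum _ _ fun c _ => jointSmooth_smul (twistTerm_jointSmooth hg _ _) _]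
    ext x
    rw [Finset.sum_apply]
    refine Finset.sum_congr rfl fun c _ => ?_
    rw [dirD_smul _ (twistTerm_jointSmooth hg _ _), dirD_rightDir, twistDel_twistTerm hg]
    simp [Nat.cast_smul_eq_nsmul]

theorem IsSymbol.partialPow (hf : D.IsSymbol m f) (a : Fin n → ℕ) :
    D.IsSymbol (m - len a) (partialPow a f) := by
  induction a using multiIndex_induction with
  | h0 => simpa [partialPow_zero] using hf
  | hs a j ih =>
    rw [partialPow_add_single a j hf.contDiff, len_add, len_single, Nat.cast_succ, ← sub_sub]
    exact ih.partialD j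

theorem IsSymbol.multiPow_twistDel (hg : D.IsSymbol m g) (a : Fin n → ℕ) :
    D.IsSymbol m (multiPow D.twistDel a g) :=
  multiPow_mem (S := {f | D.IsSymbol m f}) (fun j _ hf => IsSymbol.twistDel hf j) a hg

theorem PairSymbol.transportOp_sum {J : Type*} (s : Finset J)
    {Q : J → (E × E) × (E × E) → A} (h : ∀ j ∈ s, D.PairSymbol M (Q j))
    (p q : Fin n → (E × E) × (E × E)) :
    transportOp p q (fun x => ∑ j ∈ s, Q j x) = fun x => ∑ j ∈ s, transportOp p q (Q j) x := by
  classical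
  induction s using Finset.induction_on with
  | empty =>
    ext x
    simp [transportOp]
  | insert j s hj ih =>
    have h1 := h j (Finset.mem_insert_self _ _)
    have h2 := fun i hi => h i (Finset.mem_insert_of_mem hi)
    simp only [Finset.sum_insert hj]
    rw [h1.transportOp_add (PairSymbol.sum s h2), ih h2]

/-- The multinomial theorem, by induction on k: one more transport raises a by e_j in both factors,
and `sum_inv_fact_succ` supplies the factor k + 1. -/
theorem iterate_transportOp_pairFun (hf : D.IsSymbol m f) (hg : D.IsSymbol m' g) (k : ℕ) :
    (transportOp (leftDir n) D.rightDir)^[k] (D.pairFun f g) = fun x =>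
      ((k.factorial : ℂ) * (-Complex.I) ^ k) • ∑ a ∈ Finset.piAntidiag Finset.univ k,
        (fact a : ℂ)⁻¹ • D.pairFun (partialPow a f) (multiPow D.twistDel a g) x := by
  induction k with
  | zero =>
    ext x
    simp [Finset.piAntidiag_zero, partialPow_zero, multiPow_zero, fact]
  | succ k ih =>
    have hp : ∀ a ∈ Finset.piAntidiag Finset.univ k, D.PairSymbol (m + m' - k)
        (D.pairFun (partialPow a f) (multiPow D.twistDel a g)) := fun a ha =>
      .pair (m - len a) m' _ _ (hf.partialPow a) (hg.multiPow_twistDel a) (by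
        rw [mem_piAntidiag_univ.1 ha]; ring)
    rw [Function.iterate_succ_apply', ih,
      (PairSymbol.sum _ fun a ha => (hp a ha).smul _).transportOp_smul,
      PairSymbol.transportOp_sum _ fun a ha => (hp a ha).smul _]
    ext x
    have h1 : ∀ a ∈ Finset.piAntidiag Finset.univ k, transportOp (leftDir n) D.rightDir
        (fun x => (fact a : ℂ)⁻¹ • D.pairFun (partialPow a f) (multiPow D.twistDel a g) x) x =
        (-Complex.I) • (fact a : ℂ)⁻¹ • ∑ j, D.pairFun (partialPow (a + Pi.single j 1) f)
          (multiPow D.twistDel (a + Pi.single j 1) g) x := by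
      intro a ha
      rw [(hp a ha).transportOp_smul,
        transportOp_pairFun (hf.partialPow a) (hg.multiPow_twistDel a), smul_comm]
      simp only [partialPow_add_single _ _ hf.contDiff,
        multiPow_add_single twistDel_jointSmooth twistDel_comm _ _ hg.jointSmooth]
    beta_reduce
    rw [Finset.sum_congr rfl h1, ← Finset.smul_sum, sum_inv_fact_succ (fun a =>
      D.pairFun (partialPow a f) (multiPow D.twistDel a g) x) k, smul_smul, smul_smul]
    congr 1
    rw [Nat.factorial_succ, pow_succ]
    push_cast
    ring

/-- The k! of the multinomial formula cancels the 1/k! of Taylor's formula. -/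
theorem isSymbol_sharp_sub_sum (hf : D.IsSymbol m f) (hg : D.IsSymbol m' g) (N : ℕ) :
    D.IsSymbol (m + m' - N) fun ξ => D.sharp f g ξ - ∑ k ∈ Finset.range N,
      ∑ a ∈ Finset.piAntidiag Finset.univ k, ((-Complex.I) ^ len a / (fact a : ℂ)) •
        (partialPow a f ξ * multiPow D.twistDel a g ξ) := by
  convert isSymbol_sharp_sub hf hg N using 4 with ξ k
  rw [iterate_transportOp_pairFun hf hg, restrict, ← Complex.coe_smul, smul_smul,
    Finset.smul_sum]
  refine Finset.sum_congr rfl fun a ha => ?_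
  rw [smul_smul, mem_piAntidiag_univ.1 ha]
  have h1 : (k.factorial : ℂ) ≠ 0 := Nat.cast_ne_zero.2 (Nat.factorial_ne_zero k)
  simp only [pairFun, diag, joint_zero]
  congr 1
  push_cast
  field_simp

end TwistedSystem

end

end

section

open scoped ContDiff Matrix SchwartzMap Topology
open MeasureTheory Filter

set_option linter.unusedSectionVars false

noncomputable section

/-! ### Homogeneous functions and operators of a given order -/

namespace TwistedSystem

open PsiCalculus

variable {n : ℕ} {A : Type*} [CStarAlgebra A] {D : TwistedSystem n A}

local notation "E" => EuclideanSpace ℝ (Fin n)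

variable {f g : EuclideanSpace ℝ (Fin n) → A} {m m' M : ℝ}

theorem dirD_zero_fst (v : E) (f : E → A) :
    D.dirD (0, v) f = fun x => ∑ j, v j • partialD j f x := by
  ext x
  simp [dirD]

namespace IsHomogeneous

theorem zero (m : ℝ) : IsHomogeneous m (fun _ : E => (0 : A)) := fun r x _ _ => by simp

theorem smul (hf : IsHomogeneous m f) (c : ℂ) : IsHomogeneous m (fun x => c • f x) :=
  fun r x hr hx => by
    beta_reduce
    rw [hf r x hr hx, smul_comm]

theorem sum {J : Type*} (s : Finset J) {f : J → E → A} (hf : ∀ i ∈ s, IsHomogeneous m (f i)) :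
    IsHomogeneous m (fun x => ∑ i ∈ s, f i x) := fun r x hr hx => by
  rw [Finset.smul_sum]
  exact Finset.sum_congr rfl fun i hi => hf i hi r x hr hx

theorem mul (hf : IsHomogeneous m f) (hg : IsHomogeneous m' g) :
    IsHomogeneous (m + m') (fun x => f x * g x) := fun r x hr hx => by
  beta_reduce
  rw [hf r x hr hx, hg r x hr hx, smul_mul_smul_comm, Real.rpow_add (by linarith)]

/-- The homogeneity relation is differentiable only where it holds on a neighbourhood, that is for
‖x‖ > 1; the unit sphere is reached by continuity. -/
theorem partialD (hf : IsHomogeneous m f) (hd : ContDiff ℝ ∞ f) (j : Fin n) :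
    IsHomogeneous (m - 1) (partialD j f) := by
  intro r x hr hx
  have hr0 : 0 < r := by linarith
  have h1 : ∀ y : E, 1 < ‖y‖ →
      PsiCalculus.partialD j f (r • y) = (r ^ (m - 1) : ℝ) • PsiCalculus.partialD j f y := by
    intro y hy
    have e1 : HasFDerivAt (fun y => f (r • y)) ((fderiv ℝ f (r • y)).comp
        (r • ContinuousLinearMap.id ℝ E)) y :=
      HasFDerivAt.comp (g := f) y (hd.differentiable (by simp) (r • y)).hasFDerivAt
        ((hasFDerivAt_id y).const_smul r)
    have e2 : HasFDerivAt (fun y => f (r • y)) ((r ^ m : ℝ) • fderiv ℝ f y) y := by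
      refine ((hd.differentiable (by simp) y).hasFDerivAt.const_smul (r ^ m : ℝ)).congr_of_eventuallyEq
        ?_
      filter_upwards [(isOpen_lt continuous_const continuous_norm).mem_nhds hy] with z hz
      exact hf r z hr (le_of_lt hz)
    have e3 := congrArg (fun T => T (EuclideanSpace.single j 1)) (e1.unique e2)
    simp only [ContinuousLinearMap.comp_apply, smul_apply, ContinuousLinearMap.id_apply,
      map_smul] at e3
    rw [PsiCalculus.partialD, Real.rpow_sub_one hr0.ne', div_eq_inv_mul, mul_smul,
      PsiCalculus.partialD, ← e3, inv_smul_smul₀ hr0.ne']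
  have hc : Continuous (PsiCalculus.partialD j f) := 
    (contDiff_fderiv_apply hd _).continuous
  -- Approach x along the ray s x with s ↓ 1, on which the relation is already known.
  have hcl : IsClosed {s : ℝ | PsiCalculus.partialD j f (r • s • x) =
      (r ^ (m - 1) : ℝ) • PsiCalculus.partialD j f (s • x)} :=
    isClosed_eq (by fun_prop) (by fun_prop)
  have hs : Set.Ioi (1 : ℝ) ⊆ {s : ℝ | PsiCalculus.partialD j f (r • s • x) =
      (r ^ (m - 1) : ℝ) • PsiCalculus.partialD j f (s • x)} := by
    intro s hs
    refine h1 (s • x) ?_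
    have hs' : 1 < s := hs
    rw [norm_smul, Real.norm_of_nonneg (by linarith)]
    nlinarith
  have h2 := hcl.closure_subset_iff.2 hs
  rw [closure_Ioi] at h2
  simpa using h2 (Set.self_mem_Ici (a := (1 : ℝ)))

theorem del (hf : IsHomogeneous m f) (hs : f ∈ D.jointSmooth) (j : Fin n) :
    IsHomogeneous m (D.del j f) := by
  intro r x hr hx
  have h1 := del_smul hs ((r ^ m : ℝ) : ℂ) j
  have h2 := congrFun h1 x
  simp only [TwistedSystem.del, Complex.coe_smul] at h2 ⊢
  rw [← h2, hf r x hr hx]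

end IsHomogeneous

variable (D) in
/-- Linear operators that lower the order of symbols and the degree of homogeneity by `r`. -/
structure IsOrderOp (r : ℕ) (T : (E → A) → E → A) : Prop where
  jointSmooth : ∀ {f}, f ∈ D.jointSmooth → T f ∈ D.jointSmooth
  map_add : ∀ {f g}, f ∈ D.jointSmooth → g ∈ D.jointSmooth →
    T (fun x => f x + g x) = fun x => T f x + T g x
  map_smul : ∀ {f}, f ∈ D.jointSmooth → ∀ c : ℂ, T (fun x => c • f x) = fun x => c • T f x
  isSymbol : ∀ {m f}, D.IsSymbol m f → D.IsSymbol (m - r) (T f)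
  homogeneous : ∀ {m f}, f ∈ D.jointSmooth → IsHomogeneous m f → IsHomogeneous (m - r) (T f)

namespace IsOrderOp

variable {r s : ℕ} {T T' : (EuclideanSpace ℝ (Fin n) → A) → EuclideanSpace ℝ (Fin n) → A}

/-- Agreement on smooth functions is enough; several of the operators have convenient formulas only
there. -/
theorem congr (hT : D.IsOrderOp r T) (h : ∀ f ∈ D.jointSmooth, T' f = T f) : D.IsOrderOp r T' where
  jointSmooth hf := by
    rw [h _ hf]
    exact hT.jointSmooth hf
  map_add hf hg := by
    rw [h _ hf, h _ hg, h _ (jointSmooth_add hf hg)]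
    exact hT.map_add hf hg
  map_smul hf c := by
    rw [h _ hf, h _ (jointSmooth_smul hf c)]
    exact hT.map_smul hf c
  isSymbol hf := by
    rw [h _ hf.jointSmooth]
    exact hT.isSymbol hf
  homogeneous hf hh := by
    rw [h _ hf]
    exact hT.homogeneous hf hh

theorem id : D.IsOrderOp 0 (fun f => f) where
  jointSmooth hf := hf
  map_add _ _ := rfl
  map_smul _ _ := rfl
  isSymbol hf := by simpa using hf
  homogeneous _ hh := by simpa using hh

theorem comp (hT : D.IsOrderOp r T) (hT' : D.IsOrderOp s T') :
    D.IsOrderOp (s + r) (fun f => T (T' f)) where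
  jointSmooth hf := hT.jointSmooth (hT'.jointSmooth hf)
  map_add hf hg := by
    rw [hT'.map_add hf hg, hT.map_add (hT'.jointSmooth hf) (hT'.jointSmooth hg)]
  map_smul hf c := by
    rw [hT'.map_smul hf, hT.map_smul (hT'.jointSmooth hf)]
  isSymbol hf := by
    rw [Nat.cast_add, ← sub_sub]
    exact hT.isSymbol (hT'.isSymbol hf)
  homogeneous hf hh := by
    rw [Nat.cast_add, ← sub_sub]
    exact hT.homogeneous (hT'.jointSmooth hf) (hT'.homogeneous hf hh)

theorem multiPow {T : Fin n → (E → A) → E → A} (hT : ∀ j, D.IsOrderOp r (T j))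
    (hc : ∀ i j, ∀ f ∈ D.jointSmooth, T i (T j f) = T j (T i f)) (a : Fin n → ℕ) :
    D.IsOrderOp (len a * r) (PsiCalculus.multiPow T a) := by
  induction a using multiIndex_induction with
  | h0 =>
    rw [len_zero, zero_mul]
    exact id.congr fun f _ => multiPow_zero f
  | hs a j ih =>
    rw [len_add, len_single, add_mul, one_mul]
    exact ((hT j).comp ih).congr fun f hf =>
      multiPow_add_single (fun j f hf => (hT j).jointSmooth hf) hc j a hf

theorem smul (hT : D.IsOrderOp r T) (c : ℂ) : D.IsOrderOp r (fun f x => c • T f x) where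
  jointSmooth hf := jointSmooth_smul (hT.jointSmooth hf) c
  map_add hf hg := by
    rw [hT.map_add hf hg]
    simp only [smul_add]
  map_smul hf c' := by
    rw [hT.map_smul hf]
    ext x
    exact smul_comm _ _ _
  isSymbol hf := (hT.isSymbol hf).const_smul c
  homogeneous hf hh := (hT.homogeneous hf hh).smul c

theorem dirD_snd (v : E) : D.IsOrderOp 1 (D.dirD (0, v)) where
  jointSmooth hf := dirD_jointSmooth _ hf
  map_add {f g} hf hg := by
    apply D.joint_injective
    rw [joint_dirD (jointSmooth_add hf hg), joint_add, joint_add, joint_dirD hf, joint_dirD hg]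
    ext z
    rw [fderiv_fun_add ((contDiff_joint hf).differentiable (by simp) z)
      ((contDiff_joint hg).differentiable (by simp) z), add_apply]
  map_smul hf c := dirD_smul _ hf c
  isSymbol {m f} hf := by
    have := IsSymbol.sum Finset.univ fun j _ => (hf.partialD j).const_smul (v j)
    rw [dirD_zero_fst]
    simpa using this
  homogeneous {m f} hf hh := by
    have := IsHomogeneous.sum Finset.univ fun j _ =>
      (hh.partialD (jointSmooth_contDiff hf) j).smul (v j)
    rw [dirD_zero_fst]
    simpa using this

theorem partialPow (a : Fin n → ℕ) : D.IsOrderOp (len a) (partialPow a) := by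
  have h : ∀ j : Fin n, D.IsOrderOp 1 (partialD j) := fun j =>
    (dirD_snd (EuclideanSpace.single j 1)).congr fun f _ => (dirD_single_snd f j).symm
  have := multiPow h (fun i j f hf => partialD_comm i j f (jointSmooth_contDiff hf)) a
  rwa [mul_one] at this

theorem twistedPow (a : Fin n → ℕ) : D.IsOrderOp (len a) (twistedPow D.B a) := by
  have h : ∀ j : Fin n, D.IsOrderOp 1 (twistedD D.B j) := fun j =>
    (dirD_snd (WithLp.toLp 2 fun k => D.B k j)).congr fun f _ => twistedD_eq_dirD D j f
  have := multiPow h twistedD_comm a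
  rwa [mul_one] at this

theorem delta (c : Fin n → ℕ) : D.IsOrderOp 0 (fun f x => D.delta c (f x)) := by
  have h : ∀ j : Fin n, D.IsOrderOp 0 (D.del j) := fun j =>
    { jointSmooth := fun hf => del_jointSmooth j _ hf
      map_add := fun hf hg => del_add hf hg j
      map_smul := fun hf c => del_smul hf c j
      isSymbol := fun hf => by simpa using hf.del j
      homogeneous := fun hf hh => by simpa using hh.del hf j }
  have := multiPow h del_comm c
  rw [mul_zero] at this
  exact this.congr fun f hf => delta_comp_eq_multiPow hf c

theorem twistTerm (b c : Fin n → ℕ) : D.IsOrderOp (len c) (fun g => D.twistTerm g b c) :=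
  ((delta b).comp (twistedPow c)).smul _

theorem map_sub_sum (hT : D.IsOrderOp r T) (hf : f ∈ D.jointSmooth) {F : ℕ → E → A}
    (hF : ∀ j, F j ∈ D.jointSmooth) (N : ℕ) :
    T (fun x => f x - ∑ j ∈ Finset.range N, F j x) =
      fun x => T f x - ∑ j ∈ Finset.range N, T (F j) x := by
  induction N with
  | zero => simp
  | succ N ih =>
    have e : (fun x => f x - ∑ j ∈ Finset.range (N + 1), F j x) =
        fun x => (f x - ∑ j ∈ Finset.range N, F j x) + (-1 : ℂ) • F N x := by
      ext x
      rw [Finset.sum_range_succ]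
      simp
      abel
    have h1 : (fun x => f x - ∑ j ∈ Finset.range N, F j x) ∈ D.jointSmooth := by
      have := jointSmooth_add hf (jointSmooth_smul (jointSmooth_sum (Finset.range N)
        fun j _ => hF j) (-1))
      simpa [← sub_eq_add_neg] using this
    rw [e, hT.map_add h1 (jointSmooth_smul (hF N) _), ih, hT.map_smul (hF N)]
    ext x
    rw [Finset.sum_range_succ]
    simp
    abel

end IsOrderOp

/-! ### Calculus of classical expansions -/

namespace HasClassicalExpansion

variable {F G : ℕ → EuclideanSpace ℝ (Fin n) → A}

theorem of_hasExpansion (h : D.HasExpansion m f F) (hh : ∀ j : ℕ, IsHomogeneous (m - j) (F j)) :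
    D.HasClassicalExpansion m f F :=
  ⟨fun j => (h.symbol_term j).smooth, hh, h⟩

theorem symbol (h : D.HasClassicalExpansion m f F) : D.IsSymbol m f := h.expansion.symbol

theorem symbol_term (h : D.HasClassicalExpansion m f F) (j : ℕ) : D.IsSymbol (m - j) (F j) :=
  h.expansion.symbol_term j

theorem remainder (h : D.HasClassicalExpansion m f F) (N : ℕ) :
    D.IsSymbol (m - N) fun x => f x - ∑ j ∈ Finset.range N, F j x := by
  rcases N.eq_zero_or_pos with rfl | hN
  · simpa using h.symbol
  · exact h.expansion.remainder N hN

theorem map (h : D.HasClassicalExpansion m f F) {r : ℕ} {T : (E → A) → E → A}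
    (hT : D.IsOrderOp r T) : D.HasClassicalExpansion (m - r) (T f) (fun j => T (F j)) := by
  refine of_hasExpansion ⟨hT.isSymbol h.symbol, fun j => ?_, fun N _ => ?_⟩ fun j => ?_
  · rw [sub_right_comm]
    exact hT.isSymbol (h.symbol_term j)
  · rw [sub_right_comm, ← hT.map_sub_sum h.symbol.jointSmooth
      (fun j => (h.symbol_term j).jointSmooth)]
    exact hT.isSymbol (h.remainder N)
  · rw [sub_right_comm]
    exact hT.homogeneous (h.symbol_term j).jointSmooth (h.homogeneous_term j)

theorem smul (h : D.HasClassicalExpansion m f F) (c : ℂ) :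
    D.HasClassicalExpansion m (fun x => c • f x) (fun j x => c • F j x) := by
  simpa using h.map (IsOrderOp.id.smul c)

theorem sum {J : Type*} (s : Finset J) {f : J → E → A} {F : J → ℕ → E → A}
    (h : ∀ i ∈ s, D.HasClassicalExpansion m (f i) (F i)) :
    D.HasClassicalExpansion m (fun x => ∑ i ∈ s, f i x) (fun j x => ∑ i ∈ s, F i j x) := by
  refine of_hasExpansion ⟨IsSymbol.sum s fun i hi => (h i hi).symbol,
    fun j => IsSymbol.sum s fun i hi => (h i hi).symbol_term j, fun N _ => ?_⟩
    fun j => IsHomogeneous.sum s fun i hi => (h i hi).homogeneous_term j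
  have := IsSymbol.sum s fun i hi => (h i hi).remainder N
  convert this using 2 with x
  rw [Finset.sum_sub_distrib, Finset.sum_comm]

/-- Prepends d zero terms, which are homogeneous of every degree, so that expansions of different
orders can be added. -/
theorem shift {d : ℕ} (h : D.HasClassicalExpansion (m - d) f F) :
    D.HasClassicalExpansion m f (fun j => if d ≤ j then F (j - d) else fun _ => 0) := by
  have hd : (0 : ℝ) ≤ d := Nat.cast_nonneg d
  refine of_hasExpansion ⟨h.symbol.mono (by linarith), fun j => ?_, fun N _ => ?_⟩ fun j => ?_
  · split_ifs with hj
    · have := h.symbol_term (j - d)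
      rwa [Nat.cast_sub hj, sub_sub, add_sub_cancel] at this
    · exact isSymbol_zero _
  · rcases le_total N d with hN | hN
    · have h0 : ∀ x, ∑ j ∈ Finset.range N, (if d ≤ j then F (j - d) else fun _ => 0) x = 0 :=
        fun x => Finset.sum_eq_zero fun j hj => by
          rw [if_neg (by have := Finset.mem_range.1 hj; omega)]
      simp only [h0, sub_zero]
      exact h.symbol.mono (by have : (N : ℝ) ≤ d := by exact_mod_cast hN
                              linarith)
    · obtain ⟨N, rfl⟩ := Nat.exists_eq_add_of_le hN
      have h0 : ∀ x, ∑ j ∈ Finset.range (d + N), (if d ≤ j then F (j - d) else fun _ => 0) x =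
          ∑ j ∈ Finset.range N, F j x := by
        intro x
        rw [Finset.sum_range_add, Finset.sum_eq_zero, zero_add]
        · simp
        · intro j hj
          rw [if_neg (by have := Finset.mem_range.1 hj; omega)]
      simp only [h0]
      rw [Nat.cast_add, ← sub_sub]
      exact h.remainder N
  · split_ifs with hj
    · have := h.homogeneous_term (j - d)
      rwa [Nat.cast_sub hj, sub_sub, add_sub_cancel] at this
    · exact IsHomogeneous.zero _

/-- The Cauchy product. Its remainder is (f - ∑_{k<N} F_k) g + ∑_{k<N} F_k (g - ∑_{l<N-k} G_l), and
each term has order m + m' - N. -/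
theorem mul (hf : D.HasClassicalExpansion m f F) (hg : D.HasClassicalExpansion m' g G) :
    D.HasClassicalExpansion (m + m') (fun x => f x * g x)
      (fun j x => ∑ q ∈ Finset.HasAntidiagonal.antidiagonal j, F q.1 x * G q.2 x) := by
  have hq : ∀ (j : ℕ), ∀ q ∈ Finset.HasAntidiagonal.antidiagonal j,
      (m - (q.1 : ℕ)) + (m' - (q.2 : ℕ)) = m + m' - j := by
    intro j q hq
    rw [← Finset.HasAntidiagonal.mem_antidiagonal.1 hq]
    push_cast
    ring
  refine of_hasExpansion ⟨hf.symbol.mul hg.symbol, fun j => IsSymbol.sum _ fun q h => ?_,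
    fun N _ => ?_⟩ fun j => IsHomogeneous.sum _ fun q h => ?_
  · rw [← hq j q h]
    exact (hf.symbol_term q.1).mul (hg.symbol_term q.2)
  · have h1 := (hf.remainder N).mul hg.symbol
    have h2 : D.IsSymbol (m + m' - N) fun x => ∑ k ∈ Finset.range N,
        F k x * (g x - ∑ l ∈ Finset.range (N - k), G l x) := by
      refine IsSymbol.sum _ fun k hk => ?_
      have hk' := (Finset.mem_range.1 hk).le
      have := (hf.symbol_term k).mul (hg.remainder (N - k))
      rw [Nat.cast_sub hk'] at this
      refine this.mono (le_of_eq (by ring))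
    refine ((h1.mono (le_of_eq (by ring))).add h2).congr ?_
    intro x
    simp only [Finset.Nat.sum_antidiagonal_eq_sum_range_succ (fun k l => F k x * G l x)]
    rw [Finset.sum_range_diag_flip N (fun k l => F k x * G l x)]
    simp only [mul_sub, Finset.sum_sub_distrib, sub_mul, Finset.sum_mul, Finset.mul_sum]
    abel
  · rw [← hq j q h]
    exact (hf.homogeneous_term q.1).mul (hg.homogeneous_term q.2)

/-- An asymptotic sum of layers h_k, each with its own expansion, is regrouped by total degree:
truncating layer k at N - k terms leaves an error of order m - N. In the pair p, the layer is `p.2`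
and the index inside it `p.1`, as in `sharpPart`. -/
theorem of_layers {h : ℕ → E → A} {v : ℕ → ℕ → E → A}
    (hr : ∀ N : ℕ, D.IsSymbol (m - N) fun x => f x - ∑ k ∈ Finset.range N, h k x)
    (hh : ∀ k : ℕ, D.HasClassicalExpansion (m - k) (h k) (v k)) :
    D.HasClassicalExpansion m f
      (fun j x => ∑ p ∈ Finset.HasAntidiagonal.antidiagonal j, v p.2 p.1 x) := by
  have hq : ∀ (j : ℕ), ∀ q ∈ Finset.HasAntidiagonal.antidiagonal j,
      m - (q.2 : ℕ) - (q.1 : ℕ) = m - j := by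
    intro j q hq
    rw [← Finset.HasAntidiagonal.mem_antidiagonal.1 hq]
    push_cast
    ring
  refine of_hasExpansion ⟨?_, fun j => IsSymbol.sum _ fun q hq' => ?_,
    fun N _ => ?_⟩ fun j => IsHomogeneous.sum _ fun q hq' => ?_
  · simpa using hr 0
  · rw [← hq j q hq']
    exact (hh q.2).symbol_term q.1
  · have h2 : D.IsSymbol (m - N) fun x => ∑ k ∈ Finset.range N,
        (h k x - ∑ l ∈ Finset.range (N - k), v k l x) := by
      refine IsSymbol.sum _ fun k hk => ?_
      have := (hh k).remainder (N - k)
      rw [Nat.cast_sub (Finset.mem_range.1 hk).le] at this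
      exact this.mono (le_of_eq (by ring))
    refine ((hr N).add h2).congr ?_
    intro x
    have e : ∀ j, ∑ p ∈ Finset.HasAntidiagonal.antidiagonal j, v p.2 p.1 x =
        ∑ p ∈ Finset.HasAntidiagonal.antidiagonal j, v p.1 p.2 x := fun j =>
      Finset.sum_nbij' Prod.swap Prod.swap (by simp [add_comm]) (by simp [add_comm]) (by simp)
        (by simp) (by simp)
    simp only [e, Finset.Nat.sum_antidiagonal_eq_sum_range_succ (fun k l => v k l x)]
    rw [Finset.sum_range_diag_flip N (fun k l => v k l x)]
    simp only [Finset.sum_sub_distrib]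
    abel
  · rw [← hq j q hq']
    exact (hh q.2).homogeneous_term q.1

end HasClassicalExpansion

variable {F G : ℕ → EuclideanSpace ℝ (Fin n) → A}

/-- For c ≤ a the bound by |a| is automatic, so the sorted double sum is a single sum over those c ≤
a with |c| ≤ l. -/
theorem twistedPart_eq_sum (G : ℕ → E → A) (a : Fin n → ℕ) (l : ℕ) (ξ : E) :
    D.twistedPart G a l ξ = ∑ c ∈ Finset.Iic a, (binom a (a - c) : ℂ) •
      (if len c ≤ l then D.twistTerm (G (l - len c)) (a - c) c else fun _ => 0) ξ := by
  simp only [twistedPart, Finset.sum_filter]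
  rw [Finset.sum_comm]
  refine Finset.sum_congr rfl fun c hc => ?_
  have hle : len c ≤ len a := Finset.sum_le_sum fun i _ => Finset.mem_Iic.1 hc i
  rw [Finset.sum_ite_eq]
  by_cases h : len c ≤ l
  · rw [if_pos (Finset.mem_range.2 (by omega)), if_pos h, twistTerm, mul_smul]
  · rw [if_neg (fun h' => h (by have := Finset.mem_range.1 h'; omega)), if_neg h, smul_zero]

/-- The operator δ^{a-c} ∂_B^c lowers the order by |c|, so its expansion is shifted by |c|; this is
why the term of index l involves G at l - |c|. -/
theorem HasClassicalExpansion.multiPow_twistDel (hg : D.HasClassicalExpansion m g G)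
    (a : Fin n → ℕ) :
    D.HasClassicalExpansion m (multiPow D.twistDel a g) (D.twistedPart G a) := by
  have h := HasClassicalExpansion.sum (Finset.Iic a) fun c _ =>
    (hg.map (IsOrderOp.twistTerm (a - c) c)).shift.smul (binom a (a - c))
  convert h using 1
  · rw [TwistedSystem.multiPow_twistDel hg.symbol.jointSmooth]
    ext x
    simp [Finset.sum_apply, Nat.cast_smul_eq_nsmul]
  · ext l ξ
    exact twistedPart_eq_sum G a l ξ

/-- The layers are the sums over |a| = k. Differentiating f lowers the order by k, and the operator
on g keeps it, so layer k has order m + m' - k. -/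
theorem HasClassicalExpansion.sharp (hf : D.HasClassicalExpansion m f F)
    (hg : D.HasClassicalExpansion m' g G) :
    D.HasClassicalExpansion (m + m') (D.sharp f g) (D.sharpPart F G) := by
  have h := HasClassicalExpansion.of_layers (isSymbol_sharp_sub_sum hf.symbol hg.symbol)
    fun k => HasClassicalExpansion.sum (m := m + m' - k)
      (Finset.piAntidiag (Finset.univ : Finset (Fin n)) k)
      (F := fun a j x => ((-Complex.I) ^ len a / (fact a : ℂ)) •
        ∑ q ∈ Finset.HasAntidiagonal.antidiagonal j,
          partialPow a (F q.1) x * D.twistedPart G a q.2 x) fun a ha => ?_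
  · convert h using 1
    ext j ξ
    simp only [sharpPart, Finset.smul_sum]
    exact Finset.sum_congr rfl fun p _ => Finset.sum_comm
  · have h1 := ((hf.map (IsOrderOp.partialPow a)).mul (hg.multiPow_twistDel a)).smul
      ((-Complex.I) ^ len a / (fact a : ℂ))
    rw [mem_piAntidiag_univ.1 ha, sub_add_eq_add_sub] at h1
    exact (mem_piAntidiag_univ.1 ha).symm ▸ h1

theorem twistedPart_zero (G : ℕ → E → A) (ξ : E) : D.twistedPart G 0 0 ξ = G 0 ξ := by
  have : Finset.Iic (0 : Fin n → ℕ) = {0} := by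
    ext c
    simp
  rw [twistedPart_eq_sum, this, Finset.sum_singleton]
  simp [twistTerm, binom, twistedPow, multiPow_zero, delta_zero_index]

theorem sharpPart_zero (F G : ℕ → E → A) (ξ : E) : D.sharpPart F G 0 ξ = F 0 ξ * G 0 ξ := by
  simp [sharpPart, Finset.piAntidiag_zero, partialPow_zero, twistedPart_zero, fact]

end TwistedSystem

end

end

theorem mainTheorem5 {n : ℕ} {A : Type*} [CStarAlgebra A] (D : TwistedSystem n A)
    (m m' : ℝ) (f g : EuclideanSpace ℝ (Fin n) → A)
    (F G : ℕ → EuclideanSpace ℝ (Fin n) → A)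
    (hf : D.HasClassicalExpansion m f F) (hg : D.HasClassicalExpansion m' g G) :
    (∀ ξ, D.HasOscIntegral (D.compAmplitude f g ξ) (D.sharp f g ξ)) ∧
      D.IsClassicalSymbol (m + m') (D.sharp f g) ∧
      D.HasClassicalExpansion (m + m') (D.sharp f g) (D.sharpPart F G) ∧
      ∀ ξ, D.sharpPart F G 0 ξ = F 0 ξ * G 0 ξ := by
  exact ⟨TwistedSystem.hasOscIntegral_sharp hf.symbol hg.symbol, ⟨_, hf.sharp hg⟩, hf.sharp hg,
    TwistedSystem.sharpPart_zero F G⟩
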